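/- **Setting.** Let $P$ be a finite set of points in the plane, no three collinear, $\gamma>0$, and let $G_i$ ($i\ge 0$) be the grid of half-open square cells of side $\gamma 3^{i-1}$ with a fixed common origin (so the grids are nested). For a point $u$ let $N_i(u)$ be the $3\times3$ block of cells of $G_i$ centred at the cell of $u$. The level-$i$ adjacency graph $\mathcal G_i$ joins distinct $u,v\in P$ whenever $v\in N_i(u)$. A planar straight-line graph (PSLG) on $P$ is a graph drawn with straight segments such that no point of $P$ lies inside an edge and distinct edges meet at most in a common endpoint. **Algorithm.** Starting at some level $i_0$ from the empty graph, at each level $i$ one greedily adds edges of $\mathcal G_i$ (in any order, each edge that crosses no present one) to the current graph, which gives $\mathcal A_i$; then Phase 1 gives the intermediate graph $\hat{\mathcal A}_i\supseteq\mathcal A_i$, from which level $i+1$ starts. *Phase 1.* The faces of $\mathcal A_i$ are the components of the complement of the drawing; a face is triangulated if it is the interior of a triangle of three edges. Each boundary component (with at least one edge) of each non-triangulated face $f$ is traversed with $f$ on the right, giving a cyclic vertex sequence $v_0,\dots,v_{m-1}$ (indices mod $m$; a point may occur several times). An occurrence $v_k$ is convex if the interior angle of $f$ there is $<\pi$, else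 reflex. If $v_{l-1}$ is the first convex vertex after $v_p$, then $v_{l-1}$ and $v_l$ are the forward convex and forward support vertex of $v_p$; if $v_{q+1}$ is the last convex vertex before $v_r$, then $v_{q+1}$ and $v_q$ are the backward convex and backward support vertex of $v_r$. The support vertex is visible to $v_p$ (resp. $v_r$) if the open segment joining them lies in $f$ and $v_p$ (resp. $v_r$) is on the side of the boundary edge $v_{l-1}v_l$ (resp. $v_qv_{q+1}$) facing $f$. The start vertex $v_0$ is a backward support vertex of some reflex vertex if there is one, otherwise arbitrary. Starting with $p=0$, process $v_p$ as follows, until the traversal is back at $v_m=v_0$. 1. If $v_p$ has a forward convex vertex $v_{l-1}$, $v_{l-1}\in N_i(v_p)$, and $v_l$ is visible to $v_p$: * If $v_{l-1}$ has not been visited: let $s=l$. (a) If $v_{l+1}$ is reflex, has its backward convex vertex in $N_i(v_{l+1})$ and its backward support vertex is visible to it, let instead $v_s$ be the last vertex of the maximal run of consecutive reflex vertices starting at $v_{l+1}$ that has the same two properties. (b) Join each of $v_p,\dots,v_{l-2}$ to $v_l$, and $v_p$ to each of $v_{l+1},\dots,v_s$; continue with $p=s$. * (c) If $v_{l-1}$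 has been visited: join each of $v_p,\dots,v_{m-1}$ to $v_{j'}$, the end of the chain generated from $v_0$; stop. 2. Otherwise add nothing and continue with $p+1$. For an edge $v_av_b$ added in Phase 1, the chain $v_a,v_{a+1},\dots,v_b$ is called a triangulated chain, and $E(v_a,v_b)$ is the region enclosed by this chain and the segment $\overline{v_av_b}$ (the points off this closed polygon with nonzero winding number). **Statement (Lemma and Invariant 1).** For every $i\ge i_0$ and every run of the algorithm (all choices arbitrary), after Phase 1 of level $i$: 1. $\hat{\mathcal A}_i$ is a PSLG on $P$; 2. every edge $uv$ of $\hat{\mathcal A}_i$ that is not in $\mathcal A_i$ has length $\|uv\|\le 4\sqrt2\,\gamma 3^{i-1}$; 3. for every triangulated chain (in particular every maximal one, i.e. one whose added edge is on the boundary of a non-triangulated face of $\hat{\mathcal A}_i$), the region $E$ contains no point of $P$, and its added edge crosses no edge of $\mathcal A_i$ and no other added edge (of the same or another chain). -/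

import Mathlib

namespace GridTriangulation

noncomputable section

/-! The plane is `ℂ`. A straight-line graph on a finite point set is a `SimpleGraph ℂ` all of
whose edges join two of the points; an edge `uv` is drawn as `segment ℝ u v`. -/

/-- `G` is a planar straight-line graph on the vertex set `P`: edges join points of `P`, no point
of `P` lies inside an edge, and two distinct edges meet at most in a common endpoint. -/
structure IsPSLG (P : Finset ℂ) (G : SimpleGraph ℂ) : Prop where
  endpoints : ∀ u v, G.Adj u v → u ∈ P ∧ v ∈ P
  vertex_not_inside : ∀ u v, G.Adj u v → ∀ p ∈ P, p ∉ openSegment ℝ u v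
  noncrossing : ∀ u v x y, G.Adj u v → G.Adj x y → s(u, v) ≠ s(x, y) →
    ∀ z ∈ segment ℝ u v, z ∈ segment ℝ x y → (z = u ∨ z = v) ∧ (z = x ∨ z = y)

/-- The distinct segments `uv` and `xy` cross: they have a common relative interior point. -/
def Crosses (u v x y : ℂ) : Prop :=
  s(u, v) ≠ s(x, y) ∧ ∃ z, z ∈ openSegment ℝ u v ∧ z ∈ openSegment ℝ x y

/-- No three distinct points of `P` are collinear. -/
def GeneralPosition (P : Finset ℂ) : Prop :=
  ∀ a ∈ P, ∀ b ∈ P, ∀ c ∈ P, a ≠ b → b ≠ c → a ≠ c → ¬ Collinear ℝ {a, b, c}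

/-! ### The nested grids -/

/-- Side length of the cells of the level-`i` grid. -/
def cellSide (γ : ℝ) (i : ℕ) : ℝ := γ * (3 : ℝ) ^ ((i : ℤ) - 1)

/-- The (half-open, square) cell of the level-`i` grid with origin `o` that contains `z`. -/
def cell (γ : ℝ) (o : ℂ) (i : ℕ) (z : ℂ) : ℤ × ℤ :=
  (⌊(z - o).re / cellSide γ i⌋, ⌊(z - o).im / cellSide γ i⌋)

/-- `v ∈ N(u)`: the cell of `v` is the cell of `u` or one of the eight cells around it. -/
def Near (γ : ℝ) (o : ℂ) (i : ℕ) (u v : ℂ) : Prop :=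
  |(cell γ o i u).1 - (cell γ o i v).1| ≤ 1 ∧ |(cell γ o i u).2 - (cell γ o i v).2| ≤ 1

/-- The level-`i` adjacency graph: all pairs of distinct points `u`, `v` of `P` with
`v ∈ N(u)`. -/
def adjGraph (P : Finset ℂ) (γ : ℝ) (o : ℂ) (i : ℕ) : SimpleGraph ℂ :=
  SimpleGraph.fromRel fun u v => u ∈ P ∧ v ∈ P ∧ Near γ o i u v

/-- `A` is a possible result of the greedy procedure that runs through the edges of `H` in some
order and adds to `B` each edge that crosses no edge present so far. -/
def IsGreedyExtension (B H A : SimpleGraph ℂ) : Prop :=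
  B ≤ A ∧
  (∀ u v, A.Adj u v → ¬ B.Adj u v → H.Adj u v ∧ ∀ x y, A.Adj x y → ¬ Crosses u v x y) ∧
  (∀ u v, H.Adj u v → ¬ A.Adj u v → ∃ x y, A.Adj x y ∧ Crosses u v x y)

/-! ### Faces and their boundary vertex sequences -/

/-- The union of all vertices and edges. -/
def drawing (P : Finset ℂ) (G : SimpleGraph ℂ) : Set ℂ :=
  {z | z ∈ P ∨ ∃ u v, G.Adj u v ∧ z ∈ segment ℝ u v}

/-- The faces are the connected components of the complement of the drawing (the unbounded one
included). -/
def IsFace (P : Finset ℂ) (G : SimpleGraph ℂ) (f : Set ℂ) : Prop :=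
  ∃ z ∈ (drawing P G)ᶜ, f = connectedComponentIn (drawing P G)ᶜ z

/-- A face is triangulated if it is the interior of a triangle formed by three edges. -/
def IsNonTriangulatedFace (P : Finset ℂ) (G : SimpleGraph ℂ) (f : Set ℂ) : Prop :=
  IsFace P G f ∧
  ¬ ∃ a b c, G.Adj a b ∧ G.Adj b c ∧ G.Adj c a ∧ f = interior (convexHull ℝ {a, b, c})

/-- Counterclockwise angle in `(0, 2π]` at `v` from the direction of `a` to that of `b`. -/
def ccwAngle (v a b : ℂ) : ℝ :=
  toIocMod Real.two_pi_pos 0 (Complex.arg ((b - v) / (a - v)))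

/-- `x` lies strictly to the right of the line directed from `a` to `b`. -/
def RightOf (a b x : ℂ) : Prop :=
  ((x - a) * (starRingEnd ℂ) (b - a)).im < 0

/-- `f` lies immediately to the right when one walks from `u` to `v`. -/
def FaceOnRight (f : Set ℂ) (u v : ℂ) : Prop :=
  ∀ᶠ ε : ℝ in nhdsWithin 0 (Set.Ioi 0), (u + v) / 2 - (ε : ℂ) * (Complex.I * (v - u)) ∈ f

/-- Data of a boundary vertex sequence `⟨v₀, …, v_{m-1}⟩` of a face: the face, the vertices
(indexed by all natural numbers, to be read modulo `m`) and the length `m`. -/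
structure Walk where
  face : Set ℂ
  vert : ℕ → ℂ
  len : ℕ

/-- `w` traverses, once, one component of the boundary of `w.face`, with the face on the right:
after the step from `v_k` to `v_{k+1}` the walk turns to the neighbour of `v_{k+1}` that comes
first in counterclockwise order after `v_k` (back to `v_k` itself if there is no other one). -/
structure IsBoundaryWalk (G : SimpleGraph ℂ) (w : Walk) : Prop where
  len_pos : 0 < w.len
  periodic : ∀ k, w.vert (k + w.len) = w.vert k
  adj : ∀ k, G.Adj (w.vert k) (w.vert (k + 1))
  turn : ∀ k x, G.Adj (w.vert (k + 1)) x →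
    ccwAngle (w.vert (k + 1)) (w.vert k) (w.vert (k + 2)) ≤ ccwAngle (w.vert (k + 1)) (w.vert k) x
  minimal : ∀ k, 0 < k → k < w.len → ¬ (w.vert k = w.vert 0 ∧ w.vert (k + 1) = w.vert 1)
  face_right : FaceOnRight w.face (w.vert 0) (w.vert 1)

namespace Walk

/-- The interior angle of the face at (this occurrence of) `v_k` is less than `π`; otherwise `v_k`
is reflex. -/
def IsConvex (w : Walk) (k : ℕ) : Prop :=
  ccwAngle (w.vert k) (w.vert (k + w.len - 1)) (w.vert (k + 1)) < Real.pi

/-- `v_k` is the backward support vertex of some reflex vertex `v_r`: the last convex vertex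
before `v_r` is `v_{k+1}`. -/
def IsBackwardSupport (w : Walk) (k : ℕ) : Prop :=
  w.IsConvex (k + 1) ∧ ∃ r, k + 1 < r ∧ ∀ t, k + 1 < t → t ≤ r → ¬ w.IsConvex t

/-- Admissible choice of the start vertex `v₀`: a backward support vertex, if there is one. -/
def IsStart (w : Walk) : Prop := (∃ k, w.IsBackwardSupport k) → w.IsBackwardSupport 0

/-- Index of the forward convex vertex of `v_p`: the first convex vertex after `v_p`. Its successor
is the forward support vertex of `v_p`. -/
def fwdConvex (w : Walk) (p : ℕ) : ℕ := sInf {q | p < q ∧ w.IsConvex q}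

/-- Index of the backward convex vertex of `v_r`: the last convex vertex before `v_r`. Its
predecessor is the backward support vertex of `v_r`. -/
def bwdConvex (w : Walk) (r : ℕ) : ℕ := sSup {q | q < r ∧ w.IsConvex q}

/-- The endpoint `y` of the boundary edge with consecutive endpoints `a`, `b` (so `y = a` or
`y = b`) is visible to `x` in the boundary sequence: the open segment `xy` lies in the face, and
`x` is on the side of the edge `ab` that faces the face. -/
def Sees (w : Walk) (x y a b : ℂ) : Prop :=
  openSegment ℝ x y ⊆ w.face ∧ RightOf a b x

/-- Precondition of Step 1 for `v_p`: the forward convex vertex of `v_p` exists and is in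
`N(v_p)`, and the forward support vertex of `v_p` is visible to `v_p`. -/
def Step1 (N : ℂ → ℂ → Prop) (w : Walk) (p : ℕ) : Prop :=
  (∃ q, p < q ∧ w.IsConvex q) ∧
  N (w.vert p) (w.vert (w.fwdConvex p)) ∧
  w.Sees (w.vert p) (w.vert (w.fwdConvex p + 1))
    (w.vert (w.fwdConvex p)) (w.vert (w.fwdConvex p + 1))

/-- The backward convex vertex of `v_r` is in `N(v_r)` and the backward support vertex of `v_r` is
visible to `v_r`. -/
def BackwardOK (N : ℂ → ℂ → Prop) (w : Walk) (r : ℕ) : Prop :=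
  (∃ q, 0 < q ∧ q < r ∧ w.IsConvex q) ∧
  N (w.vert r) (w.vert (w.bwdConvex r)) ∧
  w.Sees (w.vert r) (w.vert (w.bwdConvex r - 1))
    (w.vert (w.bwdConvex r - 1)) (w.vert (w.bwdConvex r))

open Classical in
/-- The end of the chain generated from `v_p` in Steps 1(a) and 1(b). With `v_l` the forward
support vertex of `v_p`: if `v_{l+1}` is reflex and satisfies `BackwardOK`, it is the last vertex
`v_s` of the chain of consecutive reflex vertices starting at `v_{l+1}` that satisfies
`BackwardOK`; otherwise it is `v_l`. -/
def chainEnd (N : ℂ → ℂ → Prop) (w : Walk) (p : ℕ) : ℕ :=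
  if ¬ w.IsConvex (w.fwdConvex p + 2) ∧ w.BackwardOK N (w.fwdConvex p + 2) then
    sSup {s | w.fwdConvex p + 2 ≤ s ∧
      (∀ r, w.fwdConvex p + 2 ≤ r → r ≤ s → ¬ w.IsConvex r) ∧ w.BackwardOK N s}
  else w.fwdConvex p + 1

open Classical in
/-- The position that is handled after `p`: the end of the chain generated from `v_p` in Step 1
(the traversal is over if the forward convex vertex had been visited before, Step 1(c)), and the
next vertex in Step 2. -/
def next (N : ℂ → ℂ → Prop) (w : Walk) (p : ℕ) : ℕ :=
  if w.Step1 N p then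
    if w.len ≤ w.fwdConvex p then w.len else w.chainEnd N p
  else p + 1

/-- The traversal from `v₀` back to `v_m = v₀` handles the position `p`. -/
def IsProcessed (N : ℂ → ℂ → Prop) (w : Walk) (p : ℕ) : Prop :=
  p < w.len ∧ ∃ k : ℕ, (w.next N)^[k] 0 = p

/-- The edge `v_a v_b` is added, so that `v_a, v_{a+1}, …, v_b` is a triangulated chain. This
happens when a vertex `v_p` satisfying the precondition of Step 1 is handled, with forward convex
vertex `v_{l-1}`. If `v_{l-1}` was not visited before, then `v_p, …, v_{l-2}` are joined to `v_l`,
and `v_p` is joined to all vertices after `v_l` up to the end of the generated chain. If it was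
visited before (Step 1(c)), then `v_p, …, v_{m-1}` are joined to the end `v_{m + next 0}` of the
chain generated from the start vertex `v₀ = v_m`. -/
def Adds (N : ℂ → ℂ → Prop) (w : Walk) (a b : ℕ) : Prop :=
  ∃ p, w.IsProcessed N p ∧ w.Step1 N p ∧
    ((w.fwdConvex p < w.len ∧
        ((p ≤ a ∧ a < w.fwdConvex p ∧ b = w.fwdConvex p + 1) ∨
          (a = p ∧ w.fwdConvex p + 1 < b ∧ b ≤ w.chainEnd N p))) ∨
      (w.len ≤ w.fwdConvex p ∧ p ≤ a ∧ a < w.len ∧ b = w.len + w.next N 0))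

/-- The region enclosed by the chain `v_a, …, v_b` and the segment `v_b v_a`: the points off this
closed polygon around which it has nonzero winding number. -/
def region (w : Walk) (a b : ℕ) : Set ℂ :=
  {z | (∀ k, a ≤ k → k < b → z ∉ segment ℝ (w.vert k) (w.vert (k + 1))) ∧
    z ∉ segment ℝ (w.vert b) (w.vert a) ∧
    ∑ k ∈ Finset.Ico a b, Complex.arg ((w.vert (k + 1) - z) / (w.vert k - z))
      + Complex.arg ((w.vert a - z) / (w.vert b - z)) ≠ 0}

end Walk

/-! ### The algorithm -/

/-- `W` contains, for each boundary component with an edge of each non-triangulated face of `A`,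
exactly one traversal, with an admissible start vertex. -/
def IsTraversalFamily (P : Finset ℂ) (A : SimpleGraph ℂ) (W : Set Walk) : Prop :=
  (∀ w ∈ W, IsNonTriangulatedFace P A w.face ∧ IsBoundaryWalk A w ∧ w.IsStart) ∧
  (∀ f, IsNonTriangulatedFace P A f → ∀ u v, A.Adj u v → FaceOnRight f u v →
    ∃! w, w ∈ W ∧ w.face = f ∧ ∃ k, w.vert k = u ∧ w.vert (k + 1) = v)

/-- The graph obtained from `A` by Phase 1 at level `i`, run along the traversals in `W`. -/
def phaseOne (γ : ℝ) (o : ℂ) (i : ℕ) (A : SimpleGraph ℂ) (W : Set Walk) : SimpleGraph ℂ :=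
  A ⊔ SimpleGraph.fromEdgeSet
    {e | ∃ w ∈ W, ∃ a b, w.Adds (Near γ o i) a b ∧ e = s(w.vert a, w.vert b)}

/-- `Reaches P γ o i₀ i A W`: some run of the algorithm on `P` that starts at level `i₀` arrives
at level `i` with the graph `A_i = A` and uses the traversals `W` in Phase 1 of level `i`; hence
the intermediate graph is `phaseOne γ o i A W`. At the first level `A_i` comes from the empty
graph, and at every later level from the intermediate graph of the level before, by greedily
adding edges of the adjacency graph of the level. -/
inductive Reaches (P : Finset ℂ) (γ : ℝ) (o : ℂ) (i₀ : ℕ) :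
    ℕ → SimpleGraph ℂ → Set Walk → Prop
  | first (A : SimpleGraph ℂ) (W : Set Walk)
      (hA : IsGreedyExtension ⊥ (adjGraph P γ o i₀) A) (hW : IsTraversalFamily P A W) :
      Reaches P γ o i₀ i₀ A W
  | later (i : ℕ) (A A' : SimpleGraph ℂ) (W W' : Set Walk) (h : Reaches P γ o i₀ i A W)
      (hA : IsGreedyExtension (phaseOne γ o i A W) (adjGraph P γ o (i + 1)) A')
      (hW : IsTraversalFamily P A' W') :
      Reaches P γ o i₀ (i + 1) A' W'

end

end GridTriangulation

/-! The engine is one invariant, `IsLevelGraph`: the graph `A` of a level is a PSLG, its edges join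
near points, and it contains every segment between two distinct near points of `P` that no edge
crosses. Hence two near points that see each other are adjacent. Whenever an unwanted point of `P`
turns up in a triangle, `exists_first` replaces it by the point that a ray rotating about a vertex
meets first. That point sees two of the vertices. If the grid forces it to be near one of them,
there is an edge in a place where the boundary walk allows none.

The grid enters only through finitely many configurations of cells: each point is reduced to its
cell relative to a reference cell, membership in a convex hull becomes a system of inequalities
between integers, and the four resulting statements are decided by computation
(`cellHull_third_near_origin` and its companions).

Fans: let `V p` satisfy the precondition of Step 1 with convex index `c`. By downward induction on
`j`, the triangle `V j`, `V (j + 1)`, `V (c + 1)` is empty and `V j` sees `V (c + 1)` (`Fwd.fanAt`).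
Reading the walk backwards with the opposite orientation gives the fans of the backward support
vertices; the sign `s` is carried everywhere for this purpose. The chains of Steps 1(a) and 1(c) are
covered by a forward and a backward fan that meet, either in a common convex vertex or in two
consecutive ones. For such a pair, every segment from the left chain to the right one closes an
empty triangle over the preceding segments (`Pair.quad`). A point in such a triangle would have to
be near and not near the same vertex.

So each triangulated chain together with its added edge bounds a tree of empty triangles (`Tree`).
Seen from a point of `P` off the chain, the angles over an empty triangle add up, so the winding
number is zero and the region contains no point. An uncrossed segment that crosses the added edge
can be followed through the triangles and must end in a corner at an inner vertex of the chain. An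
edge of `A` cannot point into a corner, so it crosses no added edge. If another added edge crosses,
then one of its ends is an inner vertex of the first chain; since chains are nested or disjoint, its
chain is shorter. The same holds with the roles exchanged, which is absurd.

Finally, the ends of an added edge are at most three cells apart: one step to a convex vertex, one
between two convex vertices, one to the other end. This bounds the length by `4√2` cell sides, and
it makes the ends near in the grid of the next level, so the invariant passes to that level. -/

namespace GridTriangulation

noncomputable section

section

/-! ### Orientation of triples of points -/

/-- Twice the area of the triangle `a b c`, signed: for `s = 1` it is positive if `c` lies to the
right of the line directed from `a` to `b`, for `s = -1` if it lies to the left. -/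
def side (s : ℝ) (a b c : ℂ) : ℝ :=
  s * ((c.re - a.re) * (b.im - a.im) - (c.im - a.im) * (b.re - a.re))

theorem side_rotate (s : ℝ) (a b c : ℂ) : side s b c a = side s a b c := by
  unfold side; ring

theorem side_rotate' (s : ℝ) (a b c : ℂ) : side s c a b = side s a b c := by
  unfold side; ring

theorem side_swap (s : ℝ) (a b c : ℂ) : side s b a c = -side s a b c := by
  unfold side; ring

theorem side_swap' (s : ℝ) (a b c : ℂ) : side s a c b = -side s a b c := by
  unfold side; ring

theorem side_neg (s : ℝ) (a b c : ℂ) : side (-s) a b c = -side s a b c := by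
  unfold side; ring

@[simp] theorem side_left (s : ℝ) (a b : ℂ) : side s a b a = 0 := by unfold side; ring
@[simp] theorem side_right (s : ℝ) (a b : ℂ) : side s a b b = 0 := by unfold side; ring
@[simp] theorem side_base (s : ℝ) (a b : ℂ) : side s a a b = 0 := by unfold side; ring

theorem side_ne (s : ℝ) {a b c : ℂ} (h : side s a b c ≠ 0) : a ≠ b ∧ b ≠ c ∧ a ≠ c := by
  refine ⟨?_, ?_, ?_⟩ <;> rintro rfl <;> simp at h

/-- The point at parameter `t` of the line from `x` to `y`. -/
def lp (x y : ℂ) (t : ℝ) : ℂ := x + (t : ℂ) * (y - x)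

theorem lp_re (x y : ℂ) (t : ℝ) : (lp x y t).re = x.re + t * (y.re - x.re) := by simp [lp]
theorem lp_im (x y : ℂ) (t : ℝ) : (lp x y t).im = x.im + t * (y.im - x.im) := by simp [lp]

theorem side_lp (s : ℝ) (a b x y : ℂ) (t : ℝ) :
    side s a b (lp x y t) = (1 - t) * side s a b x + t * side s a b y := by
  unfold side; rw [lp_re, lp_im]; ring

theorem mem_segment_lp {x y z : ℂ} : z ∈ segment ℝ x y ↔ ∃ t : ℝ, 0 ≤ t ∧ t ≤ 1 ∧ z = lp x y t := by
  rw [segment_eq_image']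
  simp only [Set.mem_image, Set.mem_Icc, lp, Complex.real_smul]
  exact ⟨fun ⟨t, h, e⟩ => ⟨t, h.1, h.2, e.symm⟩, fun ⟨t, h, h', e⟩ => ⟨t, ⟨h, h'⟩, e.symm⟩⟩

theorem mem_openSegment_lp {x y z : ℂ} :
    z ∈ openSegment ℝ x y ↔ ∃ t : ℝ, 0 < t ∧ t < 1 ∧ z = lp x y t := by
  rw [openSegment_eq_image']
  simp only [Set.mem_image, Set.mem_Ioo, lp, Complex.real_smul]
  exact ⟨fun ⟨t, h, e⟩ => ⟨t, h.1, h.2, e.symm⟩, fun ⟨t, h, h', e⟩ => ⟨t, ⟨h, h'⟩, e.symm⟩⟩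

theorem lp_zero (x y : ℂ) : lp x y 0 = x := by simp [lp]
theorem lp_one (x y : ℂ) : lp x y 1 = y := by simp [lp]

theorem crosses_swap_left {u v x y : ℂ} (h : Crosses u v x y) : Crosses v u x y := by
  obtain ⟨h1, z, h2, h3⟩ := h
  exact ⟨by rwa [Sym2.eq_swap], z, by rwa [openSegment_symm], h3⟩

theorem crosses_swap_right {u v x y : ℂ} (h : Crosses u v x y) : Crosses u v y x := by
  obtain ⟨h1, z, h2, h3⟩ := h
  exact ⟨by rwa [Sym2.eq_swap (a := y)], z, h2, by rwa [openSegment_symm]⟩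

theorem crosses_symm {u v x y : ℂ} (h : Crosses u v x y) : Crosses x y u v := by
  obtain ⟨h1, z, h2, h3⟩ := h
  exact ⟨fun e => h1 e.symm, z, h3, h2⟩

theorem exists_lp_of_side_eq_zero {s : ℝ} (hs : s ≠ 0) {p q e : ℂ} (hpq : p ≠ q)
    (h : side s p q e = 0) : ∃ t : ℝ, e = lp p q t := by
  have h' : (e.re - p.re) * (q.im - p.im) - (e.im - p.im) * (q.re - p.re) = 0 := by
    unfold side at h; exact (mul_eq_zero.mp h).resolve_left hs
  by_cases hr : q.re - p.re = 0
  · have hi : q.im - p.im ≠ 0 := by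
      intro hi
      exact hpq (Complex.ext (by linarith) (by linarith))
    refine ⟨(e.im - p.im) / (q.im - p.im), Complex.ext ?_ ?_⟩
    · rw [lp_re, hr]
      rw [hr] at h'
      have : e.re - p.re = 0 := by
        have : (e.re - p.re) * (q.im - p.im) = 0 := by linarith
        exact (mul_eq_zero.mp this).resolve_right hi
      linarith
    · rw [lp_im]; field_simp; ring
  · refine ⟨(e.re - p.re) / (q.re - p.re), Complex.ext ?_ ?_⟩
    · rw [lp_re]; field_simp; ring
    · rw [lp_im]; field_simp; linarith

theorem collinear_of_side_eq_zero {s : ℝ} (hs : s ≠ 0) {p q e : ℂ} (hpq : p ≠ q)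
    (h : side s p q e = 0) : Collinear ℝ {p, q, e} := by
  obtain ⟨t, rfl⟩ := exists_lp_of_side_eq_zero hs hpq h
  rw [collinear_iff_of_mem (p₀ := p) (by simp)]
  refine ⟨q - p, ?_⟩
  intro x hx
  simp only [Set.mem_insert_iff, Set.mem_singleton_iff] at hx
  rcases hx with rfl | rfl | rfl
  · exact ⟨0, by simp⟩
  · exact ⟨1, by simp⟩
  · exact ⟨t, by simp [lp, add_comm]⟩

theorem GeneralPosition.side_ne_zero {P : Finset ℂ} (gp : GeneralPosition P) {s : ℝ} (hs : s ≠ 0)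
    {a b c : ℂ} (ha : a ∈ P) (hb : b ∈ P) (hc : c ∈ P) (hab : a ≠ b) (hbc : b ≠ c) (hac : a ≠ c) :
    side s a b c ≠ 0 :=
  fun h => gp a ha b hb c hc hab hbc hac (collinear_of_side_eq_zero hs hab h)

theorem GeneralPosition.not_mem_openSegment {P : Finset ℂ} (gp : GeneralPosition P)
    {a b c : ℂ} (ha : a ∈ P) (hb : b ∈ P) (hc : c ∈ P) (hab : a ≠ b) :
    c ∉ openSegment ℝ a b := by
  intro h
  obtain ⟨t, h0, h1, rfl⟩ := mem_openSegment_lp.mp h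
  have h2 : side 1 a b (lp a b t) = 0 := by rw [side_lp]; simp
  refine gp.side_ne_zero (s := 1) one_ne_zero ha hb hc hab ?_ ?_ h2
  · intro e
    have e2 : ((1 - t : ℝ) : ℂ) * (b - a) = 0 := by
      push_cast
      have : b - (a + (t : ℂ) * (b - a)) = 0 := by rw [sub_eq_zero]; exact e
      linear_combination this
    rcases mul_eq_zero.mp e2 with e3 | e3
    · rw [Complex.ofReal_eq_zero] at e3; linarith
    · exact hab (sub_eq_zero.mp e3).symm
  · intro e
    have e2 : (t : ℂ) * (b - a) = 0 := by
      have : (a + (t : ℂ) * (b - a)) - a = 0 := by rw [sub_eq_zero]; exact e.symm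
      linear_combination this
    rcases mul_eq_zero.mp e2 with e3 | e3
    · rw [Complex.ofReal_eq_zero] at e3; linarith
    · exact hab (sub_eq_zero.mp e3).symm

/-- Two segments cross if each one separates the endpoints of the other. -/
theorem exists_mem_openSegment_of_side {s : ℝ} {a b c d : ℂ}
    (h1 : 0 < side s a b c) (h2 : side s a b d < 0)
    (ha : side s c d a < 0) (hb : 0 < side s c d b) :
    ∃ z, z ∈ openSegment ℝ a b ∧ z ∈ openSegment ℝ c d := by
  have key : side s c d b - side s c d a = side s a b c - side s a b d := by unfold side; ring
  have hD : 0 < side s a b c - side s a b d := by linarith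
  have hs : s ≠ 0 := by rintro rfl; simp [side] at h1
  refine ⟨lp c d (side s a b c / (side s a b c - side s a b d)), ?_, ?_⟩
  · refine mem_openSegment_lp.mpr ⟨-side s c d a / (side s a b c - side s a b d), ?_, ?_, ?_⟩
    · exact div_pos (by linarith) hD
    · rw [div_lt_one hD]; linarith
    · have hD' := hD.ne'
      apply Complex.ext
      · rw [lp_re, lp_re]
        field_simp
        unfold side; ring
      · rw [lp_im, lp_im]
        field_simp
        unfold side; ring
  · refine mem_openSegment_lp.mpr ⟨side s a b c / (side s a b c - side s a b d), ?_, ?_, rfl⟩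
    · exact div_pos (by linarith) hD
    · rw [div_lt_one hD]; linarith

theorem crosses_of_side {s : ℝ} {a b c d : ℂ}
    (h1 : 0 < side s a b c) (h2 : side s a b d < 0)
    (ha : side s c d a < 0) (hb : 0 < side s c d b) : Crosses a b c d := by
  refine ⟨fun e => ?_, exists_mem_openSegment_of_side h1 h2 ha hb⟩
  rcases Sym2.eq_iff.mp e with ⟨rfl, rfl⟩ | ⟨rfl, rfl⟩ <;> simp at h1

/-- A point of a segment that starts where three affine functions are positive, at which the first
of them vanishes. -/
theorem exists_exit {t z : ℂ} {f g h : ℂ → ℝ}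
    (hf : ∀ u, f (lp t z u) = (1 - u) * f t + u * f z)
    (hg : ∀ u, g (lp t z u) = (1 - u) * g t + u * g z)
    (hh : ∀ u, h (lp t z u) = (1 - u) * h t + u * h z)
    (ft : 0 < f t) (gt : 0 < g t) (ht : 0 < h t) (hz : ¬ (0 < f z ∧ 0 < g z ∧ 0 < h z)) :
    ∃ u : ℝ, 0 < u ∧ u ≤ 1 ∧ 0 ≤ f (lp t z u) ∧ 0 ≤ g (lp t z u) ∧ 0 ≤ h (lp t z u) ∧
      (f (lp t z u) = 0 ∨ g (lp t z u) = 0 ∨ h (lp t z u) = 0) := by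
  set F : ℝ → ℝ := fun u => min ((1 - u) * f t + u * f z)
    (min ((1 - u) * g t + u * g z) ((1 - u) * h t + u * h z)) with hF
  have hc : ContinuousOn F (Set.Icc 0 1) := by
    apply Continuous.continuousOn; rw [hF]; fun_prop
  have h0 : 0 < F 0 := by simp [hF, ft, gt, ht]
  have h1 : F 1 ≤ 0 := by
    simp only [hF, sub_self, zero_mul, one_mul, zero_add]
    by_contra hcon
    push Not at hcon
    exact hz ⟨(lt_min_iff.mp hcon).1, (lt_min_iff.mp (lt_min_iff.mp hcon).2).1,
      (lt_min_iff.mp (lt_min_iff.mp hcon).2).2⟩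
  obtain ⟨u, hu, hu0⟩ := intermediate_value_Icc' zero_le_one hc ⟨h1, h0.le⟩
  have hup : 0 < u := by
    rcases hu.1.lt_or_eq with h | h
    · exact h
    · rw [← h] at hu0; linarith
  refine ⟨u, hup, hu.2, ?_⟩
  rw [hf, hg, hh]
  simp only [hF] at hu0
  have hge := hu0.ge
  rw [le_min_iff, le_min_iff] at hge
  refine ⟨hge.1, hge.2.1, hge.2.2, ?_⟩
  rcases min_choice ((1 - u) * f t + u * f z)
    (min ((1 - u) * g t + u * g z) ((1 - u) * h t + u * h z)) with e | e
  · left; rw [← e]; exact hu0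
  · right
    rw [e] at hu0
    rcases min_choice ((1 - u) * g t + u * g z) ((1 - u) * h t + u * h z) with e' | e'
    · left; rw [← e']; exact hu0
    · right; rw [← e']; exact hu0

/-! ### Uncrossed segments and the first point of a triangle -/

/-- No edge of `A` crosses the segment `uv`. -/
def Unc (A : SimpleGraph ℂ) (u v : ℂ) : Prop := ∀ x y, A.Adj x y → ¬ Crosses u v x y

theorem Unc.symm {A : SimpleGraph ℂ} {u v : ℂ} (h : Unc A u v) : Unc A v u :=
  fun x y hxy hc => h x y hxy (crosses_swap_left hc)

theorem IsPSLG.unc {P : Finset ℂ} {A : SimpleGraph ℂ} (hA : IsPSLG P A) {u v : ℂ}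
    (h : A.Adj u v) : Unc A u v := by
  rintro x y hxy ⟨hne, z, h1, h2⟩
  have h3 := hA.noncrossing u v x y h hxy hne z (openSegment_subset_segment ℝ _ _ h1)
    (openSegment_subset_segment ℝ _ _ h2)
  obtain ⟨hu, hv⟩ := hA.endpoints u v h
  rcases h3.1 with rfl | rfl
  · exact hA.vertex_not_inside x y hxy _ hu h2
  · exact hA.vertex_not_inside x y hxy _ hv h2

/-- `z` lies in the closed triangle `p q r`. -/
def InTri (s : ℝ) (p q r z : ℂ) : Prop := 0 ≤ side s p q z ∧ 0 ≤ side s q r z ∧ 0 ≤ side s r p z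

/-- No point of `P` but the vertices lies in the triangle `p q r`. -/
def EmptyTri (P : Finset ℂ) (s : ℝ) (p q r : ℂ) : Prop :=
  ∀ z ∈ P, InTri s p q r z → z = p ∨ z = q ∨ z = r

theorem InTri.rotate {s : ℝ} {p q r z : ℂ} (h : InTri s p q r z) : InTri s q r p z :=
  ⟨h.2.1, h.2.2, h.1⟩

theorem EmptyTri.rotate {P : Finset ℂ} {s : ℝ} {p q r : ℂ} (h : EmptyTri P s p q r) :
    EmptyTri P s q r p := by
  intro z hz hi
  have := h z hz hi.rotate.rotate
  tauto

/-- The Plücker relation for four vectors at `p`. -/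
theorem side_pluecker (s : ℝ) (p a b c d : ℂ) :
    side s p a b * side s p c d - side s p a c * side s p b d + side s p a d * side s p b c = 0 := by
  unfold side; ring

theorem side_add (s : ℝ) (p q r z : ℂ) :
    side s p q z + side s q r z + side s r p z = side s p q r := by
  unfold side; ring

theorem eq_of_two_sides {s : ℝ} {p q r z : ℂ} (ht : 0 < side s p q r) (h1 : side s p q z = 0)
    (h2 : side s r p z = 0) : z = p := by
  have hs : s ≠ 0 := by rintro rfl; simp [side] at ht
  obtain ⟨t, rfl⟩ := exists_lp_of_side_eq_zero hs (side_ne s ht.ne').1 h1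
  rw [side_lp, side_right, side_rotate' s p q r] at h2
  have : t = 0 := by
    rcases mul_eq_zero.mp (by linarith : t * side s p q r = 0) with h | h
    · exact h
    · exact absurd h ht.ne'
  rw [this, lp_zero]

theorem mem_segment_of_side {s : ℝ} {p q e : ℂ} {r : ℂ} (hs : s ≠ 0) (hpq : p ≠ q)
    (h : side s p q e = 0) (h1 : 0 ≤ side s q r e) (h2 : 0 ≤ side s r p e)
    (ht : 0 < side s p q r) : e ∈ segment ℝ p q := by
  obtain ⟨t, rfl⟩ := exists_lp_of_side_eq_zero hs hpq h
  rw [side_lp, side_left, side_rotate s p q r] at h1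
  rw [side_lp, side_right, side_rotate' s p q r] at h2
  refine mem_segment_lp.mpr ⟨t, ?_, ?_, rfl⟩
  · by_contra hc; push Not at hc; nlinarith
  · by_contra hc; push Not at hc; nlinarith

theorem mem_openSegment_of_mem_segment {x y z : ℂ} (h : z ∈ segment ℝ x y) (h1 : z ≠ x)
    (h2 : z ≠ y) : z ∈ openSegment ℝ x y :=
  mem_openSegment_of_ne_left_right h1.symm h2.symm h

theorem lp_mem_openSegment_trans {z w t : ℂ} (ht : t ∈ openSegment ℝ z w) {u : ℝ} (h0 : 0 ≤ u)
    (h1 : u < 1) : lp t z u ∈ openSegment ℝ z w := by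
  obtain ⟨a, ha, hb, rfl⟩ := mem_openSegment_lp.mp ht
  refine mem_openSegment_lp.mpr ⟨a * (1 - u), by nlinarith, by nlinarith, ?_⟩
  simp only [lp]; push_cast; ring

end

section

theorem exists_small_lp {t z : ℂ} {f g : ℂ → ℝ}
    (hf : ∀ u, f (lp t z u) = (1 - u) * f t + u * f z)
    (hg : ∀ u, g (lp t z u) = (1 - u) * g t + u * g z) (ft : 0 < f t) (gt : 0 < g t) :
    ∃ u : ℝ, 0 < u ∧ u < 1 ∧ 0 < f (lp t z u) ∧ 0 < g (lp t z u) := by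
  have h1 : ∀ᶠ u : ℝ in nhdsWithin 0 (Set.Ioi 0), 0 < (1 - u) * f t + u * f z := by
    apply Filter.Eventually.filter_mono nhdsWithin_le_nhds
    have : Continuous fun u : ℝ => (1 - u) * f t + u * f z := by fun_prop
    exact this.continuousAt.eventually (lt_mem_nhds (by simpa using ft))
  have h2 : ∀ᶠ u : ℝ in nhdsWithin 0 (Set.Ioi 0), 0 < (1 - u) * g t + u * g z := by
    apply Filter.Eventually.filter_mono nhdsWithin_le_nhds
    have : Continuous fun u : ℝ => (1 - u) * g t + u * g z := by fun_prop
    exact this.continuousAt.eventually (lt_mem_nhds (by simpa using gt))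
  have h3 : ∀ᶠ u : ℝ in nhdsWithin 0 (Set.Ioi 0), u < 1 :=
    Filter.Eventually.filter_mono nhdsWithin_le_nhds (gt_mem_nhds one_pos)
  obtain ⟨u, ⟨⟨h1, h2⟩, h3⟩, h4⟩ := (((h1.and h2).and h3).and self_mem_nhdsWithin).exists
  exact ⟨u, h4, h3, by rw [hf]; exact h1, by rw [hg]; exact h2⟩

/-- In a triangle `p q r`, the point `y` of `P` that comes first when a ray from `p` rotates from
`q` to `r`. -/
structure IsFirst (P : Finset ℂ) (A : SimpleGraph ℂ) (s : ℝ) (p q r y : ℂ) : Prop where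
  mem : y ∈ P
  ne_left : y ≠ p
  ne_right : y ≠ q
  inTri : InTri s p q r y
  strict : y = r ∨ (0 < side s p q y ∧ 0 < side s q r y ∧ 0 < side s r p y)
  first : ∀ z ∈ P, InTri s p q r z → z ≠ p → z ≠ q → z = y ∨ side s p z y < 0
  free : ∀ z w, A.Adj z w → ∀ t ∈ segment ℝ z w,
    ¬ (0 < side s p q t ∧ 0 < side s q r t ∧ 0 < side s p t y)
  unc_right : Unc A q y
  unc_left : Unc A p y

variable {P : Finset ℂ} {A : SimpleGraph ℂ} {s : ℝ}

/-- Among the points of `P` in the triangle, the one in the first direction from `p` has no point of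
`P` before its ray. An edge with a point in the swept part would have to leave that part through `p
q` or `q r`, which are uncrossed, or emanate from `q`, which `h3` forbids, or have both ends beyond
the ray, which is impossible by convexity. -/
theorem exists_first (gp : GeneralPosition P) (hA : IsPSLG P A) {p q r : ℂ}
    (hp : p ∈ P) (hq : q ∈ P) (hr : r ∈ P) (ht : 0 < side s p q r)
    (h1 : Unc A p q) (h2 : Unc A q r)
    (h3 : ∀ w, A.Adj q w → ¬ (0 < side s p q w ∧ 0 < side s q r w)) :
    ∃ y, IsFirst P A s p q r y := by
  classical
  have hs : s ≠ 0 := by rintro rfl; simp [side] at ht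
  obtain ⟨hpq, hqr, hpr⟩ := side_ne s ht.ne'
  have hrS : r ∈ P.filter (fun z => InTri s p q r z ∧ z ≠ p ∧ z ≠ q) := by
    rw [Finset.mem_filter]
    exact ⟨hr, ⟨ht.le, by simp, by simp⟩, hpr.symm, hqr.symm⟩
  -- The quotient grows from `0` on the ray `p q` to `1` on the ray `p r`, so it serves as the angle
  -- at `p`.
  obtain ⟨y, hyS, hmin⟩ := Finset.exists_min_image
    (P.filter (fun z => InTri s p q r z ∧ z ≠ p ∧ z ≠ q))
    (fun z => side s p q z / (side s p q z + side s r p z)) ⟨r, hrS⟩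
  rw [Finset.mem_filter] at hyS
  obtain ⟨hyP, hyT, hyp, hyq⟩ := hyS
  have hstrict : y = r ∨ (0 < side s p q y ∧ 0 < side s q r y ∧ 0 < side s r p y) := by
    by_cases hyr : y = r
    · exact Or.inl hyr
    · right
      exact ⟨lt_of_le_of_ne hyT.1 (gp.side_ne_zero hs hp hq hyP hpq hyq.symm hyp.symm).symm,
        lt_of_le_of_ne hyT.2.1 (gp.side_ne_zero hs hq hr hyP hqr (Ne.symm hyr) hyq.symm).symm,
        lt_of_le_of_ne hyT.2.2 (gp.side_ne_zero hs hr hp hyP hpr.symm hyp.symm (Ne.symm hyr)).symm⟩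
  have hqy : 0 < side s p q y := by
    rcases hstrict with rfl | h
    · exact ht
    · exact h.1
  have hpos : ∀ z, InTri s p q r z → z ≠ p → 0 < side s p q z + side s r p z := by
    intro z hz hzp
    by_contra hcon
    exact hzp (eq_of_two_sides ht (by linarith [hz.1, hz.2.2]) (by linarith [hz.1, hz.2.2]))
  have hfirst : ∀ z ∈ P, InTri s p q r z → z ≠ p → z ≠ q → z = y ∨ side s p z y < 0 := by
    intro z hz hzT hzp hzq
    by_cases hzy : z = y
    · exact Or.inl hzy
    right
    have hle := hmin z (Finset.mem_filter.mpr ⟨hz, hzT, hzp, hzq⟩)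
    rw [div_le_div_iff₀ (hpos y hyT hyp) (hpos z hzT hzp)] at hle
    have pl := side_pluecker s p q z y r
    have e1 := side_rotate s r p z
    have e2 := side_rotate s r p y
    rw [← e1, ← e2] at hle
    have hle' : side s p z y ≤ 0 := by
      by_contra hcon
      push Not at hcon
      nlinarith [mul_pos ht hcon]
    exact lt_of_le_of_ne hle' (gp.side_ne_zero hs hp hz hyP hzp.symm hzy hyp.symm)
  -- The wedge at `p` between `q` and `y` lies in the wedge between `q` and `r`, so the third
  -- inequality of the triangle is automatic there.
  have hcl : ∀ t, 0 ≤ side s p q t → 0 ≤ side s q r t → 0 ≤ side s y p t → 0 ≤ side s r p t := by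
    intro t ht1 ht2 ht3
    have pl := side_pluecker s p q t y r
    rw [← side_rotate s r p t]
    rw [← side_rotate s y p t] at ht3
    have hyr : 0 ≤ side s p y r := by rw [side_rotate s r p y]; exact hyT.2.2
    by_contra hcon
    push Not at hcon
    nlinarith [mul_pos_of_neg_of_neg (neg_lt_zero.mpr hqy) hcon, mul_nonneg ht1 hyr,
      mul_nonneg ht.le ht3]
  have hyp' : ∀ t, side s p t y = side s y p t := fun t => side_rotate s y p t
  have hfree : ∀ z w, A.Adj z w → ∀ t ∈ segment ℝ z w,
      ¬ (0 < side s p q t ∧ 0 < side s q r t ∧ 0 < side s p t y) := by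
    rintro z w hzw t htz ⟨t1, t2, t3⟩
    obtain ⟨hzP, hwP⟩ := hA.endpoints z w hzw
    rw [hyp'] at t3
    have hout : ∀ z ∈ P, ¬ (0 < side s p q z ∧ 0 < side s q r z ∧ 0 < side s y p z) := by
      rintro z hz ⟨a1, a2, a3⟩
      rcases hfirst z hz ⟨a1.le, a2.le, hcl z a1.le a2.le a3.le⟩ (by rintro rfl; simp at a1)
        (by rintro rfl; simp at a1) with rfl | h
      · simp at a3
      · rw [hyp'] at h; linarith
    have htzw : t ∈ openSegment ℝ z w := by
      apply mem_openSegment_of_mem_segment htz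
      · rintro rfl; exact hout _ hzP ⟨t1, t2, t3⟩
      · rintro rfl; exact hout _ hwP ⟨t1, t2, t3⟩
    -- Walk from `t` towards `z` until the swept part is left: the exit is on an uncrossed side, on
    -- the ray `p y`, or at the vertex `z` itself.
    have claim : ∀ z w, A.Adj z w → t ∈ openSegment ℝ z w → z = q ∨ side s y p z ≤ 0 := by
      intro z w hzw htzw
      obtain ⟨hzP, hwP⟩ := hA.endpoints z w hzw
      obtain ⟨u, u0, u1, e1, e2, e3, e0⟩ := exists_exit (side_lp s p q t z) (side_lp s q r t z)
        (side_lp s y p t z) t1 t2 t3 (hout z hzP)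
      have e4 := hcl _ e1 e2 e3
      rcases u1.lt_or_eq with u1 | rfl
      · have hopen := lp_mem_openSegment_trans htzw u0.le u1
        have hnP : lp t z u ∉ P := fun h =>
          hA.vertex_not_inside z w hzw _ h hopen
        rcases e0 with e0 | e0 | e0
        · exfalso
          have hm := mem_segment_of_side hs hpq e0 e2 e4 ht
          have hm' := mem_openSegment_of_mem_segment hm (fun h => hnP (h ▸ hp)) (fun h => hnP (h ▸ hq))
          refine h1 z w hzw ⟨fun e => ?_, _, hm', hopen⟩
          obtain ⟨a, -, -, rfl⟩ := mem_openSegment_lp.mp htzw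
          rcases Sym2.eq_iff.mp e with ⟨rfl, rfl⟩ | ⟨rfl, rfl⟩ <;> simp [side_lp] at t1
        · exfalso
          have hm := mem_segment_of_side hs hqr e0 e4 e1 (by rwa [side_rotate])
          have hm' := mem_openSegment_of_mem_segment hm (fun h => hnP (h ▸ hq)) (fun h => hnP (h ▸ hr))
          refine h2 z w hzw ⟨fun e => ?_, _, hm', hopen⟩
          obtain ⟨a, -, -, rfl⟩ := mem_openSegment_lp.mp htzw
          rcases Sym2.eq_iff.mp e with ⟨rfl, rfl⟩ | ⟨rfl, rfl⟩ <;> simp [side_lp] at t2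
        · right
          rw [side_lp] at e0
          by_contra hcon
          push Not at hcon
          nlinarith
      · rw [lp_one] at e1 e2 e3 e4
        by_cases hzq : z = q
        · exact Or.inl hzq
        right
        by_cases hzp : z = p
        · simp [hzp]
        rcases hfirst z hzP ⟨e1, e2, e4⟩ hzp hzq with rfl | h
        · simp
        · rw [hyp'] at h; exact h.le
    have fin : ∀ w, A.Adj q w → t ∈ openSegment ℝ q w → False := by
      intro w hqw htw
      obtain ⟨a, a0, a1, rfl⟩ := mem_openSegment_lp.mp htw
      rw [side_lp, side_right] at t1
      rw [side_lp, side_left] at t2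
      refine h3 w hqw ⟨?_, ?_⟩
      · by_contra hcon; push Not at hcon; nlinarith
      · by_contra hcon; push Not at hcon; nlinarith
    rcases claim z w hzw htzw with rfl | hz
    · exact fin w hzw htzw
    rcases claim w z hzw.symm (by rwa [openSegment_symm]) with rfl | hw
    · exact fin z hzw.symm (by rwa [openSegment_symm])
    obtain ⟨a, a0, a1, rfl⟩ := mem_openSegment_lp.mp htzw
    rw [side_lp] at t3
    nlinarith
  have hqry : ∀ a : ℝ, 0 < a → a < 1 → 0 < side s q r (lp p y a) := by
    intro a a0 a1
    rw [side_lp, side_rotate s p q r]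
    nlinarith [mul_nonneg a0.le hyT.2.1, mul_pos (sub_pos.mpr a1) ht]
  refine ⟨y, hyP, hyp, hyq, hyT, hstrict, hfirst, hfree, ?_, ?_⟩
  · rcases hstrict with rfl | hst
    · exact h2
    rintro z w hzw ⟨-, t, ht1, ht2⟩
    obtain ⟨a, a0, a1, rfl⟩ := mem_openSegment_lp.mp ht1
    refine hfree z w hzw _ (openSegment_subset_segment ℝ _ _ ht2) ⟨?_, ?_, ?_⟩
    · rw [side_lp, side_right]; nlinarith [mul_pos a0 hst.1]
    · rw [side_lp, side_left]; nlinarith [mul_pos a0 hst.2.1]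
    · rw [hyp', side_lp, side_left, ← side_rotate s y p q]
      nlinarith [mul_pos (sub_pos.mpr a1) hst.1]
  -- The open segment `p y` only bounds the free part. An edge that meets it transversally has
  -- points in the free part close to the crossing, and an edge along its line is `p y` itself by
  -- general position.
  · rintro z w hzw ⟨hne, t, ht1, ht2⟩
    obtain ⟨hzP, hwP⟩ := hA.endpoints z w hzw
    obtain ⟨a, a0, a1, rfl⟩ := mem_openSegment_lp.mp ht1
    have t1 : 0 < side s p q (lp p y a) := by
      rw [side_lp, side_left]; nlinarith [mul_pos a0 hqy]
    have t2 := hqry a a0 a1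
    have t3 : side s y p (lp p y a) = 0 := by rw [side_lp]; simp
    have fin : ∀ z w, A.Adj z w → lp p y a ∈ openSegment ℝ z w → 0 < side s y p z → False := by
      intro z w hzw ht2 hz
      obtain ⟨u, u0, u1, f1, f2⟩ := exists_small_lp (side_lp s p q _ z) (side_lp s q r _ z) t1 t2
      refine hfree z w hzw _ (openSegment_subset_segment ℝ _ _
        (lp_mem_openSegment_trans ht2 u0.le u1)) ⟨f1, f2, ?_⟩
      rw [hyp', side_lp, t3]
      nlinarith [mul_pos u0 hz]
    obtain ⟨b, b0, b1, hb⟩ := mem_openSegment_lp.mp ht2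
    have hb' : (1 - b) * side s y p z + b * side s y p w = 0 := by
      rw [← side_lp, ← hb, t3]
    rcases lt_trichotomy (side s y p z) 0 with hz | hz | hz
    · refine fin w z hzw.symm (by rwa [openSegment_symm]) ?_
      by_contra hcon; push Not at hcon
      nlinarith [mul_pos_of_neg_of_neg (neg_lt_zero.mpr (sub_pos.mpr b1)) hz]
    · have hw : side s y p w = 0 := by
        rw [hz] at hb'
        rcases mul_eq_zero.mp (by linarith : b * side s y p w = 0) with h | h
        · linarith
        · exact h
      have hin : ∀ z ∈ P, side s y p z = 0 → z = p ∨ z = y := by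
        intro z hzP hz
        by_contra hcon
        push Not at hcon
        exact gp.side_ne_zero hs hyP hp hzP hyp hcon.1.symm hcon.2.symm hz
      rcases hin z hzP hz with rfl | rfl <;> rcases hin w hwP hw with rfl | rfl
      · exact hzw.ne rfl
      · exact hne rfl
      · exact hne (Sym2.eq_swap)
      · exact hzw.ne rfl
    · exact fin z w hzw ht2 hz

theorem IsFirst.side_pos {p q r y : ℂ} (h : IsFirst P A s p q r y) (ht : 0 < side s p q r) :
    0 < side s p q y := by
  rcases h.strict with e | e
  · rw [e]; exact ht
  · exact e.1

/-- No edge at `p` points into the part of the triangle between `q` and the first point. -/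
theorem IsFirst.no_adj {p q r y w : ℂ} (h : IsFirst P A s p q r y) (ht : 0 < side s p q r)
    (hw : A.Adj p w) : ¬ (0 < side s p q w ∧ 0 < side s p w y) := by
  rintro ⟨h1, h2⟩
  have key : ∀ a : ℝ, side s q r (lp p w a) = (1 - a) * side s p q r + a * side s q r w := by
    intro a; rw [side_lp, side_rotate s p q r]
  obtain ⟨u, u0, u1, f1, -⟩ := exists_small_lp (side_lp s q r p w) (side_lp s q r p w)
    (by rwa [side_rotate]) (by rwa [side_rotate])
  refine h.free p w hw (lp p w u) (mem_segment_lp.mpr ⟨u, u0.le, u1.le, rfl⟩) ⟨?_, f1, ?_⟩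
  · rw [side_lp, side_left]; nlinarith [mul_pos u0 h1]
  · rw [side_rotate s y p, side_lp, side_right, ← side_rotate s y p w]
    nlinarith [mul_pos u0 h2]

/-- The triangle up to the first point is empty. -/
theorem IsFirst.emptyTri {p q r y : ℂ} (h : IsFirst P A s p q r y) (ht : 0 < side s p q r) :
    EmptyTri P s p q y := by
  intro z hz hi
  by_contra hcon
  push Not at hcon
  have hq := h.side_pos ht
  have hr : 0 ≤ side s q r z := by
    have pl := side_pluecker s q p y r z
    have e1 : side s q p y = - side s p q y := side_swap s p q y
    have e2 : side s q p r = - side s p q r := side_swap s p q r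
    have e3 : side s q p z = - side s p q z := side_swap s p q z
    have e4 : side s q y r = - side s q r y := side_swap' s q r y
    rw [e1, e2, e3, e4] at pl
    by_contra hc
    push Not at hc
    nlinarith [mul_pos_of_neg_of_neg (neg_lt_zero.mpr hq) hc, mul_nonneg ht.le hi.2.1,
      mul_nonneg hi.1 h.inTri.2.1]
  have hrp : 0 ≤ side s r p z := by
    have pl := side_pluecker s p q z y r
    rw [side_rotate s r p z, side_rotate s r p y, side_rotate s y p z] at pl
    by_contra hc
    push Not at hc
    nlinarith [mul_pos_of_neg_of_neg (neg_lt_zero.mpr hq) hc, mul_nonneg hi.1 h.inTri.2.2,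
      mul_nonneg ht.le hi.2.2]
  rcases h.first z hz ⟨hi.1, hr, hrp⟩ hcon.1 hcon.2.1 with e | e
  · exact hcon.2.2 e
  · rw [side_rotate s y p z] at e
    linarith [hi.2.2]

end

section

/-! ### Angles -/

theorem ccwAngle_pos (v a b : ℂ) : 0 < ccwAngle v a b :=
  (toIocMod_mem_Ioc Real.two_pi_pos 0 _).1

theorem ccwAngle_le (v a b : ℂ) : ccwAngle v a b ≤ 2 * Real.pi := by
  have := (toIocMod_mem_Ioc Real.two_pi_pos 0 (Complex.arg ((b - v) / (a - v)))).2
  unfold ccwAngle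
  rwa [zero_add] at this

theorem ccwAngle_coe (v a b : ℂ) :
    (ccwAngle v a b : Real.Angle) = (Complex.arg ((b - v) / (a - v)) : Real.Angle) := by
  rw [Real.Angle.angle_eq_iff_two_pi_dvd_sub]
  refine ⟨-toIocDiv Real.two_pi_pos 0 (Complex.arg ((b - v) / (a - v))), ?_⟩
  have := toIocMod_add_toIocDiv_zsmul Real.two_pi_pos 0 (Complex.arg ((b - v) / (a - v)))
  unfold ccwAngle
  rw [zsmul_eq_mul] at this
  push_cast
  linarith

/-- Both sides agree modulo a full turn, and all three angles lie in `(0, 2π]`, so they differ by at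
most one turn. -/
theorem ccwAngle_add {v a b c : ℂ} (ha : a ≠ v) (hb : b ≠ v) (hc : c ≠ v) :
    ccwAngle v a b + ccwAngle v b c = ccwAngle v a c ∨
      ccwAngle v a b + ccwAngle v b c = ccwAngle v a c + 2 * Real.pi := by
  have ha' := sub_ne_zero.mpr ha
  have hb' := sub_ne_zero.mpr hb
  have hc' := sub_ne_zero.mpr hc
  have h : ((ccwAngle v a b + ccwAngle v b c : ℝ) : Real.Angle) = (ccwAngle v a c : Real.Angle) := by
    rw [Real.Angle.coe_add, ccwAngle_coe, ccwAngle_coe, ccwAngle_coe,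
      ← Complex.arg_mul_coe_angle (div_ne_zero hb' ha') (div_ne_zero hc' hb')]
    congr 2
    field_simp
  obtain ⟨k, hk⟩ := Real.Angle.angle_eq_iff_two_pi_dvd_sub.mp h
  have h1 := ccwAngle_pos v a b
  have h2 := ccwAngle_pos v b c
  have h3 := ccwAngle_pos v a c
  have h4 := ccwAngle_le v a b
  have h5 := ccwAngle_le v b c
  have h6 := ccwAngle_le v a c
  have hpi := Real.pi_pos
  have k1 : (-1 : ℝ) < k := by
    by_contra hcon; push Not at hcon; nlinarith
  have k2 : (k : ℝ) < 2 := by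
    by_contra hcon; push Not at hcon; nlinarith
  have k1' : -1 < k := by exact_mod_cast k1
  have k2' : k < 2 := by exact_mod_cast k2
  obtain rfl | rfl : k = 0 ∨ k = 1 := by omega
  · left; push_cast at hk; linarith
  · right; push_cast at hk; linarith

theorem ccwAngle_self {v a : ℂ} (ha : a ≠ v) : ccwAngle v a a = 2 * Real.pi := by
  unfold ccwAngle
  rw [div_self (sub_ne_zero.mpr ha), Complex.arg_one, toIocMod_apply_left]
  ring

theorem side_eq_im {v a b : ℂ} (ha : a ≠ v) :
    ((b - v) / (a - v)).im * Complex.normSq (a - v) = -side 1 v a b := by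
  have h : Complex.normSq (a - v) ≠ 0 := Complex.normSq_pos.mpr (sub_ne_zero.mpr ha) |>.ne'
  rw [Complex.div_im]
  field_simp
  unfold side
  simp only [Complex.sub_re, Complex.sub_im]
  ring

theorem ccwAngle_of_side_neg {v a b : ℂ} (h : side 1 v a b < 0) : ccwAngle v a b < Real.pi := by
  have ha : a ≠ v := (side_ne 1 h.ne).1.symm
  have hn := Complex.normSq_pos.mpr (sub_ne_zero.mpr ha)
  have him : 0 < ((b - v) / (a - v)).im := by
    have := side_eq_im (b := b) ha
    by_contra hcon; push Not at hcon; nlinarith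
  have h1 : 0 ≤ Complex.arg ((b - v) / (a - v)) := Complex.arg_nonneg_iff.mpr him.le
  have h2 : Complex.arg ((b - v) / (a - v)) ≠ 0 := fun e => by
    rw [Complex.arg_eq_zero_iff] at e; linarith [e.2]
  have h3 : Complex.arg ((b - v) / (a - v)) ≠ Real.pi := fun e => by
    rw [Complex.arg_eq_pi_iff] at e; linarith [e.2]
  have h4 := Complex.arg_le_pi ((b - v) / (a - v))
  have hpi := Real.pi_pos
  have h5 : ccwAngle v a b = Complex.arg ((b - v) / (a - v)) := by
    unfold ccwAngle
    rw [toIocMod_eq_self]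
    exact ⟨lt_of_le_of_ne h1 h2.symm, by linarith⟩
  rw [h5]
  exact lt_of_le_of_ne h4 h3

theorem ccwAngle_of_side_pos {v a b : ℂ} (h : 0 < side 1 v a b) :
    Real.pi < ccwAngle v a b ∧ ccwAngle v a b < 2 * Real.pi := by
  have ha : a ≠ v := (side_ne 1 h.ne').1.symm
  have hb : b ≠ v := (side_ne 1 h.ne').2.2.symm
  have h' : side 1 v b a < 0 := by rw [side_swap']; linarith
  have h1 := ccwAngle_of_side_neg h'
  have h2 := ccwAngle_pos v b a
  have h3 := ccwAngle_pos v a b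
  have h4 := ccwAngle_le v a b
  have hpi := Real.pi_pos
  have := ccwAngle_add ha hb ha
  rw [ccwAngle_self ha] at this
  rcases this with e | e
  · exact ⟨by linarith, by linarith⟩
  · linarith

/-- The angle at `v` from the direction of `a` to that of `b`, counterclockwise for `0 < s` and
clockwise otherwise. -/
def ang (s : ℝ) (v a b : ℂ) : ℝ := if 0 < s then ccwAngle v a b else ccwAngle v b a

theorem ang_one (v a b : ℂ) : ang 1 v a b = ccwAngle v a b := by simp [ang]

theorem ang_neg {s : ℝ} (hs : s = 1 ∨ s = -1) (v a b : ℂ) : ang (-s) v a b = ang s v b a := by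
  rcases hs with rfl | rfl <;> norm_num [ang]

theorem ang_pos (s : ℝ) (v a b : ℂ) : 0 < ang s v a b := by
  unfold ang; split_ifs <;> exact ccwAngle_pos _ _ _

theorem ang_le (s : ℝ) (v a b : ℂ) : ang s v a b ≤ 2 * Real.pi := by
  unfold ang; split_ifs <;> exact ccwAngle_le _ _ _

theorem ang_add (s : ℝ) {v a b c : ℂ} (ha : a ≠ v) (hb : b ≠ v) (hc : c ≠ v) :
    ang s v a b + ang s v b c = ang s v a c ∨
      ang s v a b + ang s v b c = ang s v a c + 2 * Real.pi := by
  unfold ang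
  split_ifs
  · exact ccwAngle_add ha hb hc
  · rcases ccwAngle_add hc hb ha with h | h
    · left; linarith
    · right; linarith

theorem ang_self (s : ℝ) {v a : ℂ} (ha : a ≠ v) : ang s v a a = 2 * Real.pi := by
  unfold ang; split_ifs <;> exact ccwAngle_self ha

theorem ang_of_side_neg {s : ℝ} (hs : s = 1 ∨ s = -1) {v a b : ℂ} (h : side s v a b < 0) :
    ang s v a b < Real.pi := by
  rcases hs with rfl | rfl
  · rw [ang_one]; exact ccwAngle_of_side_neg h
  · rw [ang_neg (Or.inl rfl), ang_one]
    apply ccwAngle_of_side_neg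
    rw [side_neg] at h
    rw [side_swap']; exact h

theorem ang_of_side_pos {s : ℝ} (hs : s = 1 ∨ s = -1) {v a b : ℂ} (h : 0 < side s v a b) :
    Real.pi < ang s v a b ∧ ang s v a b < 2 * Real.pi := by
  rcases hs with rfl | rfl
  · rw [ang_one]; exact ccwAngle_of_side_pos h
  · rw [ang_neg (Or.inl rfl), ang_one]
    apply ccwAngle_of_side_pos
    rw [side_neg] at h
    rw [side_swap']; exact h

theorem ang_add_ang_symm {s : ℝ} (hs : s = 1 ∨ s = -1) {v a b : ℂ} (h : side s v a b ≠ 0) :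
    ang s v a b + ang s v b a = 2 * Real.pi := by
  have ha : a ≠ v := (side_ne s h).1.symm
  have hb : b ≠ v := (side_ne s h).2.2.symm
  have h1 := ang_le s v a b
  have h2 := ang_le s v b a
  have h3 : ang s v a b < 2 * Real.pi ∨ ang s v b a < 2 * Real.pi := by
    have := Real.pi_pos
    rcases lt_or_gt_of_ne h with h | h
    · left; have := ang_of_side_neg hs h; linarith
    · left; exact (ang_of_side_pos hs h).2
  have := ang_add s ha hb ha
  rw [ang_self s ha] at this
  rcases this with e | e
  · exact e
  · rcases h3 with h3 | h3 <;> linarith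

/-- If the angles at `v` from `a` to `b` and from `b` to `c` are less than `π` and so is their sum,
then they add up. -/
theorem ang_add_of_side {s : ℝ} (hs : s = 1 ∨ s = -1) {v a b c : ℂ} (h1 : side s v a b < 0)
    (h2 : side s v b c < 0) : ang s v a b + ang s v b c = ang s v a c := by
  have ha : a ≠ v := (side_ne s h1.ne).1.symm
  have hb : b ≠ v := (side_ne s h1.ne).2.2.symm
  have hc : c ≠ v := (side_ne s h2.ne).2.2.symm
  have h3 := ang_of_side_neg hs h1
  have h4 := ang_of_side_neg hs h2
  have h5 := ang_pos s v a c
  rcases ang_add s ha hb hc with h | h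
  · exact h
  · linarith

end

section

/-! ### Cells of points in a convex hull -/

/-- The grid distance of the two cells is at most one. -/
def CellNear (a b : ℤ × ℤ) : Prop := |a.1 - b.1| ≤ 1 ∧ |a.2 - b.2| ≤ 1

instance (a b : ℤ × ℤ) : Decidable (CellNear a b) := by unfold CellNear; infer_instance

theorem CellNear.symm {a b : ℤ × ℤ} (h : CellNear a b) : CellNear b a := by
  unfold CellNear at *; rw [abs_sub_comm, abs_sub_comm b.2]; exact h

theorem cellNear_sub (a b c : ℤ × ℤ) : CellNear (a - c) (b - c) ↔ CellNear a b := by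
  simp [CellNear]

/-- Necessary condition for the cell `z` to contain a point of the convex hull of four points in
the cells `a`, `b`, `c`, `d`. -/
def CellHull (a b c d z : ℤ × ℤ) : Prop :=
  (min (min a.1 b.1) (min c.1 d.1) ≤ z.1 ∧ z.1 ≤ max (max a.1 b.1) (max c.1 d.1)) ∧
  (min (min a.2 b.2) (min c.2 d.2) ≤ z.2 ∧ z.2 ≤ max (max a.2 b.2) (max c.2 d.2)) ∧
  (min (min (a.1 + a.2) (b.1 + b.2)) (min (c.1 + c.2) (d.1 + d.2)) - 1 ≤ z.1 + z.2 ∧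
    z.1 + z.2 ≤ max (max (a.1 + a.2) (b.1 + b.2)) (max (c.1 + c.2) (d.1 + d.2)) + 1) ∧
  (min (min (a.1 - a.2) (b.1 - b.2)) (min (c.1 - c.2) (d.1 - d.2)) - 1 ≤ z.1 - z.2 ∧
    z.1 - z.2 ≤ max (max (a.1 - a.2) (b.1 - b.2)) (max (c.1 - c.2) (d.1 - d.2)) + 1)

instance (a b c d z : ℤ × ℤ) : Decidable (CellHull a b c d z) := by
  unfold CellHull; infer_instance

/-- The cells at distance at most `n` from the origin. -/
def cellBox (n : ℤ) : Finset (ℤ × ℤ) := Finset.Icc (-n) n ×ˢ Finset.Icc (-n) n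

theorem mem_cellBox {n : ℤ} {a : ℤ × ℤ} :
    a ∈ cellBox n ↔ (-n ≤ a.1 ∧ a.1 ≤ n) ∧ (-n ≤ a.2 ∧ a.2 ≤ n) := by
  simp [cellBox]

theorem CellHull.mem_cellBox {a b c d z : ℤ × ℤ} (h : CellHull a b c d z) {n : ℤ}
    (ha : a ∈ cellBox n) (hb : b ∈ cellBox n) (hc : c ∈ cellBox n) (hd : d ∈ cellBox n) :
    z ∈ cellBox n := by
  rw [GridTriangulation.mem_cellBox] at *
  obtain ⟨⟨h1, h2⟩, ⟨h3, h4⟩, -⟩ := h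
  refine ⟨⟨le_trans ?_ h1, le_trans h2 ?_⟩, ⟨le_trans ?_ h3, le_trans h4 ?_⟩⟩
  · simp only [le_min_iff]; tauto
  · simp only [max_le_iff]; tauto
  · simp only [le_min_iff]; tauto
  · simp only [max_le_iff]; tauto

/-- Here `0` is the cell of a point `c` near both `p` and `d`. The part of the triangle away from
`d` fits into mutually adjacent cells if `p` is itself away from `d`. -/
theorem cellHull_third_near_origin : ∀ p ∈ cellBox 1, ∀ d ∈ cellBox 1, ¬ CellNear p d →
    ∀ q ∈ cellBox 1, CellHull p 0 d d q → ¬ CellNear q d →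
    ∀ q' ∈ cellBox 1, CellHull p 0 d d q' → ¬ CellNear q' d → CellNear q q' := by
  decide +kernel

/-- In a triangle whose apex is near the two other vertices, those two already dominate all cells of
the triangle. -/
theorem cellHull_cover_origin : ∀ y ∈ cellBox 1, ∀ d ∈ cellBox 1, ∀ v ∈ cellBox 1,
    CellHull 0 y d d v → CellNear v y ∨ CellNear v d := by
  decide +kernel

/-- The cells `a`, `0`, `d`, `b` are those of the end of a left chain, two consecutive convex
vertices and the end of a right chain. One hull cell away from `0`, `d` and `a` restricts the shape
so much that all hull cells away from `0` and `d` are near `b`. -/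
theorem cellHull_quad_origin : ∀ d ∈ cellBox 1, ∀ a ∈ cellBox 1, ¬ CellNear a d →
    ∀ b ∈ cellBox 2, CellNear b d → ¬ CellNear b 0 →
    (∃ w ∈ cellBox 2, CellHull a b 0 d w ∧ ¬ CellNear w 0 ∧ ¬ CellNear w d ∧ ¬ CellNear w a) →
    ∀ w ∈ cellBox 2, CellHull a b 0 d w → ¬ CellNear w 0 → ¬ CellNear w d → CellNear w b := by
  decide +kernel

/-- Necessary condition for segments that join points of the cells `a`, `b` and `c`, `d` to
meet. -/
def CellCross (a b c d : ℤ × ℤ) : Prop :=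
  (∃ x ∈ cellBox 2, CellHull a b b b x ∧ CellHull c d d d x) ∧
  (min (a.1 + a.2) (b.1 + b.2) ≤ max (c.1 + c.2) (d.1 + d.2) + 1 ∧
    min (c.1 + c.2) (d.1 + d.2) ≤ max (a.1 + a.2) (b.1 + b.2) + 1) ∧
  (min (a.1 - a.2) (b.1 - b.2) ≤ max (c.1 - c.2) (d.1 - d.2) + 1 ∧
    min (c.1 - c.2) (d.1 - d.2) ≤ max (a.1 - a.2) (b.1 - b.2) + 1)

instance (a b c d : ℤ × ℤ) : Decidable (CellCross a b c d) := by
  unfold CellCross; infer_instance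

/-- A common cell alone is too weak to exclude a meeting of the segments, because the diagonal
bounds would be rounded twice; hence the direct comparison of diagonals in `CellCross`. -/
theorem cellCross_origin : ∀ p ∈ cellBox 1, ∀ d ∈ cellBox 1, ¬ CellNear p d →
    ∀ z ∈ cellBox 2, CellNear d z → ¬ CellNear 0 z → ¬ CellCross 0 p d z := by
  decide +kernel

/-- `z` lies in every closed half-plane that contains `a`, `b`, `c` and `d`. -/
def InHull (a b c d z : ℂ) : Prop :=
  ∀ α β m : ℝ, m ≤ α * a.re + β * a.im → m ≤ α * b.re + β * b.im → m ≤ α * c.re + β * c.im →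
    m ≤ α * d.re + β * d.im → m ≤ α * z.re + β * z.im

theorem InTri.inHull {s : ℝ} {p q r z : ℂ} (h : InTri s p q r z) (ht : 0 < side s p q r) :
    InHull p q r r z := by
  intro α β m hp hq hr _
  have key : (α * z.re + β * z.im - m) * side s p q r = (α * p.re + β * p.im - m) * side s q r z +
      (α * q.re + β * q.im - m) * side s r p z + (α * r.re + β * r.im - m) * side s p q z := by
    unfold side; ring
  have : 0 ≤ (α * z.re + β * z.im - m) * side s p q r := by
    rw [key]
    have := mul_nonneg (sub_nonneg.mpr hp) h.2.1
    have := mul_nonneg (sub_nonneg.mpr hq) h.2.2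
    have := mul_nonneg (sub_nonneg.mpr hr) h.1
    linarith
  by_contra hcon
  push Not at hcon
  nlinarith

theorem inHull_of_mem_segment {a b z : ℂ} (h : z ∈ segment ℝ a b) : InHull a b b b z := by
  intro α β m ha hb _ _
  obtain ⟨t, t0, t1, rfl⟩ := mem_segment_lp.mp h
  rw [lp_re, lp_im]
  nlinarith [mul_nonneg t0 (sub_nonneg.mpr hb), mul_nonneg (sub_nonneg.mpr t1) (sub_nonneg.mpr ha)]

theorem InHull.trans {a b c d p q r t z : ℂ} (h : InHull p q r t z) (hp : InHull a b c d p)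
    (hq : InHull a b c d q) (hr : InHull a b c d r) (ht : InHull a b c d t) :
    InHull a b c d z := by
  intro α β m h1 h2 h3 h4
  exact h α β m (hp α β m h1 h2 h3 h4) (hq α β m h1 h2 h3 h4) (hr α β m h1 h2 h3 h4)
    (ht α β m h1 h2 h3 h4)

theorem inHull_fst (a b c d : ℂ) : InHull a b c d a := fun _ _ _ h _ _ _ => h
theorem inHull_snd (a b c d : ℂ) : InHull a b c d b := fun _ _ _ _ h _ _ => h
theorem inHull_trd (a b c d : ℂ) : InHull a b c d c := fun _ _ _ _ _ h _ => h
theorem inHull_fth (a b c d : ℂ) : InHull a b c d d := fun _ _ _ _ _ _ h => h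

variable {γ : ℝ} {o : ℂ} {i : ℕ}

/-- Coordinates with the cell side as unit. -/
theorem exists_coord (γ : ℝ) (o : ℂ) (i : ℕ) : ∃ μ ξ η : ℝ, ∀ z : ℂ,
    (((cell γ o i z).1 : ℝ) ≤ μ * z.re + ξ ∧ μ * z.re + ξ < (cell γ o i z).1 + 1) ∧
    (((cell γ o i z).2 : ℝ) ≤ μ * z.im + η ∧ μ * z.im + η < (cell γ o i z).2 + 1) := by
  refine ⟨(cellSide γ i)⁻¹, -o.re * (cellSide γ i)⁻¹, -o.im * (cellSide γ i)⁻¹, fun z => ?_⟩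
  have e1 : (cellSide γ i)⁻¹ * z.re + -o.re * (cellSide γ i)⁻¹ = (z - o).re / cellSide γ i := by
    rw [Complex.sub_re, div_eq_mul_inv]; ring
  have e2 : (cellSide γ i)⁻¹ * z.im + -o.im * (cellSide γ i)⁻¹ = (z - o).im / cellSide γ i := by
    rw [Complex.sub_im, div_eq_mul_inv]; ring
  rw [e1, e2]
  exact ⟨⟨Int.floor_le _, Int.lt_floor_add_one _⟩, ⟨Int.floor_le _, Int.lt_floor_add_one _⟩⟩

theorem InHull.exists_le {a b c d z : ℂ} (h : InHull a b c d z) (α β : ℝ) :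
    α * a.re + β * a.im ≤ α * z.re + β * z.im ∨ α * b.re + β * b.im ≤ α * z.re + β * z.im ∨
    α * c.re + β * c.im ≤ α * z.re + β * z.im ∨ α * d.re + β * d.im ≤ α * z.re + β * z.im := by
  by_contra hcon
  push Not at hcon
  obtain ⟨h1, h2, h3, h4⟩ := hcon
  have := h α β (min (min (α * a.re + β * a.im) (α * b.re + β * b.im))
    (min (α * c.re + β * c.im) (α * d.re + β * d.im))) (by simp) (by simp) (by simp) (by simp)
  simp only [min_le_iff] at this
  rcases this with (h | h) | h | h <;> linarith

/-- A linear function on a convex hull is bounded by its values at the generators. Applied in the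
axis directions this gives exact bounds on cells, and in the diagonal directions bounds with an
error of one, since two coordinates are rounded down. -/
theorem InHull.cellHull {a b c d z : ℂ} (h : InHull a b c d z) (k : ℤ × ℤ) :
    CellHull (cell γ o i a - k) (cell γ o i b - k) (cell γ o i c - k) (cell γ o i d - k)
      (cell γ o i z - k) := by
  obtain ⟨μ, ξ, η, hc⟩ := exists_coord γ o i
  have key : ∀ (u v : ℤ) (e : ℤ), (∀ p : ℂ,
      (u : ℝ) * (μ * p.re + ξ) + v * (μ * p.im + η) ≤
        (u * μ) * z.re + (v * μ) * z.im + u * ξ + v * η →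
      u * (cell γ o i p).1 + v * (cell γ o i p).2 ≤
        u * (cell γ o i z).1 + v * (cell γ o i z).2 + e) →
      (u * (cell γ o i a).1 + v * (cell γ o i a).2 ≤
        u * (cell γ o i z).1 + v * (cell γ o i z).2 + e) ∨
      (u * (cell γ o i b).1 + v * (cell γ o i b).2 ≤
        u * (cell γ o i z).1 + v * (cell γ o i z).2 + e) ∨
      (u * (cell γ o i c).1 + v * (cell γ o i c).2 ≤
        u * (cell γ o i z).1 + v * (cell γ o i z).2 + e) ∨
      (u * (cell γ o i d).1 + v * (cell γ o i d).2 ≤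
        u * (cell γ o i z).1 + v * (cell γ o i z).2 + e) := by
    intro u v e hp
    rcases h.exists_le (u * μ) (v * μ) with h1 | h1 | h1 | h1
    · exact Or.inl (hp _ (by linarith))
    · exact Or.inr (Or.inl (hp _ (by linarith)))
    · exact Or.inr (Or.inr (Or.inl (hp _ (by linarith))))
    · exact Or.inr (Or.inr (Or.inr (hp _ (by linarith))))
  have bd : ∀ (u v : ℤ) (e : ℤ), (∀ (x y x' y' : ℤ) (s t s' t' : ℝ), (x : ℝ) ≤ s → s < x + 1 →
      (y : ℝ) ≤ t → t < y + 1 → (x' : ℝ) ≤ s' → s' < x' + 1 → (y' : ℝ) ≤ t' → t' < y' + 1 →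
      u * s + v * t ≤ u * s' + v * t' → ((u * x + v * y : ℤ) : ℝ) < (u * x' + v * y' + e + 1 : ℤ)) →
      ∀ p : ℂ, (u : ℝ) * (μ * p.re + ξ) + v * (μ * p.im + η) ≤
        (u * μ) * z.re + (v * μ) * z.im + u * ξ + v * η →
      u * (cell γ o i p).1 + v * (cell γ o i p).2 ≤
        u * (cell γ o i z).1 + v * (cell γ o i z).2 + e := by
    intro u v e hb p hp
    have := hb _ _ _ _ _ _ _ _ (hc p).1.1 (hc p).1.2 (hc p).2.1 (hc p).2.2 (hc z).1.1 (hc z).1.2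
      (hc z).2.1 (hc z).2.2 (by linarith)
    rw [Int.cast_lt] at this
    omega
  have k1 := key 1 0 0 (bd _ _ _ (by intros; push_cast at *; linarith))
  have k2 := key (-1) 0 0 (bd _ _ _ (by intros; push_cast at *; linarith))
  have k3 := key 0 1 0 (bd _ _ _ (by intros; push_cast at *; linarith))
  have k4 := key 0 (-1) 0 (bd _ _ _ (by intros; push_cast at *; linarith))
  have k5 := key 1 1 1 (bd _ _ _ (by intros; push_cast at *; linarith))
  have k6 := key (-1) (-1) 1 (bd _ _ _ (by intros; push_cast at *; linarith))
  have k7 := key 1 (-1) 1 (bd _ _ _ (by intros; push_cast at *; linarith))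
  have k8 := key (-1) 1 1 (bd _ _ _ (by intros; push_cast at *; linarith))
  clear key bd
  unfold CellHull
  simp only [Prod.fst_sub, Prod.snd_sub]
  refine ⟨⟨?_, ?_⟩, ⟨?_, ?_⟩, ⟨?_, ?_⟩, ⟨?_, ?_⟩⟩
  · clear k2 k3 k4 k5 k6 k7 k8; omega
  · clear k1 k3 k4 k5 k6 k7 k8; omega
  · clear k1 k2 k4 k5 k6 k7 k8; omega
  · clear k1 k2 k3 k5 k6 k7 k8; omega
  · clear k1 k2 k3 k4 k6 k7 k8; omega
  · clear k1 k2 k3 k4 k5 k7 k8; omega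
  · clear k1 k2 k3 k4 k5 k6 k8; omega
  · clear k1 k2 k3 k4 k5 k6 k7; omega

theorem near_iff {u v : ℂ} : Near γ o i u v ↔ CellNear (cell γ o i u) (cell γ o i v) := Iff.rfl

theorem Near.symm {u v : ℂ} (h : Near γ o i u v) : Near γ o i v u := CellNear.symm h

theorem near_sub (k : ℤ × ℤ) {u v : ℂ} :
    CellNear (cell γ o i u - k) (cell γ o i v - k) ↔ Near γ o i u v := by
  rw [cellNear_sub, near_iff]

theorem Near.mem_cellBox {c u : ℂ} (h : Near γ o i c u) :
    cell γ o i u - cell γ o i c ∈ cellBox 1 := by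
  rw [GridTriangulation.mem_cellBox]
  obtain ⟨h1, h2⟩ := h
  rw [abs_le] at h1 h2
  simp only [Prod.fst_sub, Prod.snd_sub]
  omega

theorem near_mem_cellBox_two {c u v : ℂ} (h : Near γ o i c u) (h' : Near γ o i u v) :
    cell γ o i v - cell γ o i c ∈ cellBox 2 := by
  rw [GridTriangulation.mem_cellBox]
  obtain ⟨h1, h2⟩ := h
  obtain ⟨h3, h4⟩ := h'
  rw [abs_le] at h1 h2 h3 h4
  simp only [Prod.fst_sub, Prod.snd_sub]
  omega

theorem cellBox_mono {a : ℤ × ℤ} (h : a ∈ cellBox 1) : a ∈ cellBox 2 := by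
  rw [GridTriangulation.mem_cellBox] at *; omega

theorem zero_mem_cellBox : (0 : ℤ × ℤ) ∈ cellBox 1 := by decide

theorem near_of_inHull_of_near {c a b d e q : ℂ} (ha : Near γ o i c a) (hb : Near γ o i c b)
    (hd : Near γ o i c d) (he : Near γ o i c e) (hq : InHull a b d e q) : Near γ o i c q := by
  have h := (hq.cellHull (γ := γ) (o := o) (i := i) (cell γ o i c)).mem_cellBox ha.mem_cellBox
    hb.mem_cellBox hd.mem_cellBox he.mem_cellBox
  rw [GridTriangulation.mem_cellBox] at h
  simp only [Prod.fst_sub, Prod.snd_sub] at h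
  constructor <;> rw [abs_le] <;> omega

theorem near_refl (c : ℂ) : Near γ o i c c := by simp [Near]

/-- Points of a triangle whose cells are near that of one vertex are near it, too. -/
theorem near_of_inHull {c p d q : ℂ} (hp : Near γ o i c p) (hd : Near γ o i c d)
    (hq : InHull p c d d q) : Near γ o i c q :=
  near_of_inHull_of_near hp (near_refl c) hd hd hq

/-- Used with `c`, `d` the convex and support vertices of a fan: successive points of the chain are
not near `d`, hence near each other. -/
theorem near_of_not_near {c p d q q' : ℂ} (hp : Near γ o i c p) (hd : Near γ o i c d)
    (hpd : ¬ Near γ o i p d) (hq : InHull p c d d q) (hq' : InHull p c d d q')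
    (h : ¬ Near γ o i q d) (h' : ¬ Near γ o i q' d) : Near γ o i q q' := by
  have e := sub_self (cell γ o i c)
  have h1 := hq.cellHull (γ := γ) (o := o) (i := i) (cell γ o i c)
  have h2 := hq'.cellHull (γ := γ) (o := o) (i := i) (cell γ o i c)
  rw [e] at h1 h2
  rw [← near_sub (cell γ o i c)] at hpd h h' ⊢
  exact cellHull_third_near_origin _ hp.mem_cellBox _ hd.mem_cellBox hpd _
    (near_of_inHull hp hd hq).mem_cellBox h1 h _ (near_of_inHull hp hd hq').mem_cellBox h2 h'

theorem near_or_near_of_inHull {c y d v : ℂ} (hy : Near γ o i c y) (hd : Near γ o i c d)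
    (hv : InHull c y d d v) : Near γ o i v y ∨ Near γ o i v d := by
  have h1 := hv.cellHull (γ := γ) (o := o) (i := i) (cell γ o i c)
  rw [sub_self] at h1
  rw [← near_sub (cell γ o i c), ← near_sub (cell γ o i c) (v := d)]
  refine cellHull_cover_origin _ hy.mem_cellBox _ hd.mem_cellBox _ ?_ h1
  exact h1.mem_cellBox zero_mem_cellBox hy.mem_cellBox hd.mem_cellBox hd.mem_cellBox

theorem near_of_inHull_quad {a b c d w w' : ℂ} (hd : Near γ o i c d) (ha : Near γ o i c a)
    (had : ¬ Near γ o i a d) (hb : Near γ o i b d) (hbc : ¬ Near γ o i b c)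
    (hw : InHull a b c d w) (hwc : ¬ Near γ o i w c) (hwd : ¬ Near γ o i w d)
    (hwa : ¬ Near γ o i w a) (hw' : InHull a b c d w') (hwc' : ¬ Near γ o i w' c)
    (hwd' : ¬ Near γ o i w' d) : Near γ o i w' b := by
  have h1 := hw.cellHull (γ := γ) (o := o) (i := i) (cell γ o i c)
  have h2 := hw'.cellHull (γ := γ) (o := o) (i := i) (cell γ o i c)
  have b1 := near_mem_cellBox_two hd hb.symm
  have b2 := h1.mem_cellBox (cellBox_mono ha.mem_cellBox) b1
    (by rw [sub_self]; exact cellBox_mono zero_mem_cellBox) (cellBox_mono hd.mem_cellBox)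
  have b3 := h2.mem_cellBox (cellBox_mono ha.mem_cellBox) b1
    (by rw [sub_self]; exact cellBox_mono zero_mem_cellBox) (cellBox_mono hd.mem_cellBox)
  rw [← near_sub (cell γ o i c)] at had hb hbc hwc hwd hwa hwc' hwd' ⊢
  have e := sub_self (cell γ o i c)
  rw [e] at h1 h2 hbc hwc hwc'
  exact cellHull_quad_origin _ hd.mem_cellBox _ ha.mem_cellBox had _ b1 hb hbc
    ⟨_, b2, h1, hwc, hwd, hwa⟩ _ b3 h2 hwc' hwd'

/-- Excludes that the edge leaving a support vertex cuts through the segment from the convex vertex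
to a point of the chain, unless it ends near the convex vertex. -/
theorem not_near_of_mem_segments {c p d z x : ℂ} (hp : Near γ o i c p) (hd : Near γ o i c d)
    (hpd : ¬ Near γ o i p d) (hz : Near γ o i d z) (hcp : x ∈ segment ℝ c p)
    (hdz : x ∈ segment ℝ d z) : Near γ o i c z := by
  by_contra hcz
  have h1 := (inHull_of_mem_segment hcp).cellHull (γ := γ) (o := o) (i := i) (cell γ o i c)
  have h2 := (inHull_of_mem_segment hdz).cellHull (γ := γ) (o := o) (i := i) (cell γ o i c)
  have b1 := near_mem_cellBox_two hd hz
  have b0 : (0 : ℤ × ℤ) ∈ cellBox 2 := by decide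
  have bx := h1.mem_cellBox (n := 2) (by rw [sub_self]; exact b0) (cellBox_mono hp.mem_cellBox)
    (cellBox_mono hp.mem_cellBox) (cellBox_mono hp.mem_cellBox)
  have hpd' := hpd
  rw [← near_sub (cell γ o i c)] at hpd' hcz
  rw [sub_self] at h1 hcz
  have hz' := hz
  rw [← near_sub (cell γ o i c)] at hz'
  refine cellCross_origin _ hp.mem_cellBox _ hd.mem_cellBox hpd' _ b1 hz' hcz
    ⟨⟨_, bx, h1, h2⟩, ?_⟩
  obtain ⟨μ, ξ, η, hc⟩ := exists_coord γ o i
  obtain ⟨t, t0, t1, ht⟩ := mem_segment_lp.mp hcp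
  obtain ⟨u, u0, u1, hu⟩ := mem_segment_lp.mp hdz
  -- Half-open cells give strict upper and weak lower bounds, so both a strict and a weak convexity
  -- estimate are needed.
  have conv : ∀ t : ℝ, 0 ≤ t → t ≤ 1 → ∀ A B M : ℝ, A < M → B < M → A + t * (B - A) < M := by
    intro t t0 t1 A B M hA hB
    rcases t0.eq_or_lt with rfl | t0
    · linarith
    · nlinarith [mul_pos t0 (sub_pos.mpr hB), mul_nonneg (sub_nonneg.mpr t1) (sub_pos.mpr hA).le]
  have conv' : ∀ t : ℝ, 0 ≤ t → t ≤ 1 → ∀ A B M : ℝ, M ≤ A → M ≤ B → M ≤ A + t * (B - A) := by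
    intro t t0 t1 A B M hA hB
    nlinarith [mul_nonneg t0 (sub_nonneg.mpr hB),
      mul_nonneg (sub_nonneg.mpr t1) (sub_nonneg.mpr hA)]
  have key : ∀ v : ℤ, (v = 1 ∨ v = -1) → ∀ (a b e f : ℂ) (t u : ℝ), 0 ≤ t → t ≤ 1 → 0 ≤ u →
      u ≤ 1 → lp a b t = lp e f u →
      (cell γ o i a).1 + v * (cell γ o i a).2 + 2 ≤ (cell γ o i e).1 + v * (cell γ o i e).2 ∧
      (cell γ o i a).1 + v * (cell γ o i a).2 + 2 ≤ (cell γ o i f).1 + v * (cell γ o i f).2 ∧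
      (cell γ o i b).1 + v * (cell γ o i b).2 + 2 ≤ (cell γ o i e).1 + v * (cell γ o i e).2 ∧
      (cell γ o i b).1 + v * (cell γ o i b).2 + 2 ≤ (cell γ o i f).1 + v * (cell γ o i f).2 →
      False := by
    intro v hv a b e f t u t0 t1 u0 u1 he ⟨h1, h2, h3, h4⟩
    obtain ⟨⟨a1, a2⟩, a3, a4⟩ := hc a
    obtain ⟨⟨b1, b2⟩, b3, b4⟩ := hc b
    obtain ⟨⟨c1, c2⟩, c3, c4⟩ := hc e
    obtain ⟨⟨d1, d2⟩, d3, d4⟩ := hc f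
    have r1 := congrArg Complex.re he
    have r2 := congrArg Complex.im he
    rw [lp_re, lp_re] at r1
    rw [lp_im, lp_im] at r2
    rify at h1 h2 h3 h4
    set fa := (μ * a.re + ξ) + v * (μ * a.im + η) with hfa
    set fb := (μ * b.re + ξ) + v * (μ * b.im + η) with hfb
    set fe := (μ * e.re + ξ) + v * (μ * e.im + η) with hfe
    set ff := (μ * f.re + ξ) + v * (μ * f.im + η) with hff
    have hm : fa < fe ∧ fa < ff ∧ fb < fe ∧ fb < ff := by
      rcases hv with rfl | rfl <;> push_cast at * <;>
        refine ⟨?_, ?_, ?_, ?_⟩ <;> linarith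
    have heq : fa + t * (fb - fa) = fe + u * (ff - fe) := by
      rw [hfa, hfb, hfe, hff]
      linear_combination μ * r1 + v * μ * r2
    have g1 := conv t t0 t1 fa fb (min fe ff) (lt_min hm.1 hm.2.1) (lt_min hm.2.2.1 hm.2.2.2)
    have g2 := conv' u u0 u1 fe ff (min fe ff) (min_le_left _ _) (min_le_right _ _)
    linarith
  have q1 := key 1 (Or.inl rfl) c p d z t u t0 t1 u0 u1 (ht ▸ hu)
  have q2 := key 1 (Or.inl rfl) d z c p u t u0 u1 t0 t1 (hu ▸ ht)
  have q3 := key (-1) (Or.inr rfl) c p d z t u t0 t1 u0 u1 (ht ▸ hu)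
  have q4 := key (-1) (Or.inr rfl) d z c p u t u0 u1 t0 t1 (hu ▸ ht)
  simp only [Prod.fst_sub, Prod.snd_sub, Prod.fst_zero, Prod.snd_zero]
  refine ⟨⟨?_, ?_⟩, ⟨?_, ?_⟩⟩
  · clear q1 q3 q4; by_contra; apply q2; omega
  · clear q2 q3 q4; by_contra; apply q1; omega
  · clear q1 q2 q3; by_contra; apply q4; omega
  · clear q1 q2 q4; by_contra; apply q3; omega

end

section

variable {P : Finset ℂ} {A : SimpleGraph ℂ} {γ : ℝ} {o : ℂ} {i : ℕ} {s : ℝ} {V : ℤ → ℂ}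

/-! ### Boundary sequences -/

theorem InTri.reverse {p q r z : ℂ} (h : InTri s p q r z) : InTri (-s) r q p z := by
  refine ⟨?_, ?_, ?_⟩ <;> rw [side_neg, side_swap, neg_neg]
  exacts [h.2.1, h.1, h.2.2]

theorem EmptyTri.reverse {p q r : ℂ} (h : EmptyTri P s p q r) : EmptyTri P (-s) r q p := by
  intro z hz hi
  have := h z hz (by simpa using hi.reverse)
  tauto

theorem side_reverse (s : ℝ) (a b c : ℂ) : side (-s) c b a = side s a b c := by
  unfold side; ring

/-- `V` runs along the boundary of a non-triangulated face of the straight-line graph `A`, with the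
face on the right for `s = 1` and on the left for `s = -1`; `A` contains all uncrossed edges that
join points in near cells. -/
structure Bd (P : Finset ℂ) (A : SimpleGraph ℂ) (γ : ℝ) (o : ℂ) (i : ℕ) (s : ℝ) (V : ℤ → ℂ) :
    Prop where
  gp : GeneralPosition P
  pslg : IsPSLG P A
  near : ∀ u v, A.Adj u v → Near γ o i u v
  maxi : ∀ u ∈ P, ∀ v ∈ P, u ≠ v → Near γ o i u v → Unc A u v → A.Adj u v
  hs : s = 1 ∨ s = -1
  adj : ∀ k, A.Adj (V k) (V (k + 1))
  turn : ∀ k x, A.Adj (V k) x →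
    ang s (V k) (V (k - 1)) (V (k + 1)) ≤ ang s (V k) (V (k - 1)) x
  notri : ∀ k, 0 < side s (V (k - 1)) (V k) (V (k + 1)) →
    EmptyTri P s (V (k - 1)) (V k) (V (k + 1)) → ¬ A.Adj (V (k - 1)) (V (k + 1))

/-- The corner at the index `k` is convex. -/
def Conv (s : ℝ) (V : ℤ → ℂ) (k : ℤ) : Prop := 0 < side s (V (k - 1)) (V k) (V (k + 1))

/-- The direction of `x` lies in the open corner at the index `k`. -/
def InC (s : ℝ) (V : ℤ → ℂ) (k : ℤ) (x : ℂ) : Prop :=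
  ang s (V k) (V (k - 1)) x < ang s (V k) (V (k - 1)) (V (k + 1))

/-- The segment from `V a` to `V b` starts and ends in the corners at `a` and `b` and is no edge,
but is crossed by no edge. -/
structure Diag (A : SimpleGraph ℂ) (s : ℝ) (V : ℤ → ℂ) (a b : ℤ) : Prop where
  ne : V a ≠ V b
  unc : Unc A (V a) (V b)
  not_adj : ¬ A.Adj (V a) (V b)
  left : InC s V a (V b)
  right : InC s V b (V a)

/-- A boundary edge or a diagonal. -/
def Link (A : SimpleGraph ℂ) (s : ℝ) (V : ℤ → ℂ) (a b : ℤ) : Prop := b = a + 1 ∨ Diag A s V a b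

namespace Bd

theorem s_ne (h : Bd P A γ o i s V) : s ≠ 0 := by rcases h.hs with e | e <;> rw [e] <;> norm_num

theorem mem (h : Bd P A γ o i s V) (k : ℤ) : V k ∈ P := (h.pslg.endpoints _ _ (h.adj k)).1

theorem adj' (h : Bd P A γ o i s V) (k : ℤ) : A.Adj (V k) (V (k - 1)) := by
  have := h.adj (k - 1); rw [sub_add_cancel] at this; exact this.symm

theorem ang_lt_pi (h : Bd P A γ o i s V) {v a b : ℂ} (hv : v ∈ P) (ha : a ∈ P) (hb : b ∈ P)
    (hav : a ≠ v) (hbv : b ≠ v) (hlt : ang s v a b < Real.pi) : side s v a b < 0 := by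
  by_contra hcon
  have hpi := Real.pi_pos
  have hab : a ≠ b := by
    rintro rfl; rw [ang_self s hav] at hlt; linarith
  have := h.gp.side_ne_zero h.s_ne hv ha hb hav.symm hab hbv.symm
  have := ang_of_side_pos h.hs (lt_of_le_of_ne (not_lt.mp hcon) this.symm)
  linarith

theorem ang_eq_two_pi (h : Bd P A γ o i s V) {v a b : ℂ} (hv : v ∈ P) (ha : a ∈ P) (hb : b ∈ P)
    (hav : a ≠ v) (hbv : b ≠ v) (hlt : ang s v a b = 2 * Real.pi) : a = b := by
  by_contra hab
  have hpi := Real.pi_pos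
  have := h.gp.side_ne_zero h.s_ne hv ha hb hav.symm hab hbv.symm
  rcases lt_or_gt_of_ne this with h1 | h1
  · have := ang_of_side_neg h.hs h1; linarith
  · have := ang_of_side_pos h.hs h1; linarith

/-- Reversing the walk and the orientation together preserves all hypotheses, so every statement on
forward fans yields one on backward fans. The turning rule survives because the angle from the
incoming to the outgoing edge is the same one read from its other side. -/
theorem rev (h : Bd P A γ o i s V) : Bd P A γ o i (-s) (fun k => V (-k)) where
  gp := h.gp
  pslg := h.pslg
  near := h.near
  maxi := h.maxi
  hs := by rcases h.hs with e | e <;> simp [e]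
  adj := fun k => by
    have := h.adj' (-k)
    rwa [show -k - 1 = -(k + 1) by ring] at this
  turn := fun k x hx => by
    rw [show -(k - 1) = -k + 1 by ring, show -(k + 1) = -k - 1 by ring, ang_neg h.hs, ang_neg h.hs]
    have h1 := h.turn (-k) x hx
    have h2 := ang_pos s (V (-k)) x (V (-k + 1))
    rcases ang_add s (h.adj' (-k)).ne' hx.ne' (h.adj (-k)).ne' with e | e
    · linarith
    · have := ang_le s (V (-k)) (V (-k - 1)) x
      linarith
  notri := fun k hk he hadj => by
    rw [show -(k - 1) = -k + 1 by ring, show -(k + 1) = -k - 1 by ring] at *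
    rw [side_reverse] at hk
    refine h.notri (-k) hk ?_ hadj.symm
    simpa using he.reverse

theorem _root_.GridTriangulation.conv_iff_side {k : ℤ} : Conv s V k ↔
    side s (V k) (V (k - 1)) (V (k + 1)) < 0 := by
  unfold Conv; rw [side_swap]; constructor <;> intro <;> linarith

theorem conv_iff (h : Bd P A γ o i s V) {k : ℤ} :
    Conv s V k ↔ ang s (V k) (V (k - 1)) (V (k + 1)) < Real.pi :=
  ⟨fun hk => ang_of_side_neg h.hs (conv_iff_side.mp hk), fun hk => conv_iff_side.mpr
    (h.ang_lt_pi (h.mem _) (h.mem _) (h.mem _) (h.adj' k).ne' (h.adj k).ne' hk)⟩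

theorem _root_.GridTriangulation.conv_rev {k : ℤ} :
    Conv (-s) (fun k => V (-k)) (-k) ↔ Conv s V k := by
  unfold Conv
  simp only
  rw [show -(-k - 1) = k + 1 by ring, show -(-k + 1) = k - 1 by ring, neg_neg, side_reverse]

/-- The corner may be measured from the outgoing edge as well, which makes it invariant under
reversal. -/
theorem inC_iff (h : Bd P A γ o i s V) {k : ℤ} {x : ℂ} (hx : x ≠ V k) : InC s V k x ↔
    ang s (V k) x (V (k + 1)) < ang s (V k) (V (k - 1)) (V (k + 1)) := by
  unfold InC
  have h1 := ang_pos s (V k) x (V (k + 1))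
  have h2 := ang_pos s (V k) (V (k - 1)) x
  have h3 := ang_le s (V k) x (V (k + 1))
  have h4 := ang_le s (V k) (V (k - 1)) x
  rcases ang_add s (h.adj' k).ne' hx (h.adj k).ne' with e | e <;> constructor <;> intro <;> linarith

theorem inC_rev (h : Bd P A γ o i s V) {k : ℤ} {x : ℂ} (hx : x ≠ V k) :
    InC (-s) (fun k => V (-k)) (-k) x ↔ InC s V k x := by
  rw [h.inC_iff hx]
  unfold InC
  simp only
  rw [show -(-k - 1) = k + 1 by ring, show -(-k + 1) = k - 1 by ring, neg_neg, ang_neg h.hs,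
    ang_neg h.hs]

theorem not_inC_of_adj (h : Bd P A γ o i s V) {k : ℤ} {x : ℂ} (hx : A.Adj (V k) x) :
    ¬ InC s V k x := not_lt.mpr (h.turn k x hx)

theorem diag_rev (h : Bd P A γ o i s V) {a b : ℤ} :
    Diag A (-s) (fun k => V (-k)) (-b) (-a) ↔ Diag A s V a b := by
  constructor
  · rintro ⟨h1, h2, h3, h4, h5⟩
    simp only [neg_neg] at *
    exact ⟨h1.symm, h2.symm, fun e => h3 e.symm, (h.inC_rev h1).mp h5, (h.inC_rev h1.symm).mp h4⟩
  · rintro ⟨h1, h2, h3, h4, h5⟩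
    refine ⟨?_, ?_, ?_, ?_, ?_⟩ <;> simp only [neg_neg]
    exacts [h1.symm, h2.symm, fun e => h3 e.symm, (h.inC_rev h1).mpr h5, (h.inC_rev h1.symm).mpr h4]

theorem link_rev (h : Bd P A γ o i s V) {a b : ℤ} :
    Link A (-s) (fun k => V (-k)) (-b) (-a) ↔ Link A s V a b := by
  unfold Link; rw [h.diag_rev]
  exact or_congr_left ⟨fun e => by omega, fun e => by omega⟩

theorem not_near_of_diag (h : Bd P A γ o i s V) {a b : ℤ} (hd : Diag A s V a b) :
    ¬ Near γ o i (V a) (V b) :=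
  fun hn => hd.not_adj (h.maxi _ (h.mem a) _ (h.mem b) hd.ne hn hd.unc)

theorem unc_of_link (h : Bd P A γ o i s V) {a b : ℤ} (hl : Link A s V a b) :
    Unc A (V a) (V b) := by
  rcases hl with rfl | hl
  · exact h.pslg.unc (h.adj a)
  · exact hl.unc

theorem ne_of_link (h : Bd P A γ o i s V) {a b : ℤ} (hl : Link A s V a b) : V a ≠ V b := by
  rcases hl with rfl | hl
  · exact (h.adj a).ne
  · exact hl.ne

theorem inC_of_side (h : Bd P A γ o i s V) {k : ℤ} {x : ℂ} (hc : ¬ Conv s V k)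
    (hx : 0 < side s (V k) (V (k + 1)) x) : InC s V k x := by
  rw [h.conv_iff, not_lt] at hc
  rw [h.inC_iff (side_ne s hx.ne').2.2.symm]
  rw [← neg_lt_zero, ← side_swap'] at hx
  have := ang_of_side_neg h.hs hx
  linarith

theorem inC_of_side' (h : Bd P A γ o i s V) {k : ℤ} {x : ℂ} (hc : ¬ Conv s V k)
    (hx : 0 < side s (V (k - 1)) (V k) x) : InC s V k x := by
  rw [h.conv_iff, not_lt] at hc
  rw [← neg_lt_zero, ← side_swap] at hx
  have := ang_of_side_neg h.hs hx
  unfold InC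
  linarith

theorem inC_of_sides (h : Bd P A γ o i s V) {k : ℤ} {x : ℂ}
    (hx : 0 < side s (V k) (V (k + 1)) x) (hx' : 0 < side s (V (k - 1)) (V k) x) :
    InC s V k x := by
  rw [← neg_lt_zero, ← side_swap'] at hx
  rw [← neg_lt_zero, ← side_swap] at hx'
  have := ang_add_of_side h.hs hx' hx
  have := ang_pos s (V k) x (V (k + 1))
  unfold InC
  linarith

/-- Points in the wedge between the outgoing edge and a direction in the corner are in the
corner. -/
theorem inC_wedge (h : Bd P A γ o i s V) {k : ℤ} {d x : ℂ} (hd : d = V (k - 1) ∨ InC s V k d)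
    (h1 : 0 < side s (V k) (V (k + 1)) x) (h2 : 0 < side s d (V k) x) : InC s V k x := by
  have hdk : d ≠ V k := (side_ne s h2.ne').1
  rw [h.inC_iff (side_ne s h1.ne').2.2.symm]
  rw [← neg_lt_zero, ← side_swap'] at h1
  rw [← neg_lt_zero, ← side_swap] at h2
  have e := ang_add_of_side h.hs h2 h1
  have := ang_pos s (V k) d x
  rcases hd with rfl | hd
  · linarith
  · rw [h.inC_iff hdk] at hd
    linarith

theorem inC_wedge' (h : Bd P A γ o i s V) {k : ℤ} {d x : ℂ} (hd : d = V (k + 1) ∨ InC s V k d)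
    (h1 : 0 < side s (V (k - 1)) (V k) x) (h2 : 0 < side s (V k) d x) : InC s V k x := by
  rw [← neg_lt_zero, ← side_swap] at h1
  rw [← neg_lt_zero, ← side_swap'] at h2
  have e := ang_add_of_side h.hs h1 h2
  have := ang_pos s (V k) x d
  unfold InC at *
  rcases hd with rfl | hd <;> linarith

/-- A direction is in the corner if it is reached from another one by turning over an angle that
contains no edge. -/
theorem inC_extend (h : Bd P A γ o i s V) {k : ℤ} {d x : ℂ} (hd : d = V (k - 1) ∨ InC s V k d)
    (hx : x ∈ P) (h1 : side s (V k) d x < 0)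
    (hno : ∀ w, A.Adj (V k) w → ¬ (side s (V k) d w < 0 ∧ side s (V k) w x < 0))
    (hadj : ¬ A.Adj (V k) x) : InC s V k x := by
  have hdk : d ≠ V k := (side_ne s h1.ne).1.symm
  have hxk : x ≠ V k := (side_ne s h1.ne).2.2.symm
  have hkk := h.adj k
  have hdP : ang s (V k) d (V (k + 1)) ≤ ang s (V k) (V (k - 1)) (V (k + 1)) := by
    rcases hd with rfl | hd
    · exact le_rfl
    · exact ((h.inC_iff hdk).mp hd).le
  have hpi := Real.pi_pos
  have hχ := ang_of_side_neg h.hs h1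
  have hψ := ang_pos s (V k) d (V (k + 1))
  have key : ang s (V k) d x < ang s (V k) d (V (k + 1)) := by
    by_contra hcon
    push Not at hcon
    have hxkk := ang_pos s (V k) (V (k + 1)) x
    have hxk2 := ang_le s (V k) (V (k + 1)) x
    have hlt : ang s (V k) d (V (k + 1)) < Real.pi := by linarith
    rcases ang_add s hdk hkk.ne' hxk with e | e
    · have hlt' : ang s (V k) (V (k + 1)) x < Real.pi := by linarith
      refine hno _ hkk ⟨?_, h.ang_lt_pi (h.mem _) (h.mem _) hx hkk.ne' hxk hlt'⟩
      rcases hd with rfl | hd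
      · exact h.ang_lt_pi (h.mem _) (h.mem _) (h.mem _) hdk hkk.ne' hlt
      · by_contra hs0
        -- `d` need not belong to `P`, so general position does not exclude that it lies on the line
        -- of the outgoing edge. In the same direction the angle is `2π` by convention, not `0`.
        rcases (not_lt.mp hs0).eq_or_lt with h0 | h0
        · have h4 : side s (V k) (V (k + 1)) x < 0 :=
            h.ang_lt_pi (h.mem _) (h.mem _) hx hkk.ne' hxk hlt'
          obtain ⟨t, ht⟩ := exists_lp_of_side_eq_zero h.s_ne hdk.symm h0.symm
          rw [ht, ← side_rotate, ← side_rotate, side_lp, side_right, side_rotate' s (V k) d x] at h4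
          have ht0 : 0 < t := by by_contra hc; push Not at hc; nlinarith
          have hz : (V (k + 1) - V k) / (d - V k) = t := by
            rw [ht, lp]; field_simp [sub_ne_zero.mpr hdk]; ring
          have hz' : (d - V k) / (V (k + 1) - V k) = ((t⁻¹ : ℝ) : ℂ) := by
            rw [← inv_div, hz]; push_cast; rfl
          have : ang s (V k) d (V (k + 1)) = 2 * Real.pi := by
            unfold ang ccwAngle
            rw [hz, hz', Complex.arg_ofReal_of_nonneg ht0.le,
              Complex.arg_ofReal_of_nonneg (inv_pos.mpr ht0).le, toIocMod_apply_left]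
            simp
          linarith
        · have := (ang_of_side_pos h.hs h0).1
          linarith
    · have : ang s (V k) (V (k + 1)) x = 2 * Real.pi := by linarith
      exact hadj (h.ang_eq_two_pi (h.mem _) (h.mem _) hx hkk.ne' hxk this ▸ hkk)
  rw [h.inC_iff hxk]
  rcases ang_add s hdk hxk hkk.ne' with e | e
  · have := ang_pos s (V k) d x
    linarith
  · have := ang_le s (V k) x (V (k + 1))
    linarith

theorem inC_extend' (h : Bd P A γ o i s V) {k : ℤ} {d x : ℂ} (hd : d = V (k + 1) ∨ InC s V k d)
    (hx : x ∈ P) (h1 : 0 < side s (V k) d x)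
    (hno : ∀ w, A.Adj (V k) w → ¬ (0 < side s (V k) d w ∧ 0 < side s (V k) w x))
    (hadj : ¬ A.Adj (V k) x) : InC s V k x := by
  have hdk : d ≠ V k := (side_ne s h1.ne').1.symm
  have hxk : x ≠ V k := (side_ne s h1.ne').2.2.symm
  rw [← h.inC_rev hxk]
  refine h.rev.inC_extend (k := -k) (d := d) ?_ hx ?_ ?_ ?_
  · rw [h.inC_rev hdk, show -(-k - 1) = k + 1 by ring]; exact hd
  · rw [neg_neg, side_neg]; linarith
  · intro w hw ⟨h2, h3⟩
    rw [neg_neg] at *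
    rw [side_neg] at h2 h3
    exact hno w hw ⟨by linarith, by linarith⟩
  · rwa [neg_neg]

/-- In an empty triangle the rotating ray meets no point before `r`, so the properties of the first
point are properties of `r`. -/
theorem unc_inC_of_emptyTri (h : Bd P A γ o i s V) {a : ℤ} {q r : ℂ} (hq : q ∈ P) (hr : r ∈ P)
    (hd : q = V (a + 1) ∨ InC s V a q) (ht : 0 < side s (V a) q r) (h1 : Unc A (V a) q)
    (h2 : Unc A q r) (h3 : ∀ w, A.Adj q w → ¬ (0 < side s (V a) q w ∧ 0 < side s q r w))
    (he : EmptyTri P s (V a) q r) (hadj : ¬ A.Adj (V a) r) :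
    Unc A (V a) r ∧ InC s V a r := by
  obtain ⟨y, hy⟩ := exists_first h.gp h.pslg (h.mem a) hq hr ht h1 h2 h3
  obtain rfl : y = r := by
    rcases he y hy.mem hy.inTri with e | e | e
    · exact absurd e hy.ne_left
    · exact absurd e hy.ne_right
    · exact e
  exact ⟨hy.unc_left, h.inC_extend' hd hr ht (fun w hw => hy.no_adj ht hw) hadj⟩

/-- An empty triangle over a boundary edge and a link that is closed by no edge is closed by a
diagonal. -/
theorem diag_of_emptyTri (h : Bd P A γ o i s V) {a b : ℤ}
    (ht : 0 < side s (V a) (V (a + 1)) (V b)) (hl : Link A s V (a + 1) b)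
    (he : EmptyTri P s (V a) (V (a + 1)) (V b)) (hadj : ¬ A.Adj (V a) (V b)) : Diag A s V a b := by
  have hno : ∀ w, A.Adj (V (a + 1)) w →
      ¬ (0 < side s (V a) (V (a + 1)) w ∧ 0 < side s (V (a + 1)) (V b) w) := by
    rintro w hw ⟨w1, w2⟩
    refine h.not_inC_of_adj hw (h.inC_wedge' (d := V b) ?_ (by simpa using w1) w2)
    rcases hl with rfl | hl
    · exact Or.inl rfl
    · exact Or.inr hl.left
  have h1 := h.unc_inC_of_emptyTri (h.mem _) (h.mem _) (Or.inl rfl) ht (h.pslg.unc (h.adj a))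
    (h.unc_of_link hl) hno he hadj
  have h2 := h.rev.unc_inC_of_emptyTri (a := -b) (q := V (a + 1)) (r := V a) (h.mem _) (h.mem _)
    ?_ ?_ ?_ ?_ ?_ ?_ ?_
  · have hne : V a ≠ V b := (side_ne s ht.ne').2.2
    exact ⟨hne, h1.1, hadj, h1.2, (h.inC_rev hne).mp h2.2⟩
  · rw [h.inC_rev (h.ne_of_link hl), show -(-b + 1) = b - 1 by ring]
    rcases hl with rfl | hl
    · left; congr 1; ring
    · exact Or.inr hl.right
  · rwa [neg_neg, side_reverse]
  · rw [neg_neg]; exact (h.unc_of_link hl).symm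
  · exact (h.pslg.unc (h.adj a)).symm
  · intro w hw ⟨h3, h4⟩
    rw [neg_neg, side_neg, side_swap, neg_neg] at h3
    rw [side_neg, side_swap, neg_neg] at h4
    exact hno w hw ⟨h4, h3⟩
  · rw [neg_neg]; exact he.reverse
  · rw [neg_neg]; exact fun e => hadj e.symm

/-- A first point strictly inside the ear would be near `V k`, as both neighbours are, and would see
it. The resulting edge would point into the corner at `k`, against the turning rule. -/
theorem ear_first (h : Bd P A γ o i s V) {k : ℤ} (hk : Conv s V k) :
    IsFirst P A s (V (k - 1)) (V k) (V (k + 1)) (V (k + 1)) := by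
  have hno : ∀ w, A.Adj (V k) w →
      ¬ (0 < side s (V (k - 1)) (V k) w ∧ 0 < side s (V k) (V (k + 1)) w) :=
    fun w hw ⟨w1, w2⟩ => h.not_inC_of_adj hw (h.inC_of_sides w2 w1)
  obtain ⟨y, hy⟩ := exists_first h.gp h.pslg (h.mem _) (h.mem _) (h.mem _) hk
    (h.pslg.unc (h.adj' k).symm) (h.pslg.unc (h.adj k)) hno
  rcases hy.strict with e | e
  · rwa [e] at hy
  · exfalso
    have hn : Near γ o i (V k) y := near_of_inHull (h.near _ _ (h.adj' k)) (h.near _ _ (h.adj k))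
      (hy.inTri.inHull hk)
    exact hno y (h.maxi _ (h.mem k) _ hy.mem hy.ne_right.symm hn hy.unc_right) ⟨e.1, e.2.1⟩

theorem ear_emptyTri (h : Bd P A γ o i s V) {k : ℤ} (hk : Conv s V k) :
    EmptyTri P s (V (k - 1)) (V k) (V (k + 1)) := (h.ear_first hk).emptyTri hk

theorem ear_diag (h : Bd P A γ o i s V) {k : ℤ} (hk : Conv s V k) :
    Diag A s V (k - 1) (k + 1) := by
  have := h.diag_of_emptyTri (a := k - 1) (b := k + 1)
  rw [sub_add_cancel] at this
  exact this hk (Or.inl rfl) (h.ear_emptyTri hk) (h.notri k hk (h.ear_emptyTri hk))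

end Bd

end

/-! ### Determinism of the boundary walk, uniqueness of reflex corners and the wedge at a support
vertex -/

section

variable {P : Finset ℂ} {A : SimpleGraph ℂ} {γ : ℝ} {o : ℂ} {i : ℕ} {s : ℝ} {V : ℤ → ℂ}

theorem InHull.side_nonneg {a b p q r t z : ℂ} (h : InHull p q r t z) (hp : 0 ≤ side s a b p)
    (hq : 0 ≤ side s a b q) (hr : 0 ≤ side s a b r) (ht : 0 ≤ side s a b t) :
    0 ≤ side s a b z := by
  have := h (s * (b.im - a.im)) (-s * (b.re - a.re))
    (s * (a.re * (b.im - a.im) - a.im * (b.re - a.re)))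
  unfold side at *
  have := this (by linarith) (by linarith) (by linarith) (by linarith)
  linarith

theorem InHull.inTri {p q r z : ℂ} (h : InHull p q r r z) (ht : 0 ≤ side s p q r) :
    InTri s p q r z := by
  refine ⟨h.side_nonneg ?_ ?_ ?_ ?_, h.side_nonneg ?_ ?_ ?_ ?_, h.side_nonneg ?_ ?_ ?_ ?_⟩ <;>
    simp [side_rotate, ht]

namespace Bd

theorem ang_inj (h : Bd P A γ o i s V) {v a b c : ℂ} (hv : v ∈ P) (hb : b ∈ P)
    (hc : c ∈ P) (hav : a ≠ v) (hbv : b ≠ v) (hcv : c ≠ v) (e : ang s v a b = ang s v a c) :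
    b = c := by
  have h1 := ang_pos s v b c
  refine h.ang_eq_two_pi hv hb hc hbv hcv ?_
  rcases ang_add s hav hbv hcv with e' | e' <;> linarith

theorem eq_of_turn (h : Bd P A γ o i s V) {k l : ℤ} (e0 : V k = V l) (e1 : V (k - 1) = V (l - 1)) :
    V (k + 1) = V (l + 1) := by
  refine h.ang_inj (h.mem k) (h.mem _) (h.mem _) (h.adj' k).ne' (h.adj k).ne'
    (e0 ▸ (h.adj l).ne') (le_antisymm ?_ ?_)
  · exact h.turn k _ (e0 ▸ h.adj l)
  · have := h.turn l (V (k + 1)) (e0 ▸ h.adj k)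
    rwa [← e0, ← e1] at this

/-- The next vertex depends on the last directed edge only, so one repeated edge makes the walk
repeat from there on. -/
theorem eq_add (h : Bd P A γ o i s V) {k l : ℤ} (e0 : V k = V l) (e1 : V (k + 1) = V (l + 1))
    (n : ℕ) : V (k + n) = V (l + n) ∧ V (k + n + 1) = V (l + n + 1) := by
  induction n with
  | zero => simpa using ⟨e0, e1⟩
  | succ n ih =>
    push_cast
    rw [← add_assoc, ← add_assoc]
    refine ⟨ih.2, h.eq_of_turn ih.2 ?_⟩
    rw [add_sub_cancel_right, add_sub_cancel_right]; exact ih.1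

theorem pi_lt_of_not_conv (h : Bd P A γ o i s V) {k : ℤ} (hk : ¬ Conv s V k) :
    Real.pi < ang s (V k) (V (k - 1)) (V (k + 1)) := by
  have hpi := Real.pi_pos
  by_cases e : V (k - 1) = V (k + 1)
  · rw [e, ang_self s (h.adj k).ne']; linarith
  · have := h.gp.side_ne_zero h.s_ne (h.mem k) (h.mem (k - 1)) (h.mem (k + 1)) (h.adj' k).ne e
      (h.adj k).ne
    refine (ang_of_side_pos h.hs (lt_of_le_of_ne ?_ this.symm)).1
    rw [conv_iff_side] at hk
    exact not_lt.mp hk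

/-- A vertex has at most one reflex corner. -/
theorem eq_of_not_conv (h : Bd P A γ o i s V) {k l : ℤ} (hk : ¬ Conv s V k) (hl : ¬ Conv s V l)
    (e : V k = V l) : V (k + 1) = V (l + 1) := by
  apply h.eq_of_turn e
  have h1 := h.pi_lt_of_not_conv hk
  have h2 := h.pi_lt_of_not_conv hl
  have h3 := h.turn k (V (l - 1)) (e ▸ h.adj' l)
  have h4 := h.turn l (V (k - 1)) (e ▸ h.adj' k)
  rw [← e] at h4 h2
  by_contra hne
  have hs := h.gp.side_ne_zero h.s_ne (h.mem k) (h.mem (k - 1)) (h.mem (l - 1)) (h.adj' k).ne hne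
    (e ▸ (h.adj' l).ne)
  have := ang_add_ang_symm h.hs hs
  linarith

/-- An edge is the one on which the boundary arrives, if no edge lies between it and a direction in
the corner. -/
theorem eq_prev (h : Bd P A γ o i s V) {k : ℤ} {d y : ℂ} (hd : d = V (k + 1) ∨ InC s V k d)
    (hdP : d ∈ P) (hy : A.Adj (V k) y) (h1 : 0 < side s (V k) d y)
    (hno : ∀ w, A.Adj (V k) w → ¬ (0 < side s (V k) d w ∧ 0 < side s (V k) w y)) :
    y = V (k - 1) := by
  have hyP := (h.pslg.endpoints _ _ hy).2
  have hdk : d ≠ V k := (side_ne s h1.ne').1.symm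
  have hpr := (h.adj' k).ne'
  have hyd : ang s (V k) y d < Real.pi := ang_of_side_neg h.hs (by rw [side_swap']; linarith)
  have hdθ : ang s (V k) (V (k - 1)) d ≤ ang s (V k) (V (k - 1)) (V (k + 1)) := by
    rcases hd with rfl | hd
    · exact le_rfl
    · exact le_of_lt hd
  have ht := h.turn k y hy
  have h0 := ang_pos s (V k) y d
  have h2 := ang_le s (V k) y (V (k - 1))
  have h3 := ang_le s (V k) (V (k - 1)) y
  rcases ang_add s hy.ne' hpr hdk with e | e
  · exfalso
    have h4 := ang_pos s (V k) y (V (k - 1))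
    have h5 := ang_pos s (V k) (V (k - 1)) d
    have s1 := h.ang_lt_pi (h.mem k) hyP (h.mem (k - 1)) hy.ne' hpr (by linarith)
    have s2 := h.ang_lt_pi (h.mem k) (h.mem (k - 1)) hdP hpr hdk (by linarith)
    refine hno _ (h.adj' k) ⟨?_, ?_⟩
    · rw [side_swap']; linarith
    · rw [side_swap']; linarith
  · rcases ang_add s hpr hy.ne' hdk with e' | e'
    · linarith
    · exact (h.ang_eq_two_pi (h.mem k) (h.mem _) hyP hpr hy.ne' (by linarith)).symm

/-- No edge at the end of a boundary edge `V c V (c + 1)` points into the triangle that it forms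
with a point near `V c` which sees `V (c + 1)`. -/
theorem no_adj_wedge (h : Bd P A γ o i s V) {c : ℤ} {u : ℂ} (hu : u ∈ P)
    (hn : Near γ o i (V c) u) (hunc : Unc A u (V (c + 1))) (hadj : ¬ A.Adj u (V (c + 1)))
    (hside : 0 < side s (V c) (V (c + 1)) u) (w : ℂ) (hw : A.Adj (V (c + 1)) w) :
    ¬ (0 < side s (V c) (V (c + 1)) w ∧ 0 < side s (V (c + 1)) u w) := by
  rintro ⟨h1, h2⟩
  have huc : u ≠ V (c + 1) := (side_ne s hside.ne').2.1.symm
  have e1 : c + 1 - 1 = c := by ring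
  have hcd := h.adj c
  have hpd : ¬ Near γ o i u (V (c + 1)) := fun hc =>
    hadj (h.maxi _ hu _ (h.mem _) huc hc hunc)
  have t := h.turn (c + 1) w hw
  rw [e1] at t
  have a1 : side s (V (c + 1)) (V c) w < 0 := by rw [side_swap]; linarith
  have a2 : side s (V (c + 1)) w u < 0 := by rw [side_swap']; linarith
  have a3 := ang_add_of_side h.hs a1 a2
  have a4 := ang_pos s (V (c + 1)) w u
  have a5 : side s (V (c + 1)) (V c) u < 0 := by rw [side_swap]; linarith
  have a6 := ang_of_side_neg h.hs a5
  have hnx := h.adj (c + 1)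
  -- The next edge of the walk comes no later than `w`, hence within the angle from `V c` to `u`. So
  -- the corner at `c + 1` is convex, and its ear has ends that are not near.
  have b1 := h.ang_lt_pi (h.mem (c + 1)) (h.mem c) (h.mem (c + 1 + 1)) hcd.ne hnx.ne'
    (by linarith)
  have hconv : Conv s V (c + 1) := by rw [conv_iff_side, e1]; exact b1
  have b2 : side s (V (c + 1)) (V (c + 1 + 1)) u < 0 := by
    refine h.ang_lt_pi (h.mem (c + 1)) (h.mem (c + 1 + 1)) hu hnx.ne' huc ?_
    have := ang_pos s (V (c + 1)) (V c) (V (c + 1 + 1))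
    have := ang_le s (V (c + 1)) (V (c + 1 + 1)) u
    rcases ang_add s hcd.ne hnx.ne' huc with e | e <;> linarith
  have hear := h.not_near_of_diag (h.ear_diag hconv)
  rw [e1] at hear
  -- Otherwise `V (c + 2)` lies in the triangle of `u`, `V c`, `V (c + 1)`, all of which are near `V
  -- c`.
  have c1 : side s u (V c) (V (c + 1 + 1)) < 0 := by
    by_contra hcon
    push Not at hcon
    apply hear
    refine near_of_inHull hn (h.near _ _ hcd) (InTri.inHull (s := s) (p := u) ?_ ?_)
    · refine ⟨hcon, ?_, ?_⟩
      · have := side_swap s (V (c + 1)) (V c) (V (c + 1 + 1))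
        linarith
      · have := side_swap' s (V (c + 1)) u (V (c + 1 + 1))
        linarith
    · rwa [← side_rotate]
  have hx := exists_mem_openSegment_of_side (s := s) (a := u) (b := V c) (c := V (c + 1))
    (d := V (c + 1 + 1)) (by rwa [← side_rotate]) c1 b2 (by
      rw [side_swap']; linarith)
  obtain ⟨x, hx1, hx2⟩ := hx
  -- Now the edge to `V (c + 2)` leaves the triangle through the side from `u` to `V c`, and the
  -- cell lemma makes the ends of the ear near after all.
  exact hear (not_near_of_mem_segments hn (h.near _ _ hcd) hpd (h.near _ _ hnx)
    (by rw [segment_symm]; exact openSegment_subset_segment ℝ _ _ hx1)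
    (openSegment_subset_segment ℝ _ _ hx2))

end Bd

end

section

variable {P : Finset ℂ} {A : SimpleGraph ℂ} {γ : ℝ} {o : ℂ} {i : ℕ} {s : ℝ} {V : ℤ → ℂ}

/-! ### Fans -/

/-- `c` is the first convex index after `p`, the points `V p` and `V c` are in near cells and
`V p` sees `V (c + 1)`. -/
structure Fwd (P : Finset ℂ) (A : SimpleGraph ℂ) (γ : ℝ) (o : ℂ) (i : ℕ) (s : ℝ) (V : ℤ → ℂ)
    (p c : ℤ) : Prop where
  lt : p < c
  conv : Conv s V c
  reflex : ∀ k, p < k → k < c → ¬ Conv s V k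
  near : Near γ o i (V c) (V p)
  unc : Unc A (V p) (V (c + 1))
  not_adj : ¬ A.Adj (V p) (V (c + 1))
  facing : 0 < side s (V c) (V (c + 1)) (V p)
  next : Conv s V p → c = p + 1

/-- The position of `V j` in the fan with centre `V (c + 1)` over the chain from `p` to `c`. -/
structure FanAt (P : Finset ℂ) (A : SimpleGraph ℂ) (γ : ℝ) (o : ℂ) (i : ℕ) (s : ℝ) (V : ℤ → ℂ)
    (p c j : ℤ) : Prop where
  tri : 0 < side s (V j) (V (j + 1)) (V (c + 1))
  empty : EmptyTri P s (V j) (V (j + 1)) (V (c + 1))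
  diag : Diag A s V j (c + 1)
  near : Near γ o i (V c) (V j)
  right : 0 < side s (V c) (V (c + 1)) (V j)
  bend : j + 1 < c → side s (V j) (V (j + 1)) (V c) < 0
  inHull : InHull (V p) (V c) (V (c + 1)) (V (c + 1)) (V j)

/-- Directions at `q` on one side of a line through `q` are linearly ordered; the Plücker relation
expresses this. -/
theorem side_trans {q a b c d : ℂ} (hb : 0 < side s a q b) (hc : 0 < side s a q c)
    (hd : 0 < side s a q d) (h1 : 0 < side s b q c) (h2 : 0 < side s c q d) : 0 < side s b q d := by
  have pl := side_pluecker s q a b c d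
  have e1 := side_swap s a q b
  have e2 := side_swap s a q c
  have e3 := side_swap s a q d
  have e4 := side_swap s b q c
  have e5 := side_swap s c q d
  have e6 := side_swap s b q d
  rw [e1, e2, e3, e4, e5, e6] at pl
  by_contra hcon
  push Not at hcon
  have m1 := mul_pos hb h2
  have m2 := mul_pos hd h1
  nlinarith [mul_nonneg hc.le (neg_nonneg.mpr hcon)]

/-- The direction `c` is beyond `a` if it lies between `b` and `d`. -/
theorem side_between {q a b c d : ℂ} (hb : 0 < side s a q b) (hd : 0 < side s a q d)
    (hbd : 0 < side s b q d) (h1 : 0 < side s b q c) (h2 : 0 < side s c q d) :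
    0 < side s a q c := by
  have pl := side_pluecker s q a b c d
  have e1 := side_swap s a q b
  have e2 := side_swap s a q c
  have e3 := side_swap s a q d
  have e4 := side_swap s b q c
  have e5 := side_swap s c q d
  have e6 := side_swap s b q d
  rw [e1, e2, e3, e4, e5, e6] at pl
  by_contra hcon
  push Not at hcon
  have m1 := mul_pos hb h2
  have m2 := mul_pos hd h1
  nlinarith [mul_nonneg hbd.le (neg_nonneg.mpr hcon)]

namespace Fwd

/-- If the chain returned to its start, the two occurrences would be reflex corners at one vertex,
hence the same corner. The walk would then repeat with period `j - p`, and the convex corner at `c`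
would already occur inside the reflex part. -/
theorem ne_start {p c j : ℤ} (hF : Fwd P A γ o i s V p c) (h : Bd P A γ o i s V)
    (h1 : p < j) (h2 : j < c) : V j ≠ V p := by
  intro e
  have hp : ¬ Conv s V p := fun hp => by have := hF.next hp; omega
  have e' := h.eq_of_not_conv (hF.reflex j h1 h2) hp e
  obtain ⟨n, hn⟩ := Int.eq_ofNat_of_zero_le (show 0 ≤ c - 1 - j by omega)
  have e1 := h.eq_add e e' n
  have e2 := h.eq_add e e' (n + 1)
  push_cast at e2
  rw [← hn] at e1 e2
  refine hF.reflex (p + (c - j)) (by omega) (by omega) ?_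
  have hc := hF.conv
  unfold Conv at *
  rw [show j + (c - 1 - j) = c - 1 by ring] at e1
  rw [show j + (c - 1 - j + 1) = c by ring] at e2
  rw [e1.1, e2.1, e2.2] at hc
  convert hc using 3 <;> ring

theorem not_near_end {p c : ℤ} (hF : Fwd P A γ o i s V p c) (h : Bd P A γ o i s V) :
    ¬ Near γ o i (V p) (V (c + 1)) := fun hc =>
  hF.not_adj (h.maxi _ (h.mem _) _ (h.mem _) (side_ne s hF.facing.ne').2.1.symm hc hF.unc)

theorem side_start {p c j : ℤ} (hF : Fwd P A γ o i s V p c) (h : Bd P A γ o i s V)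
    (h1 : p < j) (h2 : j < c) (hj : FanAt P A γ o i s V p c j) :
    0 < side s (V j) (V (c + 1)) (V p) := by
  have hT := (hj.inHull.inTri (s := s) (by rw [← side_rotate]; exact hF.facing.le)).2.2
  have hne := hF.ne_start h h1 h2
  have hp : V p ≠ V (c + 1) := (side_ne s hF.facing.ne').2.1.symm
  rw [side_rotate] at hT
  exact lt_of_le_of_ne hT
    (h.gp.side_ne_zero h.s_ne (h.mem j) (h.mem (c + 1)) (h.mem p) hj.diag.ne hp.symm hne).symm

/-- The candidate for `V j` is the first point in the triangle of `V (j + 1)`, `V (c + 1)` and `V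
p`, seen from `V (j + 1)`. It is adjacent to `V (j + 1)` by maximality, and no edge lies before it,
so it is the previous vertex of the walk. -/
theorem fanAt_of_succ {p c j : ℤ} (hF : Fwd P A γ o i s V p c) (h : Bd P A γ o i s V)
    (hpj : p ≤ j) (hk : j + 1 = c ∨ (j + 1 < c ∧ FanAt P A γ o i s V p c (j + 1))) :
    FanAt P A γ o i s V p c j := by
  have hd : V p ≠ V (c + 1) := (side_ne s hF.facing.ne').2.1.symm
  have hcd := h.adj c
  have k1 : 0 < side s (V (j + 1)) (V (c + 1)) (V p) := by
    rcases hk with e | ⟨hk, hf⟩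
    · rw [e]; exact hF.facing
    · exact hF.side_start h (by omega) hk hf
  have k2 : Link A s V (j + 1) (c + 1) := by
    rcases hk with e | ⟨hk, hf⟩
    · rw [e]; exact Or.inl rfl
    · exact Or.inr hf.diag
  have k3 : InHull (V p) (V c) (V (c + 1)) (V (c + 1)) (V (j + 1)) := by
    rcases hk with e | ⟨hk, hf⟩
    · rw [e]; exact inHull_snd _ _ _ _
    · exact hf.inHull
  have between : ∀ w, 0 < side s (V (j + 1)) (V (c + 1)) w → 0 < side s w (V (c + 1)) (V p) →
      0 < side s (V c) (V (c + 1)) w := by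
    intro w h1 h2
    rcases hk with e | ⟨hk, hf⟩
    · rw [e] at h1; exact h1
    · exact side_between hf.right hF.facing k1 h1 h2
  have hno : ∀ w, A.Adj (V (c + 1)) w →
      ¬ (0 < side s (V (j + 1)) (V (c + 1)) w ∧ 0 < side s (V (c + 1)) (V p) w) := by
    rintro w hw ⟨h1, h2⟩
    refine h.no_adj_wedge (h.mem p) hF.near hF.unc hF.not_adj hF.facing w hw ⟨between w h1 ?_, h2⟩
    rwa [← side_rotate]
  obtain ⟨y, hy⟩ := exists_first h.gp h.pslg (h.mem (j + 1)) (h.mem (c + 1)) (h.mem p) k1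
    (h.unc_of_link k2) hF.unc.symm hno
  have yhull : InHull (V p) (V c) (V (c + 1)) (V (c + 1)) y :=
    (hy.inTri.inHull k1).trans k3 (inHull_trd _ _ _ _) (inHull_fst _ _ _ _) (inHull_fst _ _ _ _)
  -- If `y` were near `V (c + 1)`, it would be adjacent to it: for `y = V p` this is excluded by
  -- hypothesis, and otherwise the edge would point into the wedge that `no_adj_wedge` keeps free.
  have yd : ¬ Near γ o i y (V (c + 1)) := by
    intro hn
    have hadj := h.maxi _ (h.mem (c + 1)) _ hy.mem hy.ne_right.symm hn.symm hy.unc_right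
    rcases hy.strict with e | e
    · exact hF.not_adj (e ▸ hadj.symm)
    · exact hno y hadj ⟨e.1, e.2.1⟩
  have cy : Near γ o i (V c) y := near_of_inHull hF.near (h.near _ _ hcd) yhull
  -- Both points lie in the triangle of `V p`, `V c`, `V (c + 1)` and neither is near `V (c + 1)`,
  -- so the cell lemma applies.
  have ky : Near γ o i (V (j + 1)) y := by
    rcases hk with e | ⟨hk, hf⟩
    · rw [e]; exact cy
    · exact near_of_not_near hF.near (h.near _ _ hcd) (hF.not_near_end h) k3 yhull
        (h.not_near_of_diag hf.diag) yd
  have kadj := h.maxi _ (h.mem (j + 1)) _ hy.mem hy.ne_left.symm ky hy.unc_left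
  have hyj : y = V j := by
    have := h.eq_prev (k := j + 1) (d := V (c + 1)) ?_ (h.mem _) kadj (hy.side_pos k1)
      (fun w hw => hy.no_adj k1 hw)
    · rwa [add_sub_cancel_right] at this
    · rcases k2 with e | e
      · left; rw [e]
      · exact Or.inr e.left
  subst hyj
  have htri : 0 < side s (V j) (V (j + 1)) (V (c + 1)) := by
    rw [← side_rotate]; exact hy.side_pos k1
  have hempty := (hy.emptyTri k1).rotate.rotate
  have hright : 0 < side s (V c) (V (c + 1)) (V j) := by
    rcases hy.strict with e | e
    · rw [e]; exact hF.facing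
    · refine between _ e.1 ?_
      rw [← side_rotate]; exact e.2.1
  refine ⟨htri, hempty, ?_, cy, hright, ?_, yhull⟩
  · exact h.diag_of_emptyTri htri k2 hempty fun hadj => yd (h.near _ _ hadj)
  -- Each reflex corner bends the chain further away: relative to the edge at `j`, the vertex `V c`
  -- stays on the outer side.
  · intro hjc
    have hf := (hk.resolve_left (by omega)).2
    have hrefl := hF.reflex (j + 1) (by omega) hjc
    rw [conv_iff_side, add_sub_cancel_right, not_lt] at hrefl
    have hb : side s (V (j + 1)) (V (j + 1 + 1)) (V c) ≤ 0 := by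
      by_cases e : j + 1 + 1 = c
      · rw [e]; simp
      · exact (hf.bend (by omega)).le
    have pl := side_pluecker s (V (j + 1)) (V (j + 1 + 1)) (V c) (V (c + 1)) (V j)
    have h1 := hf.tri
    have h2 := hy.side_pos k1
    have h3 := hf.right
    have hne : V j ≠ V c := fun e => yd (e ▸ h.near _ _ hcd)
    have hne' : V (j + 1) ≠ V c := fun e => h.not_near_of_diag hf.diag (e ▸ h.near _ _ hcd)
    have h4 := h.gp.side_ne_zero h.s_ne (h.mem j) (h.mem (j + 1)) (h.mem c) (h.adj j).ne hne' hne
    have e1 := side_swap' s (V (j + 1)) (V j) (V (j + 1 + 1))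
    rw [side_rotate s (V (j + 1)) (V c) (V (c + 1))] at h3
    rw [side_rotate s (V j) (V (j + 1)) (V c)] at pl
    refine lt_of_le_of_ne ?_ h4
    by_contra hcon
    push Not at hcon
    rw [e1] at pl
    nlinarith [mul_pos h1 hcon, mul_nonneg hrefl h3.le, mul_nonneg (neg_nonneg.mpr hb) h2.le]

theorem fanAt {p c j : ℤ} (hF : Fwd P A γ o i s V p c) (h : Bd P A γ o i s V) (hpj : p ≤ j)
    (hjc : j < c) : FanAt P A γ o i s V p c j := by
  obtain ⟨n, hn⟩ := Int.eq_ofNat_of_zero_le (show 0 ≤ c - 1 - j by omega)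
  have hj : j + 1 + n = c := by omega
  clear hn hjc
  induction n generalizing j with
  | zero => exact hF.fanAt_of_succ h hpj (Or.inl (by simpa using hj))
  | succ n ih =>
    push_cast at hj
    exact hF.fanAt_of_succ h hpj (Or.inr ⟨by omega, ih (by omega) (by omega)⟩)

/-- The fan over a shorter chain. -/
theorem restrict {p c j : ℤ} (hF : Fwd P A γ o i s V p c) (h : Bd P A γ o i s V) (hpj : p ≤ j)
    (hjc : j < c) : Fwd P A γ o i s V j c := by
  have hf := hF.fanAt h hpj hjc
  refine ⟨hjc, hF.conv, fun k h1 h2 => hF.reflex k (by omega) h2, hf.near, hf.diag.unc,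
    hf.diag.not_adj, hf.right, fun hj => ?_⟩
  rcases hpj.eq_or_lt with rfl | hlt
  · exact hF.next hj
  · exact absurd hj (hF.reflex j hlt hjc)

/-- The triangles of the fan turn about `V (c + 1)` in one sense, and all stay on one side of the
line through `V c`; hence the total turn does not exceed a half-turn. -/
theorem mono {p c j k : ℤ} (hF : Fwd P A γ o i s V p c) (h : Bd P A γ o i s V) (hpj : p ≤ j)
    (hjk : j < k) (hkc : k ≤ c) : 0 < side s (V k) (V (c + 1)) (V j) := by
  obtain ⟨n, hn⟩ := Int.eq_ofNat_of_zero_le (show 0 ≤ k - 1 - j by omega)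
  have hj : j + 1 + n = k := by omega
  clear hn
  induction n generalizing j with
  | zero =>
    rw [← hj]
    simpa [side_rotate] using (hF.fanAt h hpj (by omega)).tri
  | succ n ih =>
    push_cast at hj
    rcases hkc.eq_or_lt with rfl | hkc
    · exact (hF.fanAt h hpj hjk).right
    have h1 := ih (by omega) (by omega) (by omega : j + 1 + 1 + (n : ℤ) = k)
    have h2 : 0 < side s (V (j + 1)) (V (c + 1)) (V j) := by
      rw [side_rotate]; exact (hF.fanAt h hpj (by omega)).tri
    exact side_trans (hF.fanAt h (by omega) hkc).right (hF.fanAt h (by omega) (by omega)).right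
      (hF.fanAt h hpj (by omega)).right h1 h2

end Fwd

end

/-! ### Points that see a fan from outside -/

section

variable {P : Finset ℂ} {A : SimpleGraph ℂ} {γ : ℝ} {o : ℂ} {i : ℕ} {s : ℝ} {V : ℤ → ℂ}

theorem side_bary (s t : ℝ) (a b p q r z : ℂ) : side s a b z * side t p q r =
    side s a b p * side t q r z + side s a b q * side t r p z + side s a b r * side t p q z := by
  unfold side; ring

theorem IsFirst.side_pos_of_vertices {t : ℝ} {p q r y a b : ℂ} (h : IsFirst P A t p q r y)
    (ht : 0 < side t p q r) (hp : 0 ≤ side s a b p) (hq : 0 ≤ side s a b q)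
    (hr : 0 < side s a b r) : 0 < side s a b y := by
  rcases h.strict with e | ⟨e1, e2, e3⟩
  · rwa [e]
  · have := side_bary s t a b p q r y
    have := mul_nonneg hp e2.le
    have := mul_nonneg hq e3.le
    have := mul_pos hr e1
    by_contra hcon
    push Not at hcon
    nlinarith

/-- A point that sees the chain of a fan from outside the fan is not near the convex vertex. -/
theorem Fwd.not_near {p c j : ℤ} (hF : Fwd P A γ o i s V p c) (h : Bd P A γ o i s V)
    (hpj : p ≤ j) (hjc : j ≤ c) {y : ℂ} (hy : y ∈ P) (hunc : Unc A (V j) y) (hin : InC s V j y)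
    (h1 : j < c → 0 < side s (V j) (V (c + 1)) y) (h2 : 0 < side s (V c) (V (c + 1)) y) :
    ¬ Near γ o i (V c) y := by
  intro hn
  obtain ⟨n, hn'⟩ := Int.eq_ofNat_of_zero_le (show 0 ≤ c - j by omega)
  have hj : j + n = c := by omega
  clear hn'
  induction n generalizing j y with
  | zero =>
    obtain rfl : j = c := by simpa using hj
    exact h.not_inC_of_adj
      (h.maxi _ (h.mem _) _ hy (side_ne s h2.ne').2.2 hn hunc) hin
  | succ n ih =>
    push_cast at hj
    have hlt : j < c := by omega
    have h1 := h1 hlt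
    have hf := hF.fanAt h hpj hlt
    have hyj : V j ≠ y := (side_ne s h1.ne').2.2
    have hcd := h.near _ _ (h.adj c)
    have hcd' : 0 < side s (V j) (V c) (V (c + 1)) := by
      have := hf.right
      rwa [side_rotate s (V j) (V c) (V (c + 1))] at this
    have kc : 0 ≤ side s (V c) (V (c + 1)) (V (j + 1)) := by
      by_cases e : j + 1 = c
      · rw [e]; simp
      · exact (hF.fanAt h (by omega) (by omega)).right.le
    have kn : Near γ o i (V c) (V (j + 1)) := by
      by_cases e : j + 1 = c
      · rw [e]; exact near_refl _
      · exact (hF.fanAt h (by omega) (by omega)).near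
    -- If `y` is on the outer side of the edge, then `V j` lies in the triangle of `V c`, `V (c +
    -- 1)`, `y`, and is near `y` or near `V (c + 1)`; both contradict maximality.
    rcases le_or_gt (side s (V j) (V (j + 1)) y) 0 with ho | ho
    · have hb : side s (V j) (V (j + 1)) (V c) ≤ 0 := by
        by_cases e : j + 1 = c
        · rw [e]; simp
        · exact (hf.bend (by omega)).le
      have pl := side_pluecker s (V j) (V (j + 1)) (V c) (V (c + 1)) y
      have ht := hf.tri
      have h3 : 0 ≤ side s (V j) y (V c) := by
        rw [side_swap']
        by_contra hcon
        push Not at hcon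
        nlinarith [mul_pos ht (by linarith : 0 < side s (V j) (V c) y),
          mul_nonneg (neg_nonneg.mpr hb) h1.le, mul_nonneg (neg_nonneg.mpr ho) hcd'.le]
      have hT : InTri s (V c) (V (c + 1)) y (V j) :=
        ⟨by rw [side_rotate]; exact hcd'.le, by rw [side_rotate]; exact h1.le,
          by rw [side_rotate]; exact h3⟩
      have hH := hT.inHull h2
      have hH' : InHull (V c) y (V (c + 1)) (V (c + 1)) (V j) :=
        fun α β m a1 a2 a3 a4 => hH α β m a1 a3 a2 a2
      rcases near_or_near_of_inHull hn hcd hH' with e | e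
      · exact h.not_inC_of_adj (h.maxi _ (h.mem _) _ hy hyj e hunc) hin
      · exact h.not_near_of_diag hf.diag e
    -- On the inner side, the first point of the triangle `V (j + 1)`, `V j`, `y` sees `V (j + 1)`
    -- and is still near `V c`, so the induction moves one vertex towards `c`.
    · have ht : 0 < side (-s) (V (j + 1)) (V j) y := by rw [side_neg, side_swap, neg_neg]; exact ho
      obtain ⟨y', hy'⟩ := exists_first h.gp h.pslg (h.mem (j + 1)) (h.mem j) hy ht
        (h.pslg.unc (h.adj j).symm) hunc (by
          rintro w hw ⟨w1, w2⟩
          rw [side_neg, side_swap, neg_neg] at w1 w2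
          exact h.not_inC_of_adj hw (h.inC_wedge (Or.inr hin) w1 w2))
      have g4 : 0 < side s (V c) (V (c + 1)) y' := hy'.side_pos_of_vertices ht kc hf.right.le h2
      have g5 : 0 < side s (V j) (V (j + 1)) y' := by
        have := hy'.side_pos ht
        rwa [side_neg, side_swap, neg_neg] at this
      refine ih (j := j + 1) (by omega) (by omega) hy'.mem hy'.unc_left ?_ ?_ g4 ?_ (by omega)
      · by_cases e : j + 1 = c
        · subst e
          exact h.inC_of_sides g4 (by rwa [add_sub_cancel_right])
        · exact h.inC_of_side' (hF.reflex (j + 1) (by omega) (by omega))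
            (by rwa [add_sub_cancel_right])
      · intro hlt'
        have hk := hF.fanAt h (show p ≤ j + 1 by omega) hlt'
        have hm := hF.mono h hpj (show j < j + 1 by omega) hlt
        refine hy'.side_pos_of_vertices ht (by simp) hm.le ?_
        exact side_trans hk.right hf.right h2 hm h1
      · exact near_of_inHull_of_near kn hf.near hn hn (hy'.inTri.inHull ht)

end

section

variable {P : Finset ℂ} {A : SimpleGraph ℂ} {γ : ℝ} {o : ℂ} {i : ℕ} {s : ℝ} {V : ℤ → ℂ}

/-! ### Quadrilaterals between two chains -/

theorem InTri.side_nonneg {p q r z : ℂ} (h : InTri s p q r z) (ht : 0 < side s p q r) {a b : ℂ}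
    (hp : 0 ≤ side s a b p) (hq : 0 ≤ side s a b q) (hr : 0 ≤ side s a b r) :
    0 ≤ side s a b z :=
  (h.inHull ht).side_nonneg hp hq hr hr

/-- If two edges `a a'` and `b' b` start from the segment `a' b'` to the same side, then `b` is on
the inner side of the first one. -/
theorem side_pos_of_edges (gp : GeneralPosition P) (hA : IsPSLG P A) (hs : s ≠ 0) {a a' b' b : ℂ}
    (haa : A.Adj a a') (hbb : A.Adj b' b) (hne : a ≠ b) (hab : a ≠ b')
    (h1 : 0 < side s a a' b') (h2 : 0 < side s a' b' b) (he : EmptyTri P s a' b' b) :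
    0 < side s a a' b := by
  have ha := (hA.endpoints _ _ haa)
  have hb := (hA.endpoints _ _ hbb)
  have h0 := gp.side_ne_zero hs ha.1 ha.2 hb.2 haa.ne (side_ne s h2.ne').2.2 hne
  by_contra hcon
  have h3 : side s a a' b < 0 := lt_of_le_of_ne (not_lt.mp hcon) h0
  have h4 : side s b' b a < 0 := by
    by_contra hc
    push Not at hc
    have h5 := side_rotate' s a' b a
    have h6 := side_swap' s a a' b
    have h7 := side_rotate s a a' b'
    have h8 := side_swap s a' b a
    have h9 := side_rotate s a a' b
    rcases he a ha.1 ⟨by linarith, hc, by linarith⟩ with e | e | e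
    · exact haa.ne e
    · exact hab e
    · exact hne e
  refine hA.unc haa.symm b b' hbb.symm (crosses_of_side (s := s) ?_ ?_ ?_ ?_)
  · rw [side_swap]; linarith
  · rw [side_swap]; linarith
  · rw [side_swap]
    have := side_rotate s a' b' b
    linarith
  · rw [side_swap]; linarith

/-- In a convex quadrilateral, of whose four triangles one is empty. -/
theorem inTri_of_quad {a a' b' b z : ℂ} (h1 : 0 < side s a a' b')
    (h2 : 0 < side s a' b' b) (h3 : 0 < side s a a' b) (h4 : 0 < side s a b' b)
    (he : EmptyTri P s a' b' b) (hz : z ∈ P) (hzb : z ≠ b') (hzb' : z ≠ b)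
    (hi : InTri s a b' b z) : InTri s a a' b z := by
  refine ⟨hi.side_nonneg h4 (by simp) h1.le h3.le, ?_, hi.2.2⟩
  by_contra hcon
  push Not at hcon
  have h5 := side_swap s a' b z
  rcases he z hz ⟨hi.side_nonneg h4 (by rw [side_rotate]; exact h1.le) (by simp) h2.le, hi.2.1,
    by linarith⟩ with e | e | e
  · rw [e] at hcon; simp at hcon
  · exact hzb e
  · exact hzb' e

/-- The first point of the triangle `a b' b` sees `a'`. -/
theorem IsFirst.unc_of_quad {a a' b' b w : ℂ} (hw : IsFirst P A s a b' b w)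
    (gp : GeneralPosition P) (hA : IsPSLG P A) (haa : A.Adj a a') (hb' : b' ∈ P)
    (h1 : 0 < side s a a' b') (h2 : 0 < side s a' b' b) (h3 : 0 < side s a a' b)
    (h4 : 0 < side s a b' b) (he : EmptyTri P s a a' b')
    (hst : 0 < side s a b' w ∧ 0 < side s b' b w ∧ 0 < side s b a w)
    (hadj : ¬ A.Adj a b') (hno : ∀ x, A.Adj a x → ¬ (0 < side s a a' x ∧ 0 < side s b' a x)) :
    Unc A a' w := by
  have ha := hA.endpoints _ _ haa
  have hs : s ≠ 0 := by rintro rfl; simp [side] at h1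
  have w1 : 0 < side s a a' w := hw.side_pos_of_vertices h4 (by simp) h1.le h3
  have w2 : 0 < side s a' b' w :=
    hw.side_pos_of_vertices h4 (by rw [side_rotate]; exact h1.le) (by simp) h2
  -- The line `a b'` cuts this triangle into a part swept before `w` and a part inside the empty
  -- triangle `a a' b'`.
  have hemp : EmptyTri P s a a' w := by
    intro z hz hi
    have hb2 : 0 ≤ side s b' b z := by
      refine hi.side_nonneg w1 ?_ ?_ hst.2.1.le
      · rw [side_rotate]; exact h4.le
      · rw [side_rotate]; exact h2.le
    have hb3 : 0 ≤ side s b a z := by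
      refine hi.side_nonneg w1 (by simp) ?_ hst.2.2.le
      rw [side_rotate']; exact h3.le
    rcases lt_or_ge 0 (side s a b' z) with hc | hc
    · rcases hw.first z hz ⟨hc.le, hb2, hb3⟩ (side_ne s hc.ne').2.2.symm
        (side_ne s hc.ne').2.1.symm with e | e
      · exact Or.inr (Or.inr e)
      · have := hi.2.2
        rw [← side_rotate] at this
        linarith
    · have h5 := side_swap s a b' z
      rcases he z hz ⟨hi.1, hi.side_nonneg w1 (by rw [side_rotate]; exact h1.le) (by simp) w2.le,
        by linarith⟩ with e | e | e
      · exact Or.inl e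
      · exact Or.inr (Or.inl e)
      · exfalso
        have := hi.2.1
        rw [e, side_swap'] at this
        linarith
  have ht : 0 < side (-s) a' a w := by rw [side_neg, side_swap, neg_neg]; exact w1
  obtain ⟨y, hy⟩ := exists_first gp hA ha.2 ha.1 hw.mem ht (hA.unc haa.symm) hw.unc_left (by
    rintro x hx ⟨x1, x2⟩
    rw [side_neg, side_swap, neg_neg] at x1 x2
    have hxP := (hA.endpoints _ _ hx).2
    have hxb : x ≠ b' := by rintro rfl; exact hadj hx
    have := gp.side_ne_zero hs ha.1 hb' hxP (side_ne s h1.ne').2.2 hxb.symm hx.ne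
    rcases lt_or_gt_of_ne this with h | h
    · refine hno x hx ⟨x1, ?_⟩
      rw [side_swap]; linarith
    · refine hw.no_adj h4 hx ⟨h, ?_⟩
      rwa [side_rotate'] at x2)
  rcases hemp y hy.mem (by simpa using hy.inTri.reverse.rotate) with e | e | e
  · exact absurd e hy.ne_right
  · exact absurd e hy.ne_left
  · exact e ▸ hy.unc_left

end

/-! ### Pairs of meeting fans: set-up and the quadrilateral step -/

section

variable {P : Finset ℂ} {A : SimpleGraph ℂ} {γ : ℝ} {o : ℂ} {i : ℕ} {s : ℝ} {V : ℤ → ℂ}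

/-- A forward fan from `p` with convex index `c` that meets a backward fan from `q` with convex
index `g`. -/
structure Pair (P : Finset ℂ) (A : SimpleGraph ℂ) (γ : ℝ) (o : ℂ) (i : ℕ) (s : ℝ) (V : ℤ → ℂ)
    (p c g q : ℤ) : Prop where
  bd : Bd P A γ o i s V
  fwd : Fwd P A γ o i s V p c
  bwd : Fwd P A γ o i (-s) (fun k => V (-k)) (-q) (-g)
  convex : g = c ∨ (g = c + 1 ∧ (Conv s V p → Conv s V (p - 1)) ∧ (Conv s V q → Conv s V (q + 1)))

/-- The triangles over the segment from `V a` to `V b` between two fans. -/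
structure Quad (P : Finset ℂ) (A : SimpleGraph ℂ) (s : ℝ) (V : ℤ → ℂ) (p q e d a b : ℤ) :
    Prop where
  tri_left : a < e → 0 < side s (V a) (V (a + 1)) (V b)
  empty_left : a < e → EmptyTri P s (V a) (V (a + 1)) (V b)
  apex_left : a < e → 0 < side s (V a) (V e) (V b)
  tri_right : d < b → 0 < side s (V a) (V (b - 1)) (V b)
  empty_right : d < b → EmptyTri P s (V a) (V (b - 1)) (V b)
  apex_right : d < b → 0 < side s (V a) (V d) (V b)
  link : Link A s V a b ∨ (A.Adj (V a) (V b) ∧ a = p ∧ b = q)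

theorem Quad.rev (h : Bd P A γ o i s V) {p q e d a b : ℤ} (hQ : Quad P A s V p q e d a b) :
    Quad P A (-s) (fun k => V (-k)) (-q) (-p) (-d) (-e) (-b) (-a) := by
  constructor
  · intro hlt
    simp only [neg_neg]
    rw [show -(-b + 1) = b - 1 by ring, side_reverse]
    exact hQ.tri_right (by omega)
  · intro hlt
    simp only [neg_neg]
    rw [show -(-b + 1) = b - 1 by ring]
    exact (hQ.empty_right (by omega)).reverse
  · intro hlt
    simp only [neg_neg]
    rw [side_reverse]
    exact hQ.apex_right (by omega)
  · intro hlt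
    simp only [neg_neg]
    rw [show -(-a - 1) = a + 1 by ring, side_reverse]
    exact hQ.tri_left (by omega)
  · intro hlt
    simp only [neg_neg]
    rw [show -(-a - 1) = a + 1 by ring]
    exact (hQ.empty_left (by omega)).reverse
  · intro hlt
    simp only [neg_neg]
    rw [side_reverse]
    exact hQ.apex_left (by omega)
  · rcases hQ.link with hl | ⟨hl, e1, e2⟩
    · exact Or.inl (h.link_rev.mpr hl)
    · right
      simp only [neg_neg]
      exact ⟨hl.symm, by omega, by omega⟩

namespace Pair

variable {p c g q a b : ℤ}

theorem rev (h : Pair P A γ o i s V p c g q) :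
    Pair P A γ o i (-s) (fun k => V (-k)) (-q) (-g) (-c) (-p) := by
  refine ⟨h.bd.rev, h.bwd, ?_, ?_⟩
  · simpa using h.fwd
  · rw [conv_rev, conv_rev, show -p + 1 = -(p - 1) by ring, show -q - 1 = -(q + 1) by ring,
      conv_rev, conv_rev]
    rcases h.convex with e | ⟨e, h1, h2⟩
    · exact Or.inl (by rw [e])
    · exact Or.inr ⟨by omega, h2, h1⟩

/-- The triangles over the segments to the forward support vertex. -/
theorem quad_left (h : Pair P A γ o i s V p c g q) (hpa : p ≤ a) (hag : a < g) :
    Quad P A s V p q (g - 1) (c + 1) a (c + 1) := by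
  have hcg : g = c ∨ g = c + 1 := h.convex.imp id And.left
  constructor
  · intro hlt; exact (h.fwd.fanAt h.bd hpa (by omega)).tri
  · intro hlt; exact (h.fwd.fanAt h.bd hpa (by omega)).empty
  · intro hlt
    rw [← side_rotate]
    exact h.fwd.mono h.bd hpa hlt (by omega)
  · intro hlt; omega
  · intro hlt; omega
  · intro hlt; omega
  · left
    by_cases e : a = c
    · rw [e]; exact Or.inl rfl
    · exact Or.inr (h.fwd.fanAt h.bd hpa (by omega)).diag

/-- The facts from which the triangles over the segment from `V a` to `V b` are obtained. -/
structure Step (P : Finset ℂ) (A : SimpleGraph ℂ) (γ : ℝ) (o : ℂ) (i : ℕ) (s : ℝ) (V : ℤ → ℂ)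
    (p c g q a b : ℤ) : Prop where
  pair : Pair P A γ o i s V p c g q
  pa : p ≤ a
  ag : a + 1 < g
  cb : c + 1 < b
  bq : b ≤ q
  quad_a : Quad P A s V p q (g - 1) (c + 1) a (b - 1)
  quad_b : Quad P A s V p q (g - 1) (c + 1) (a + 1) b
  quad_ab : Quad P A s V p q (g - 1) (c + 1) (a + 1) (b - 1)
  diag_a : Diag A s V a (b - 1)
  diag_b : Diag A s V (a + 1) b

namespace Step

theorem rev (h : Step P A γ o i s V p c g q a b) :
    Step P A γ o i (-s) (fun k => V (-k)) (-q) (-g) (-c) (-p) (-b) (-a) where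
  pair := h.pair.rev
  pa := by have := h.bq; omega
  ag := by have := h.cb; omega
  cb := by have := h.ag; omega
  bq := by have := h.pa; omega
  quad_a := by
    have := h.quad_b.rev h.pair.bd
    convert this using 1 <;> ring
  quad_b := by
    have := h.quad_a.rev h.pair.bd
    convert this using 1 <;> ring
  quad_ab := by
    have := h.quad_ab.rev h.pair.bd
    convert this using 1 <;> ring
  diag_a := by
    rw [show -a - 1 = -(a + 1) by ring, h.pair.bd.diag_rev]; exact h.diag_b
  diag_b := by
    rw [show -b + 1 = -(b - 1) by ring, h.pair.bd.diag_rev]; exact h.diag_a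

theorem adj_b (h : Step P A γ o i s V p c g q a b) :
    A.Adj (V (b - 1)) (V b) := (h.pair.bd.adj' b).symm

theorem ne (h : Step P A γ o i s V p c g q a b) :
    V a ≠ V b := fun e => h.diag_a.not_adj (e ▸ h.pair.bd.adj' b)

theorem side_b (h : Step P A γ o i s V p c g q a b) :
    0 < side s (V (a + 1)) (V (b - 1)) (V b) := h.quad_b.tri_right h.cb

theorem empty_b (h : Step P A γ o i s V p c g q a b) :
    EmptyTri P s (V (a + 1)) (V (b - 1)) (V b) := h.quad_b.empty_right h.cb

theorem side_a (h : Step P A γ o i s V p c g q a b) :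
    0 < side s (V a) (V (a + 1)) (V (b - 1)) :=
  h.quad_a.tri_left (by have := h.ag; omega)

theorem empty_a (h : Step P A γ o i s V p c g q a b) :
    EmptyTri P s (V a) (V (a + 1)) (V (b - 1)) :=
  h.quad_a.empty_left (by have := h.ag; omega)

/-- If the two outer edges converged so far that `V b` fell beyond the line of the first edge, the
edges would cross, or `V a` would lie in an empty triangle. -/
theorem tri_left (h : Step P A γ o i s V p c g q a b) :
    0 < side s (V a) (V (a + 1)) (V b) :=
  side_pos_of_edges h.pair.bd.gp h.pair.bd.pslg h.pair.bd.s_ne (h.pair.bd.adj a) h.adj_b h.ne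
    h.diag_a.ne h.side_a h.side_b h.empty_b

theorem tri_right (h : Step P A γ o i s V p c g q a b) :
    0 < side s (V a) (V (b - 1)) (V b) := by
  have := h.rev.tri_left
  rw [show -b + 1 = -(b - 1) by ring] at this
  simpa [side_reverse] using this

theorem inTri (h : Step P A γ o i s V p c g q a b) {z : ℂ} (hz : z ∈ P)
    (hi : InTri s (V a) (V (b - 1)) (V b) z)
    (h1 : z ≠ V (b - 1)) (h2 : z ≠ V b) : InTri s (V a) (V (a + 1)) (V b) z :=
  inTri_of_quad h.side_a h.side_b h.tri_left h.tri_right h.empty_b hz h1 h2 hi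

/-- The ray rotates about `V a` from `V (b - 1)` to `V b`. Edges at `V (b - 1)` into the triangle
would lie in the corner there, between the diagonal and the outgoing edge. -/
theorem exists_isFirst (h : Step P A γ o i s V p c g q a b) :
    ∃ w, IsFirst P A s (V a) (V (b - 1)) (V b) w := by
  refine exists_first h.pair.bd.gp h.pair.bd.pslg (h.pair.bd.mem _) (h.pair.bd.mem _)
    (h.pair.bd.mem _) h.tri_right h.diag_a.unc (h.pair.bd.pslg.unc h.adj_b) ?_
  rintro w hw ⟨w1, w2⟩
  refine h.pair.bd.not_inC_of_adj hw (h.pair.bd.inC_wedge (Or.inr h.diag_a.right) ?_ w1)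
  rwa [sub_add_cancel]

end Step

end Pair

end

/-! ### Emptiness of the triangles between two fans -/

section

variable {P : Finset ℂ} {A : SimpleGraph ℂ} {γ : ℝ} {o : ℂ} {i : ℕ} {s : ℝ} {V : ℤ → ℂ}

namespace Pair

variable {p c g q a b : ℤ}

theorem fanAt_bwd (h : Pair P A γ o i s V p c g q) (hgb : g < b) (hbq : b ≤ q) :
    FanAt P A γ o i (-s) (fun k => V (-k)) (-q) (-g) (-b) :=
  h.bwd.fanAt h.bd.rev (by omega) (by omega)

theorem bwd_right (h : Pair P A γ o i s V p c g q) (hgb : g < b) (hbq : b ≤ q) :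
    0 < side s (V (g - 1)) (V g) (V b) := by
  have := (h.fanAt_bwd hgb hbq).right
  simp only [neg_neg] at this
  rwa [side_neg, side_swap, neg_neg, show -(-g + 1) = g - 1 by ring] at this

theorem bwd_near (h : Pair P A γ o i s V p c g q) (hgb : g < b) (hbq : b ≤ q) :
    Near γ o i (V g) (V b) := by
  have := (h.fanAt_bwd hgb hbq).near
  simpa only [neg_neg] using this

theorem bwd_tri (h : Pair P A γ o i s V p c g q) (hgb : g < b) (hbq : b ≤ q) :
    0 < side s (V (g - 1)) (V (b - 1)) (V b) := by
  have := (h.fanAt_bwd hgb hbq).tri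
  simp only [neg_neg] at this
  rwa [side_reverse, show -(-g + 1) = g - 1 by ring, show -(-b + 1) = b - 1 by ring] at this

theorem bwd_diag (h : Pair P A γ o i s V p c g q) (hgb : g < b) (hbq : b ≤ q) :
    Diag A s V (g - 1) b := by
  have := (h.fanAt_bwd hgb hbq).diag
  rwa [show -g + 1 = -(g - 1) by ring, h.bd.diag_rev] at this

theorem bwd_mono {k : ℤ} (h : Pair P A γ o i s V p c g q) (hgk : g ≤ k) (hkb : k < b)
    (hbq : b ≤ q) : 0 < side s (V (g - 1)) (V k) (V b) := by
  have := h.bwd.mono (j := -b) (k := -k) h.bd.rev (by omega) (by omega) (by omega)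
  simp only [neg_neg] at this
  rwa [side_neg, side_swap, neg_neg, show -(-g + 1) = g - 1 by ring] at this

theorem bwd_reflex (h : Pair P A γ o i s V p c g q) (hgb : g < b) (hbq : b < q) :
    ¬ Conv s V b := by
  have := h.bwd.reflex (-b) (by omega) (by omega)
  rwa [conv_rev] at this

namespace Step

/-- A point of `P` in the triangle of `V a`, `V (b - 1)`, `V b` that sees `V a`, `V (a + 1)` and
`V (b - 1)`. -/
structure Witness (P : Finset ℂ) (A : SimpleGraph ℂ) (s : ℝ) (V : ℤ → ℂ) (a b : ℤ) (w : ℂ) :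
    Prop where
  first : IsFirst P A s (V a) (V (b - 1)) (V b) w
  strict : 0 < side s (V a) (V (b - 1)) w ∧ 0 < side s (V (b - 1)) (V b) w ∧
    0 < side s (V b) (V a) w
  unc : Unc A (V (a + 1)) w

/-- In a non-empty triangle the first point is not the vertex `V b`, hence strictly inside. It sees
`V a` and `V (b - 1)` by construction and `V (a + 1)` by the quadrilateral argument. -/
theorem exists_witness (h : Step P A γ o i s V p c g q a b)
    (he : ¬ EmptyTri P s (V a) (V (b - 1)) (V b)) : ∃ w, Witness P A s V a b w := by
  have hbd := h.pair.bd
  obtain ⟨w, hw⟩ := h.exists_isFirst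
  have hst : 0 < side s (V a) (V (b - 1)) w ∧ 0 < side s (V (b - 1)) (V b) w ∧
      0 < side s (V b) (V a) w := by
    rcases hw.strict with e | e
    · exact absurd (e ▸ hw.emptyTri h.tri_right) he
    · exact e
  refine ⟨w, hw, hst, hw.unc_of_quad hbd.gp hbd.pslg (hbd.adj a) (hbd.mem _) h.side_a h.side_b
    h.tri_left h.tri_right h.empty_a hst h.diag_a.not_adj ?_⟩
  rintro x hx ⟨x1, x2⟩
  exact hbd.not_inC_of_adj hx (hbd.inC_wedge (Or.inr h.diag_a.left) x1 x2)

variable {w : ℂ}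

theorem Witness.side_outer (hw : Witness P A s V a b w) (h : Step P A γ o i s V p c g q a b) :
    0 < side s (V a) (V (a + 1)) w :=
  hw.first.side_pos_of_vertices h.tri_right (by simp) h.side_a.le h.tri_left

/-- The witness is not near the forward convex vertex. -/
theorem Witness.not_near (hw : Witness P A s V a b w) (h : Step P A γ o i s V p c g q a b)
    (hs : 0 < side s (V c) (V (c + 1)) w) : ¬ Near γ o i (V c) w := by
  have hbd := h.pair.bd
  have hcg : g = c ∨ g = c + 1 := h.pair.convex.imp id And.left
  have h1 := h.pa
  have h2 := h.ag
  have h3 := h.cb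
  have h4 := h.bq
  have hl := hw.side_outer h
  refine h.pair.fwd.not_near (j := a + 1) hbd (by omega) (by omega) hw.first.mem hw.unc ?_ ?_ hs
  · by_cases e : a + 1 = c
    · subst e
      exact hbd.inC_of_sides hs (by rwa [add_sub_cancel_right])
    · exact hbd.inC_of_side' (h.pair.fwd.reflex _ (by omega) (by omega))
        (by rwa [add_sub_cancel_right])
  · intro hlt
    refine hw.first.side_pos_of_vertices h.tri_right ?_ ?_ (h.quad_b.apex_right h3)
    · rw [side_rotate]; exact (h.pair.fwd.fanAt hbd h1 (by omega)).tri.le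
    · by_cases e : b - 1 = c + 1
      · rw [e]; simp
      · exact (h.quad_ab.apex_right (by omega)).le

/-- The witness is not near the backward convex vertex. -/
theorem Witness.not_near' (hw : Witness P A s V a b w) (h : Step P A γ o i s V p c g q a b)
    (hs : 0 < side s (V (g - 1)) (V g) w) : ¬ Near γ o i (V g) w := by
  have hbd := h.pair.bd
  have hcg : g = c ∨ g = c + 1 := h.pair.convex.imp id And.left
  have h1 := h.pa
  have h2 := h.ag
  have h3 := h.cb
  have h4 := h.bq
  have hwb : w ≠ V (b - 1) := hw.first.ne_right
  have := h.pair.bwd.not_near (j := -(b - 1)) (y := w) hbd.rev (by omega) (by omega) hw.first.mem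
    (by simpa only [neg_neg] using hw.first.unc_right) ?_ ?_ ?_
  · simpa only [neg_neg] using this
  · rw [hbd.inC_rev hwb]
    by_cases e : b - 1 = g
    · subst e
      exact hbd.inC_of_sides (by rw [sub_add_cancel]; exact hw.strict.2.1) hs
    · exact hbd.inC_of_side (h.pair.bwd_reflex (by omega) (by omega))
        (by rw [sub_add_cancel]; exact hw.strict.2.1)
  · intro hlt
    simp only [neg_neg]
    rw [side_neg, side_swap, neg_neg, show -(-g + 1) = g - 1 by ring]
    refine hw.first.side_pos_of_vertices h.tri_right ?_ (by simp) ?_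
    · rw [side_rotate]; exact (h.quad_a.apex_left (by omega)).le
    · exact h.pair.bwd_tri (by omega) h4
  · simp only [neg_neg]
    rwa [side_neg, side_swap, neg_neg, show -(-g + 1) = g - 1 by ring]

theorem Witness.inHull (hw : Witness P A s V a b w) (h : Step P A γ o i s V p c g q a b) :
    InHull (V a) (V (b - 1)) (V b) (V b) w := hw.first.inTri.inHull h.tri_right

/-- With a common convex vertex `V g`, all three vertices of the triangle are near `V g`, and so is
the witness. It lies beyond the chord of the ear at `g`, hence on the inner side of one of the two
edges at `g`, and the fan belonging to that edge forbids nearness. -/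
theorem Witness.false_of_eq (hw : Witness P A s V a b w) (h : Step P A γ o i s V p c g q a b)
    (e : g = c) : False := by
  subst e
  have hbd := h.pair.bd
  have h1 := h.pa
  have h2 := h.ag
  have h3 := h.cb
  have h4 := h.bq
  have hn : Near γ o i (V g) w := by
    have hb := h.pair.bwd_near (by omega : g < b) h4
    exact near_of_inHull_of_near (h.pair.fwd.fanAt hbd h1 (by omega)).near
      (h.pair.bwd_near (by omega : g < b - 1) (by omega)) hb hb (hw.inHull h)
  have hs : 0 < side s (V (g - 1)) (V (g + 1)) w := by
    refine hw.first.side_pos_of_vertices h.tri_right ?_ ?_ ?_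
    · exact (h.pair.fwd.mono hbd h1 (by omega) (by omega)).le
    · by_cases e : b - 1 = g + 1
      · rw [e]; simp
      · exact (h.pair.bwd_mono (by omega) (by omega) (by omega)).le
    · exact h.pair.bwd_mono (by omega) (by omega) (by omega)
  have hc := h.pair.fwd.conv
  unfold Conv at hc
  have key := side_add s (V (g - 1)) (V g) (V (g + 1)) w
  have key2 := side_swap s (V (g - 1)) (V (g + 1)) w
  rcases lt_or_ge 0 (side s (V g) (V (g + 1)) w) with e | e
  · exact hw.not_near h e hn
  · exact hw.not_near' h (by linarith) hn

theorem Witness.side_convex (hw : Witness P A s V a b w) (h : Step P A γ o i s V p c g q a b)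
    (e : g = c + 1) : 0 < side s (V c) (V (c + 1)) w := by
  have hbd := h.pair.bd
  have h1 := h.pa
  have h2 := h.ag
  have h3 := h.cb
  have h4 := h.bq
  have e' : g - 1 = c := by omega
  refine hw.first.side_pos_of_vertices h.tri_right
    (h.pair.fwd.fanAt hbd h1 (by omega)).right.le ?_ ?_
  · by_cases e1 : b - 1 = c + 1
    · rw [e1]; simp
    · have := h.pair.bwd_right (b := b - 1) (by omega) (by omega)
      rw [e', e] at this
      exact this.le
  · have := h.pair.bwd_right (b := b) (by omega) (by omega)
    rwa [e', e] at this

/-- Otherwise the witness is adjacent to `V a` and is the previous vertex of the walk, which makes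
the corner at `a` convex and forces `a = p`. Then the corner at `p - 1` is convex as well, and the
edge leaving it backwards enters the part that the first-point property keeps free. This is what the
extra condition in `Pair.convex` is for. -/
theorem Witness.not_near_left (hw : Witness P A s V a b w)
    (h : Step P A γ o i s V p c g q a b) (e : g = c + 1) : ¬ Near γ o i w (V a) := by
  intro hn
  have hbd := h.pair.bd
  have h1 := h.pa
  have h2 := h.ag
  have hadj := hbd.maxi _ (hbd.mem a) _ hw.first.mem hw.first.ne_left.symm hn.symm
    hw.first.unc_left
  have hwa := hbd.eq_prev (Or.inr h.diag_a.left) (hbd.mem _) hadj hw.strict.1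
    (fun x hx => hw.first.no_adj h.tri_right hx)
  have hca : Conv s V a := by
    have := hw.side_outer h
    rw [hwa] at this
    unfold Conv
    rwa [← side_rotate]
  obtain rfl : a = p := by
    by_contra hne
    exact h.pair.fwd.reflex a (by omega) (by omega) hca
  have hcp : Conv s V (a - 1) := by
    rcases h.pair.convex with e' | ⟨-, h5, -⟩
    · omega
    · exact h5 hca
  unfold Conv at hcp
  rw [sub_add_cancel, ← hwa] at hcp
  have hx := hbd.adj' (a - 1)
  rw [← hwa] at hx
  obtain ⟨u, u0, u1, f1, f2⟩ := exists_small_lp (side_lp s (V a) (V (b - 1)) w (V (a - 1 - 1)))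
    (side_lp s (V (b - 1)) (V b) w (V (a - 1 - 1))) hw.strict.1 hw.strict.2.1
  refine hw.first.free _ _ hx (lp w (V (a - 1 - 1)) u)
    (mem_segment_lp.mpr ⟨u, u0.le, u1.le, rfl⟩) ⟨f1, f2, ?_⟩
  rw [side_rotate s w (V a), side_lp, side_left, ← side_rotate s w (V a)]
  rw [← side_rotate] at hcp
  rw [← side_rotate] at hcp
  nlinarith [mul_pos u0 hcp]

/-- Replaces the inner vertex `V (b - 1)` by the convex vertices, as the cell lemma for
quadrilaterals requires. -/
theorem witness_hull (hw : Witness P A s V a b w) (h : Step P A γ o i s V p c g q a b)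
    (e : g = c + 1) : InHull (V a) (V b) (V c) (V (c + 1)) w := by
  have hbd := h.pair.bd
  have h1 := h.pa
  have h2 := h.ag
  have h3 := h.cb
  have h4 := h.bq
  have e' : g - 1 = c := by omega
  refine (hw.inHull h).trans (inHull_fst _ _ _ _) ?_ (inHull_snd _ _ _ _) (inHull_snd _ _ _ _)
  by_cases e1 : b - 1 = c + 1
  · rw [e1]; exact inHull_fth _ _ _ _
  · have hr := h.pair.bwd.restrict (j := -b) hbd.rev (by omega) (by omega)
    have := (hr.fanAt hbd.rev (j := -(b - 1)) (by omega) (by omega)).inHull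
    simp only [neg_neg] at this
    rw [show -(-g + 1) = c by omega, e] at this
    exact this.trans (inHull_snd _ _ _ _) (inHull_fth _ _ _ _) (inHull_trd _ _ _ _)
      (inHull_trd _ _ _ _)

theorem empty_right (h : Step P A γ o i s V p c g q a b) :
    EmptyTri P s (V a) (V (b - 1)) (V b) := by
  by_contra he
  have hbd := h.pair.bd
  have h1 := h.pa
  have h2 := h.ag
  have h3 := h.cb
  have h4 := h.bq
  obtain ⟨w, hw⟩ := h.exists_witness he
  rcases h.pair.convex with e | ⟨e, -, -⟩
  · exact hw.false_of_eq h e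
  -- The points in the right triangle lie in the left one too, so the mirror image of the situation
  -- has a witness of its own.
  have he' : ¬ EmptyTri P (-s) (V (-(-b))) (V (-(-a - 1))) (V (-(-a))) := by
    intro hc
    simp only [neg_neg] at hc
    have hc := hc.reverse
    rw [neg_neg, show -(-a - 1) = a + 1 by ring] at hc
    apply he
    intro z hz hi
    by_contra hcon
    push Not at hcon
    rcases hc z hz (h.inTri hz hi hcon.2.1 hcon.2.2) with e1 | e1 | e1
    · exact hcon.1 e1
    · have e2 := h.side_a
      have e3 := hi.1
      rw [e1, side_swap'] at e3
      linarith
    · exact hcon.2.2 e1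
  obtain ⟨w', hw'⟩ := h.rev.exists_witness he'
  have e' : -c = -g + 1 := by omega
  have n1 := hw'.not_near h.rev (hw'.side_convex h.rev e')
  have n2 := hw'.not_near' h.rev (by
    have := hw'.side_convex h.rev e'
    rwa [show -c - 1 = -g by omega, e'])
  have n3 := hw'.not_near_left h.rev e'
  have n4 := witness_hull hw' h.rev e'
  simp only [neg_neg] at n1 n2 n3 n4
  rw [e] at n1
  rw [show -(-g + 1) = c by omega, e] at n4
  have m1 := hw.not_near h (hw.side_convex h e)
  have m2 := hw.not_near' h (by
    have := hw.side_convex h e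
    rwa [show g - 1 = c by omega, e])
  rw [e] at m2
  have ha := h.pair.fwd.fanAt hbd h1 (by omega)
  have hb := h.pair.bwd_diag (b := b) (by omega) h4
  have hbn := h.pair.bwd_near (b := b) (by omega) h4
  rw [show g - 1 = c by omega] at hb
  rw [e] at hbn
  -- Both witnesses are away from the two convex vertices, and `w` is away from `V a`; the cell
  -- lemma then puts `w'` near `V b`, which the mirrored `not_near_left` excludes.
  refine n3 (near_of_inHull_quad (h.pair.bd.near _ _ (hbd.adj c)) ha.near
    (hbd.not_near_of_diag ha.diag) hbn.symm (fun hc => hbd.not_near_of_diag hb hc.symm)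
    (witness_hull hw h e) (fun hc => m1 hc.symm) (fun hc => m2 hc.symm)
    (hw.not_near_left h e) ?_ (fun hc => n2 hc.symm) (fun hc => n1 hc.symm))
  exact n4.trans (inHull_snd _ _ _ _) (inHull_fst _ _ _ _) (inHull_fth _ _ _ _)
    (inHull_trd _ _ _ _)

theorem empty_left (h : Step P A γ o i s V p c g q a b) :
    EmptyTri P s (V a) (V (a + 1)) (V b) := by
  have := h.rev.empty_right
  simp only [neg_neg] at this
  have := this.reverse
  rwa [neg_neg, show -(-a - 1) = a + 1 by ring] at this

/-- An edge from `V a` to `V b` leaves no room outside of the chain. -/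
theorem eq_of_adj (h : Step P A γ o i s V p c g q a b) (hadj : A.Adj (V a) (V b)) :
    a = p ∧ g = c + 1 := by
  have hbd := h.pair.bd
  have h1 := h.pa
  have h2 := h.ag
  obtain ⟨w, hw⟩ := h.exists_isFirst
  obtain rfl : w = V b := by
    rcases h.empty_right w hw.mem hw.inTri with e | e | e
    · exact absurd e hw.ne_left
    · exact absurd e hw.ne_right
    · exact e
  have hwa := hbd.eq_prev (Or.inr h.diag_a.left) (hbd.mem _) hadj h.tri_right
    (fun x hx => hw.no_adj h.tri_right hx)
  have hca : Conv s V a := by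
    have := h.tri_left
    rw [hwa] at this
    unfold Conv
    rwa [← side_rotate]
  have hcg : g = c ∨ g = c + 1 := h.pair.convex.imp id And.left
  have hap : a = p := by
    by_contra hne
    exact h.pair.fwd.reflex a (by omega) (by omega) hca
  have := h.pair.fwd.next (hap ▸ hca)
  omega

/-- The triangles over the segment from `V a` to `V b`. -/
theorem quad (h : Step P A γ o i s V p c g q a b) :
    Quad P A s V p q (g - 1) (c + 1) a b := by
  have hbd := h.pair.bd
  have h1 := h.pa
  have h2 := h.ag
  have h3 := h.cb
  have h4 := h.bq
  have hL := h.tri_left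
  have hR := h.tri_right
  have hcg : g = c ∨ g = c + 1 := h.pair.convex.imp id And.left
  refine ⟨fun _ => hL, fun _ => h.empty_left, fun _ => ?_, fun _ => hR, fun _ => h.empty_right,
    fun _ => ?_, ?_⟩
  · by_cases e : a + 1 = g - 1
    · rwa [← e]
    -- Four directions at `V b`: the position of `V (g - 1)` relative to `V a` follows from its
    -- position relative to `V (a + 1)`.
    · have pl := side_pluecker s (V b) (V (b - 1)) (V (g - 1)) (V (a + 1)) (V a)
      have k1 := h.quad_b.apex_left (by omega)
      have k3 := h.pair.bwd_tri (b := b) (by omega) h4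
      have k4 := h.side_b
      have flip : ∀ x y z, side s z y x = -side s x y z := fun x y z => by unfold side; ring
      rw [flip (V (g - 1)), flip (V a), flip (V (a + 1)), flip (V a), flip (V a),
        flip (V (a + 1)) (V (g - 1))] at pl
      by_contra hcon
      push Not at hcon
      nlinarith [mul_pos k3 hL, mul_pos hR k1, mul_nonneg k4.le (neg_nonneg.mpr hcon)]
  · by_cases e : b - 1 = c + 1
    · rwa [← e]
    · have pl := side_pluecker s (V a) (V (a + 1)) (V (c + 1)) (V (b - 1)) (V b)
      have k1 := h.quad_a.apex_right (by omega)
      have k3 := (h.pair.fwd.fanAt hbd h1 (by omega)).tri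
      have k4 := h.side_a
      by_contra hcon
      push Not at hcon
      nlinarith [mul_pos k3 hR, mul_pos hL k1, mul_nonneg k4.le (neg_nonneg.mpr hcon)]
  · by_cases hadj : A.Adj (V a) (V b)
    · right
      refine ⟨hadj, (h.eq_of_adj hadj).1, ?_⟩
      have := (h.rev.eq_of_adj (by simpa only [neg_neg] using hadj.symm)).1
      omega
    · exact Or.inl (Or.inr (hbd.diag_of_emptyTri hL (Or.inr h.diag_b) h.empty_left hadj))

end Step

end Pair

end

/-! ### Induction over a pair of fans, and the tree of triangles over a chain -/

section

variable {P : Finset ℂ} {A : SimpleGraph ℂ} {γ : ℝ} {o : ℂ} {i : ℕ} {s : ℝ} {V : ℤ → ℂ}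

/-- Induction on the total distance of `a` and `b` from the innermost segment. If one end is the
apex of a fan, the fan itself gives the triangles; otherwise the three smaller segments feed `Step`.
A smaller segment cannot be the exceptional edge of `A`, because that one joins `V p` to `V q`. -/
theorem Pair.quad {p c g q a b : ℤ} (h : Pair P A γ o i s V p c g q) (hpa : p ≤ a) (hag : a < g)
    (hcb : c < b) (hbq : b ≤ q) : Quad P A s V p q (g - 1) (c + 1) a b := by
  obtain ⟨n, hn⟩ := Int.eq_ofNat_of_zero_le (show 0 ≤ (g - 1 - a) + (b - (c + 1)) by omega)
  induction n using Nat.strong_induction_on generalizing a b with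
  | _ n ih =>
  by_cases hb : b = c + 1
  · rw [hb]; exact h.quad_left hpa hag
  by_cases ha : a = g - 1
  · have := (h.rev.quad_left (a := -b) (by omega) (by omega)).rev h.bd.rev
    simp only [neg_neg] at this
    convert this using 1 <;> omega
  have hcg : g = c ∨ g = c + 1 := h.convex.imp id And.left
  have q1 := ih (n - 1) (by omega) (a := a) (b := b - 1) hpa hag (by omega) (by omega) (by omega)
  have q2 := ih (n - 1) (by omega) (a := a + 1) (b := b) (by omega) (by omega) hcb hbq (by omega)
  have q3 := ih (n - 2) (by omega) (a := a + 1) (b := b - 1) (by omega) (by omega) (by omega)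
    (by omega) (by omega)
  refine Pair.Step.quad ⟨h, hpa, by omega, by omega, hbq, q1, q2, q3, ?_, ?_⟩
  · rcases q1.link with (e | e) | ⟨-, -, e⟩
    · omega
    · exact e
    · omega
  · rcases q2.link with (e | e) | ⟨-, e, -⟩
    · omega
    · exact e
    · omega

/-- The chain from `V a` to `V b` and the segment between its ends bound a union of triangles
without points of `P`, each of which is cut off by a link. -/
inductive Tree (P : Finset ℂ) (A : SimpleGraph ℂ) (s : ℝ) (V : ℤ → ℂ) : ℤ → ℤ → Prop
  | edge (k : ℤ) : Tree P A s V k (k + 1)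
  | left (a b : ℤ) (ht : 0 < side s (V a) (V (a + 1)) (V b))
      (he : EmptyTri P s (V a) (V (a + 1)) (V b)) (hl : Link A s V (a + 1) b)
      (h : Tree P A s V (a + 1) b) : Tree P A s V a b
  | right (a b : ℤ) (ht : 0 < side s (V a) (V (b - 1)) (V b))
      (he : EmptyTri P s (V a) (V (b - 1)) (V b)) (hl : Link A s V a (b - 1))
      (h : Tree P A s V a (b - 1)) : Tree P A s V a b

theorem Tree.lt {a b : ℤ} (h : Tree P A s V a b) : a < b := by
  induction h with
  | edge k => omega
  | left => omega
  | right => omega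

theorem Fwd.tree {p c j : ℤ} (hF : Fwd P A γ o i s V p c) (h : Bd P A γ o i s V) (hpj : p ≤ j)
    (hjc : j ≤ c) : Tree P A s V j (c + 1) := by
  obtain ⟨n, hn⟩ := Int.eq_ofNat_of_zero_le (show 0 ≤ c - j by omega)
  induction n generalizing j with
  | zero =>
    obtain rfl : j = c := by push_cast at hn; omega
    exact Tree.edge j
  | succ n ih =>
    push_cast at hn
    have hf := hF.fanAt h hpj (by omega)
    refine Tree.left _ _ hf.tri hf.empty ?_ (ih (by omega) (by omega) (by omega))
    by_cases e : j + 1 = c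
    · rw [e]; exact Or.inl rfl
    · exact Or.inr (hF.fanAt h (by omega) (by omega)).diag

/-- Triangles are cut off at the left chain until its last vertex is reached, then at the right
chain. -/
theorem Pair.tree {p c g q a b : ℤ} (h : Pair P A γ o i s V p c g q) (hpa : p ≤ a) (hag : a < g)
    (hcb : c < b) (hbq : b ≤ q) : Tree P A s V a b := by
  have hcg : g = c ∨ g = c + 1 := h.convex.imp id And.left
  obtain ⟨n, hn⟩ := Int.eq_ofNat_of_zero_le (show 0 ≤ (g - 1 - a) + (b - (c + 1)) by omega)
  induction n generalizing a b with
  | zero =>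
    push_cast at hn
    obtain rfl : b = c + 1 := by omega
    exact h.fwd.tree h.bd hpa (by omega)
  | succ n ih =>
    push_cast at hn
    have hQ := h.quad hpa hag hcb hbq
    by_cases ha : a < g - 1
    · refine Tree.left _ _ (hQ.tri_left ha) (hQ.empty_left ha) ?_
        (ih (by omega) (by omega) (by omega) (by omega) (by omega))
      rcases (h.quad (a := a + 1) (by omega) (by omega) hcb hbq).link with e | ⟨-, e, -⟩
      · exact e
      · omega
    · refine Tree.right _ _ (hQ.tri_right (by omega)) (hQ.empty_right (by omega)) ?_
        (ih (by omega) (by omega) (by omega) (by omega) (by omega))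
      rcases (h.quad (b := b - 1) hpa hag (by omega) (by omega)).link with e | ⟨-, -, e⟩
      · exact e
      · omega

/-! ### Cell distances -/

/-- The cells of `u` and `v` are at most `n` apart in the grid. -/
def CellDist (γ : ℝ) (o : ℂ) (i : ℕ) (n : ℤ) (u v : ℂ) : Prop :=
  |(cell γ o i u).1 - (cell γ o i v).1| ≤ n ∧ |(cell γ o i u).2 - (cell γ o i v).2| ≤ n

theorem CellDist.trans {m n : ℤ} {u v w : ℂ} (h : CellDist γ o i m u v)
    (h' : CellDist γ o i n v w) : CellDist γ o i (m + n) u w :=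
  ⟨(abs_sub_le _ _ _).trans (add_le_add h.1 h'.1), (abs_sub_le _ _ _).trans (add_le_add h.2 h'.2)⟩

theorem Near.cellDist {u v : ℂ} (h : Near γ o i u v) : CellDist γ o i 1 u v := h

theorem CellDist.mono {m n : ℤ} {u v : ℂ} (h : CellDist γ o i m u v) (hmn : m ≤ n) :
    CellDist γ o i n u v := ⟨h.1.trans hmn, h.2.trans hmn⟩

theorem Fwd.cellDist {p c j : ℤ} (hF : Fwd P A γ o i s V p c) (h : Bd P A γ o i s V)
    (hpj : p ≤ j) (hjc : j < c) : CellDist γ o i 3 (V j) (V (c + 1)) := by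
  have h1 := (hF.fanAt h hpj hjc).near.symm.cellDist
  exact (h1.trans (h.near _ _ (h.adj c)).cellDist).mono (by norm_num)

/-- One cell from `V a` to `V c`, one along the edge between two convex vertices if they differ, one
from `V g` to `V b`. -/
theorem Pair.cellDist {p c g q a b : ℤ} (h : Pair P A γ o i s V p c g q) (hpa : p ≤ a)
    (hac : a < c) (hgb : g < b) (hbq : b ≤ q) : CellDist γ o i 3 (V a) (V b) := by
  have h1 := (h.fwd.fanAt h.bd hpa hac).near.symm.cellDist
  have h2 := (h.bwd_near hgb hbq).cellDist
  rcases h.convex with e | ⟨e, -, -⟩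
  · rw [e] at h2; exact (h1.trans h2).mono (by norm_num)
  · rw [e] at h2; exact (h1.trans (h.bd.near _ _ (h.bd.adj c)).cellDist).trans h2

theorem cellSide_pos (hγ : 0 < γ) (i : ℕ) : 0 < cellSide γ i := by
  unfold cellSide; positivity

/-- Floors at most three apart mean coordinates less than four sides apart. -/
theorem CellDist.dist_le (hγ : 0 < γ) {u v : ℂ} (h : CellDist γ o i 3 u v) :
    dist u v ≤ 4 * √2 * cellSide γ i := by
  have hc := cellSide_pos hγ i
  have key : ∀ x y : ℝ, |⌊x / cellSide γ i⌋ - ⌊y / cellSide γ i⌋| ≤ 3 →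
      |x - y| ≤ 4 * cellSide γ i := by
    intro x y hxy
    rw [abs_le] at hxy
    obtain ⟨h1, h2⟩ := hxy
    have a1 := Int.floor_le (x / cellSide γ i)
    have a2 := Int.lt_floor_add_one (x / cellSide γ i)
    have b1 := Int.floor_le (y / cellSide γ i)
    have b2 := Int.lt_floor_add_one (y / cellSide γ i)
    rify at h1 h2
    rw [abs_le]
    have e : (x - y) = (x / cellSide γ i - y / cellSide γ i) * cellSide γ i := by
      field_simp
    constructor
    · rw [e]; nlinarith
    · rw [e]; nlinarith
  have h1 := key _ _ h.1
  have h2 := key _ _ h.2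
  simp only [Complex.sub_re, Complex.sub_im, sub_sub_sub_cancel_right] at h1 h2
  rw [Complex.dist_eq_re_im]
  rw [Real.sqrt_le_left (by positivity)]
  have h3 := sq_le_sq' (abs_le.mp h1).1 (abs_le.mp h1).2
  have h4 := sq_le_sq' (abs_le.mp h2).1 (abs_le.mp h2).2
  have h5 : (4 * √2 * cellSide γ i) ^ 2 = 32 * cellSide γ i ^ 2 := by
    rw [mul_pow, mul_pow, Real.sq_sqrt (by norm_num)]; ring
  rw [h5]
  nlinarith

/-- Cells of the next grid are blocks of three by three, and indices at most three apart have
quotients by three at most one apart. This is why edges added at one level are legitimate at the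
next. -/
theorem CellDist.near_succ {u v : ℂ} (h : CellDist γ o i 3 u v) : Near γ o (i + 1) u v := by
  have hc : cellSide γ (i + 1) = cellSide γ i * 3 := by
    unfold cellSide
    rw [mul_assoc]
    congr 1
    rw [← zpow_add_one₀ (by norm_num)]
    congr 1
    push_cast; ring
  have key : ∀ x y : ℝ, |⌊x / cellSide γ i⌋ - ⌊y / cellSide γ i⌋| ≤ 3 →
      |⌊x / cellSide γ (i + 1)⌋ - ⌊y / cellSide γ (i + 1)⌋| ≤ 1 := by
    intro x y hxy
    have e : ∀ x : ℝ, ⌊x / cellSide γ (i + 1)⌋ = ⌊x / cellSide γ i⌋ / 3 := by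
      intro x
      rw [hc, ← div_div]
      exact Int.floor_div_natCast (x / cellSide γ i) 3
    rw [e, e]
    rw [abs_le] at *
    omega
  exact ⟨key _ _ h.1, key _ _ h.2⟩

end

section

variable {P : Finset ℂ} {A : SimpleGraph ℂ} {γ : ℝ} {o : ℂ} {i : ℕ} {s : ℝ} {V : ℤ → ℂ}

/-! ### Segments that cross a triangulated chain -/

/-- A segment that crosses the side `p r` of an empty triangle from the apex `q` or through one of
the other sides. -/
theorem cross_triangle_aux (gp : GeneralPosition P) {p q r x y z : ℂ} (hp : p ∈ P)
    (hq : q ∈ P) (hr : r ∈ P) (hx : x ∈ P) (hy : y ∈ P) (hxy : x ≠ y) (ht : 0 < side s p q r)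
    (he : EmptyTri P s p q r) (h1 : z ∈ openSegment ℝ p r) (h2 : z ∈ openSegment ℝ x y)
    (hfy : 0 < side s r p y) :
    (y = q ∧ 0 < side s p q x ∧ 0 < side s q r x) ∨ Crosses x y p q ∨ Crosses x y q r := by
  have hs : s ≠ 0 := by rintro rfl; simp [side] at ht
  obtain ⟨t, t0, t1, hz⟩ := mem_openSegment_lp.mp h1
  obtain ⟨u, u0, u1, hz'⟩ := mem_openSegment_lp.mp h2
  have f1 : 0 < side s p q z := by rw [hz, side_lp, side_left]; nlinarith [mul_pos t0 ht]
  have f2 : 0 < side s q r z := by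
    rw [hz, side_lp, side_right, side_rotate s p q r]
    nlinarith [mul_pos (sub_pos.mpr t1) ht]
  have f3 : side s r p z = 0 := by rw [hz, side_lp]; simp
  by_cases hyq : y = q
  · left
    refine ⟨hyq, ?_, ?_⟩
    · rw [hz', side_lp, hyq, side_right] at f1
      by_contra hcon; push Not at hcon
      nlinarith
    · rw [hz', side_lp, hyq, side_left] at f2
      by_contra hcon; push Not at hcon
      nlinarith
  right
  have hyp : y ≠ p := by rintro rfl; simp at hfy
  have hyr : y ≠ r := by rintro rfl; simp at hfy
  have hout : ¬ (0 ≤ side s p q y ∧ 0 ≤ side s q r y) := by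
    rintro ⟨g1, g2⟩
    rcases he y hy ⟨g1, g2, hfy.le⟩ with e | e | e
    exacts [hyp e, hyq e, hyr e]
  -- Only two sides can be exits, since the function of `r p` grows from zero towards `y`; the third
  -- slot repeats the second function.
  obtain ⟨v, v0, v1, g1, g2, -, g0⟩ := exists_exit (side_lp s p q z y) (side_lp s q r z y)
    (side_lp s q r z y) f1 f2 f2 (fun hc => hout ⟨hc.1.le, hc.2.1.le⟩)
  have v1' : v < 1 := by
    refine lt_of_le_of_ne v1 ?_
    rintro rfl
    rw [lp_one] at g1 g2
    exact hout ⟨g1, g2⟩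
  have g3 : 0 ≤ side s r p (lp z y v) := by
    rw [side_lp, f3]
    nlinarith [mul_pos v0 hfy]
  have hopen : lp z y v ∈ openSegment ℝ x y := by
    have := lp_mem_openSegment_trans (by rwa [openSegment_symm] at h2) v0.le v1'
    rwa [openSegment_symm]
  have hnP : ∀ e ∈ P, lp z y v ≠ e := fun e heP hee =>
    gp.not_mem_openSegment hx hy heP hxy (hee ▸ hopen)
  have hne := side_ne s ht.ne'
  rcases g0 with g0 | g0 | g0
  · left
    have hm := mem_segment_of_side hs hne.1 g0 g2 g3 ht
    refine ⟨fun e => ?_, _, hopen, mem_openSegment_of_mem_segment hm (hnP p hp) (hnP q hq)⟩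
    rcases Sym2.eq_iff.mp e with ⟨-, e⟩ | ⟨-, e⟩
    exacts [hyq e, hyp e]
  all_goals
    right
    have hm := mem_segment_of_side hs hne.2.1 g0 g3 g1 (by rwa [side_rotate])
    refine ⟨fun e => ?_, _, hopen, mem_openSegment_of_mem_segment hm (hnP q hq) (hnP r hr)⟩
    rcases Sym2.eq_iff.mp e with ⟨-, e⟩ | ⟨-, e⟩
    exacts [hyr e, hyq e]

/-- One end of a crossing segment is strictly on the side of `q`, for otherwise the whole segment
would lie on the line `r p` and coincide with the side. -/
theorem cross_triangle (gp : GeneralPosition P) {p q r x y : ℂ} (hp : p ∈ P)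
    (hq : q ∈ P) (hr : r ∈ P) (hx : x ∈ P) (hy : y ∈ P) (hxy : x ≠ y) (ht : 0 < side s p q r)
    (he : EmptyTri P s p q r) (hc : Crosses p r x y) :
    (y = q ∧ 0 < side s p q x ∧ 0 < side s q r x) ∨
      (x = q ∧ 0 < side s p q y ∧ 0 < side s q r y) ∨ Crosses x y p q ∨ Crosses x y q r := by
  have hs : s ≠ 0 := by rintro rfl; simp [side] at ht
  obtain ⟨hne, z, h1, h2⟩ := hc
  have hpr : p ≠ r := (side_ne s ht.ne').2.2
  have f3 : side s r p z = 0 := by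
    obtain ⟨t, t0, t1, hz⟩ := mem_openSegment_lp.mp h1
    rw [hz, side_lp]; simp
  have hin : ∀ w ∈ P, side s r p w = 0 → w = p ∨ w = r := by
    intro w hw h0
    by_contra hcon
    push Not at hcon
    exact gp.side_ne_zero hs hr hp hw hpr.symm hcon.1.symm hcon.2.symm h0
  obtain ⟨u, u0, u1, hz⟩ := mem_openSegment_lp.mp h2
  have f4 := f3
  rw [hz, side_lp] at f4
  rcases lt_trichotomy 0 (side s r p y) with hy0 | hy0 | hy0
  · rcases cross_triangle_aux gp hp hq hr hx hy hxy ht he h1 h2 hy0 with h | h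
    · exact Or.inl h
    · exact Or.inr (Or.inr h)
  · exfalso
    have hx0 : side s r p x = 0 := by
      rw [← hy0] at f4
      rcases mul_eq_zero.mp (by linarith : (1 - u) * side s r p x = 0) with h | h
      · linarith
      · exact h
    rcases hin x hx hx0 with e1 | e1 <;> rcases hin y hy hy0.symm with e2 | e2
    · exact hxy (e1.trans e2.symm)
    · exact hne (by rw [e1, e2])
    · exact hne (by rw [e1, e2, Sym2.eq_swap])
    · exact hxy (e1.trans e2.symm)
  · have hx0 : 0 < side s r p x := by
      by_contra hcon; push Not at hcon
      nlinarith [mul_pos u0 (neg_pos.mpr hy0), mul_nonneg (sub_pos.mpr u1).le (neg_nonneg.mpr hcon)]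
    rw [openSegment_symm] at h2
    rcases cross_triangle_aux gp hp hq hr hy hx hxy.symm ht he h1 h2 hx0 with h | h | h
    · exact Or.inr (Or.inl h)
    · exact Or.inr (Or.inr (Or.inl (crosses_swap_left h)))
    · exact Or.inr (Or.inr (Or.inr (crosses_swap_left h)))

/-- An uncrossed segment that crosses the segment under a triangulated chain ends in a corner of
the chain. -/
theorem Tree.exists_of_crosses {a b : ℤ} (hT : Tree P A s V a b) (h : Bd P A γ o i s V) {x y : ℂ}
    (hx : x ∈ P) (hy : y ∈ P) (hxy : x ≠ y) (hunc : Unc A x y) (hc : Crosses (V a) (V b) x y) :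
    ∃ k, a < k ∧ k < b ∧ ((x = V k ∧ InC s V k y) ∨ (y = V k ∧ InC s V k x)) := by
  induction hT with
  | edge k => exact absurd (crosses_symm hc) (hunc _ _ (h.adj k))
  | left a b ht he hl hT ih =>
    have hlt := hT.lt
    have hw : ∀ w, 0 < side s (V a) (V (a + 1)) w → 0 < side s (V (a + 1)) (V b) w →
        InC s V (a + 1) w := by
      intro w h1 h2
      refine h.inC_wedge' (d := V b) ?_ (by simpa using h1) h2
      rcases hl with e | e
      · exact Or.inl (by rw [e])
      · exact Or.inr e.left
    rcases cross_triangle h.gp (h.mem _) (h.mem _) (h.mem _) hx hy hxy ht he hc with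
      ⟨e, h1, h2⟩ | ⟨e, h1, h2⟩ | h1 | h1
    · exact ⟨a + 1, by omega, hlt, Or.inr ⟨e, hw _ h1 h2⟩⟩
    · exact ⟨a + 1, by omega, hlt, Or.inl ⟨e, hw _ h1 h2⟩⟩
    · exact absurd h1 (hunc _ _ (h.adj a))
    · obtain ⟨k, h2, h3, h4⟩ := ih (crosses_symm h1)
      exact ⟨k, by omega, h3, h4⟩
  | right a b ht he hl hT ih =>
    have hlt := hT.lt
    have hw : ∀ w, 0 < side s (V a) (V (b - 1)) w → 0 < side s (V (b - 1)) (V b) w →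
        InC s V (b - 1) w := by
      intro w h1 h2
      refine h.inC_wedge (d := V a) ?_ (by simpa using h2) h1
      rcases hl with e | e
      · exact Or.inl (by rw [e, add_sub_cancel_right])
      · exact Or.inr e.right
    rcases cross_triangle h.gp (h.mem _) (h.mem _) (h.mem _) hx hy hxy ht he hc with
      ⟨e, h1, h2⟩ | ⟨e, h1, h2⟩ | h1 | h1
    · exact ⟨b - 1, hlt, by omega, Or.inr ⟨e, hw _ h1 h2⟩⟩
    · exact ⟨b - 1, hlt, by omega, Or.inl ⟨e, hw _ h1 h2⟩⟩
    · obtain ⟨k, h2, h3, h4⟩ := ih (crosses_symm h1)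
      exact ⟨k, h2, by omega, h4⟩
    · exact absurd h1 (hunc _ _ (h.adj' b).symm)

/-! ### Winding numbers -/

theorem arg_div_of_re_pos {x y : ℂ} (hx : 0 < x.re) (hy : 0 < y.re) :
    Complex.arg (y / x) = Complex.arg y - Complex.arg x := by
  have hx0 : x ≠ 0 := by rintro rfl; simp at hx
  have hy0 : y ≠ 0 := by rintro rfl; simp at hy
  have h1 := abs_lt.mp (Complex.abs_arg_lt_pi_div_two_iff.mpr (Or.inl hx))
  have h2 := abs_lt.mp (Complex.abs_arg_lt_pi_div_two_iff.mpr (Or.inl hy))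
  have h3 := Complex.arg_div_coe_angle hy0 hx0
  rw [← Real.Angle.coe_sub] at h3
  have h4 := congrArg Real.Angle.toReal h3
  rw [Real.Angle.toReal_coe_eq_self_iff.mpr ⟨Complex.neg_pi_lt_arg _, Complex.arg_le_pi _⟩,
    Real.Angle.toReal_coe_eq_self_iff.mpr ⟨by linarith, by linarith⟩] at h4
  exact h4

/-- Angles add up if they are seen from outside a triangle. -/
theorem arg_add_of_side {p q a b c z : ℂ} (hz : side s p q z < 0) (ha : 0 ≤ side s p q a)
    (hb : 0 ≤ side s p q b) (hc : 0 ≤ side s p q c) :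
    Complex.arg ((b - z) / (a - z)) + Complex.arg ((c - z) / (b - z)) =
      Complex.arg ((c - z) / (a - z)) := by
  -- Multiplication by `m` turns the normal of the line `p q` into the real axis, so the points in
  -- question, seen from `z`, move to the right half-plane, where arguments subtract without a jump.
  set m : ℂ := ⟨s * (q.im - p.im), s * (q.re - p.re)⟩ with hm
  have key : ∀ x, 0 ≤ side s p q x → 0 < (m * (x - z)).re := by
    intro x hx
    have : (m * (x - z)).re = side s p q x - side s p q z := by
      unfold side
      simp only [hm, Complex.mul_re, Complex.sub_re, Complex.sub_im]
      ring
    linarith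
  have hm0 : m ≠ 0 := by
    intro e
    have := key a ha
    rw [e] at this
    simp at this
  rw [← mul_div_mul_left (b - z) (a - z) hm0, ← mul_div_mul_left (c - z) (b - z) hm0,
    ← mul_div_mul_left (c - z) (a - z) hm0, arg_div_of_re_pos (key a ha) (key b hb),
    arg_div_of_re_pos (key b hb) (key c hc), arg_div_of_re_pos (key a ha) (key c hc)]
  ring

/-- A point of `P` other than the vertices is outside the triangle, hence separated from it by the
line of one of its sides. -/
theorem arg_add_of_emptyTri {p q r z : ℂ} (hz : z ∈ P) (ht : 0 < side s p q r)
    (he : EmptyTri P s p q r) (hp : z ≠ p) (hq : z ≠ q) (hr : z ≠ r) :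
    Complex.arg ((q - z) / (p - z)) + Complex.arg ((r - z) / (q - z)) =
      Complex.arg ((r - z) / (p - z)) := by
  have hn : ¬ InTri s p q r z := fun hi => by
    rcases he z hz hi with e | e | e
    exacts [hp e, hq e, hr e]
  have t1 := side_rotate s p q r
  have t2 := side_rotate' s p q r
  by_cases h1 : 0 ≤ side s p q z
  · by_cases h2 : 0 ≤ side s q r z
    · exact arg_add_of_side (p := r) (q := p) (not_le.mp fun h3 => hn ⟨h1, h2, h3⟩) (by simp)
        (by linarith) (by simp)
    · exact arg_add_of_side (p := q) (q := r) (not_le.mp h2) (by linarith) (by simp) (by simp)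
  · exact arg_add_of_side (p := p) (q := q) (not_le.mp h1) (by simp) (by simp) ht.le

/-- The change of the angle along a triangulated chain. -/
theorem Tree.sum_arg {a b : ℤ} (hT : Tree P A s V a b) {z : ℂ} (hz : z ∈ P)
    (hne : ∀ k, a ≤ k → k ≤ b → z ≠ V k) :
    ∑ k ∈ Finset.Ico a b, Complex.arg ((V (k + 1) - z) / (V k - z)) =
      Complex.arg ((V b - z) / (V a - z)) := by
  induction hT with
  | edge k =>
    have : Finset.Ico k (k + 1) = {k} := by ext; simp; omega
    rw [this, Finset.sum_singleton]
  | left a b ht he hl hT ih =>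
    have hlt := hT.lt
    have : Finset.Ico a b = insert a (Finset.Ico (a + 1) b) := by ext; simp; omega
    rw [this, Finset.sum_insert (by simp), ih (fun k h1 h2 => hne k (by omega) h2)]
    exact arg_add_of_emptyTri hz ht he (hne _ (by omega) (by omega)) (hne _ (by omega) (by omega))
      (hne _ (by omega) (by omega))
  | right a b ht he hl hT ih =>
    have hlt := hT.lt
    have : Finset.Ico a b = insert (b - 1) (Finset.Ico a (b - 1)) := by ext; simp; omega
    rw [this, Finset.sum_insert (by simp), ih (fun k h1 h2 => hne k h1 (by omega)), add_comm,
      sub_add_cancel]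
    exact arg_add_of_emptyTri hz ht he (hne _ (by omega) (by omega)) (hne _ (by omega) (by omega))
      (hne _ (by omega) (by omega))

/-- The argument of the inverse is the negative one except at `π`, which would put `z` on the line
through `a` and `b`. -/
theorem arg_add_arg_inv (gp : GeneralPosition P) {a b z : ℂ} (ha : a ∈ P) (hb : b ∈ P)
    (hz : z ∈ P) (hab : a ≠ b) (hza : z ≠ a) (hzb : z ≠ b) :
    Complex.arg ((b - z) / (a - z)) + Complex.arg ((a - z) / (b - z)) = 0 := by
  rw [← inv_div (b - z) (a - z), Complex.arg_inv, if_neg]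
  · ring
  · intro e
    rw [Complex.arg_eq_pi_iff] at e
    have h1 := side_eq_im (b := b) hza.symm
    rw [e.2, zero_mul] at h1
    exact gp.side_ne_zero one_ne_zero hz ha hb hza hab hzb (by linarith)

end

section

open Filter Topology

variable {P : Finset ℂ} {A : SimpleGraph ℂ}

/-! ### Faces -/

theorem isCompact_segment (u v : ℂ) : IsCompact (segment ℝ u v) := by
  rw [segment_eq_image']
  exact isCompact_Icc.image (by fun_prop)

/-- A set of points and edges of a finite drawing is closed. -/
theorem isClosed_subdrawing (hA : IsPSLG P A) (Q : ℂ → Prop) (E : ℂ → ℂ → Prop) :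
    IsClosed {z | (z ∈ P ∧ Q z) ∨ ∃ u v, A.Adj u v ∧ E u v ∧ z ∈ segment ℝ u v} := by
  classical
  have : {z | (z ∈ P ∧ Q z) ∨ ∃ u v, A.Adj u v ∧ E u v ∧ z ∈ segment ℝ u v} =
      (↑(P.filter Q) : Set ℂ) ∪
        ⋃ e ∈ (P ×ˢ P).filter (fun e => A.Adj e.1 e.2 ∧ E e.1 e.2), segment ℝ e.1 e.2 := by
    ext z
    simp only [Set.mem_ofPred_eq, Set.mem_union, Finset.coe_filter, Set.mem_iUnion,
      Finset.mem_filter, Finset.mem_product, exists_prop, Prod.exists]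
    refine or_congr_right ⟨?_, ?_⟩
    · rintro ⟨u, v, h1, h2, h3⟩
      exact ⟨u, v, ⟨hA.endpoints u v h1, h1, h2⟩, h3⟩
    · rintro ⟨u, v, ⟨-, h1, h2⟩, h3⟩
      exact ⟨u, v, h1, h2, h3⟩
  rw [this]
  exact (Finset.finite_toSet _).isClosed.union
    (Set.Finite.isClosed_biUnion (Finset.finite_toSet _) fun e _ => (isCompact_segment _ _).isClosed)

theorem IsFace.subset {f : Set ℂ} (hf : IsFace P A f) : f ⊆ (drawing P A)ᶜ := by
  obtain ⟨z, -, rfl⟩ := hf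
  exact connectedComponentIn_subset _ _

theorem IsFace.isPreconnected {f : Set ℂ} (hf : IsFace P A f) : IsPreconnected f := by
  obtain ⟨z, -, rfl⟩ := hf
  exact isPreconnected_connectedComponentIn

theorem IsFace.eq_component {f : Set ℂ} (hf : IsFace P A f) {x : ℂ} (hx : x ∈ f) :
    f = connectedComponentIn (drawing P A)ᶜ x := by
  obtain ⟨z, -, rfl⟩ := hf
  exact connectedComponentIn_eq hx

theorem IsFace.eq_of_mem {f f' : Set ℂ} (hf : IsFace P A f) (hf' : IsFace P A f') {x : ℂ}
    (hx : x ∈ f) (hx' : x ∈ f') : f = f' := by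
  rw [hf.eq_component hx, hf'.eq_component hx']

theorem IsFace.subset_of_isPreconnected {f S : Set ℂ} (hf : IsFace P A f) (hS : IsPreconnected S)
    (hSD : S ⊆ (drawing P A)ᶜ) {x : ℂ} (hx : x ∈ S) (hxf : x ∈ f) : S ⊆ f := by
  rw [hf.eq_component hxf]
  exact hS.subset_connectedComponentIn hx hSD

/-- The point at parameter `t` of the segment `uv`, moved to the right by `ε` times the length of
the segment. -/
def shifted (u v : ℂ) (t ε : ℝ) : ℂ := lp u v t - (ε : ℂ) * (Complex.I * (v - u))

theorem faceOnRight_iff {f : Set ℂ} {u v : ℂ} :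
    FaceOnRight f u v ↔ ∀ᶠ ε : ℝ in 𝓝[>] 0, shifted u v (1 / 2) ε ∈ f := by
  unfold FaceOnRight
  have : ∀ ε : ℝ, (u + v) / 2 - (ε : ℂ) * (Complex.I * (v - u)) = shifted u v (1 / 2) ε := by
    intro ε
    simp only [shifted, lp]
    push_cast
    ring
  simp only [this]

theorem side_shifted (u v a b : ℂ) (t ε : ℝ) : side 1 a b (shifted u v t ε) =
    (1 - t) * side 1 a b u + t * side 1 a b v +
      ε * ((b.im - a.im) * (v.im - u.im) + (b.re - a.re) * (v.re - u.re)) := by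
  unfold side shifted lp
  simp only [Complex.sub_re, Complex.add_re, Complex.mul_re, Complex.sub_im, Complex.add_im,
    Complex.mul_im, Complex.ofReal_re, Complex.ofReal_im, Complex.I_re, Complex.I_im]
  ring

theorem side_shifted_self {u v : ℂ} (huv : u ≠ v) (t : ℝ) {ε : ℝ} (hε : 0 < ε) :
    0 < side 1 u v (shifted u v t ε) := by
  rw [side_shifted, side_left, side_right]
  have : 0 < (v.im - u.im) * (v.im - u.im) + (v.re - u.re) * (v.re - u.re) := by
    have := Complex.normSq_pos.mpr (sub_ne_zero.mpr huv.symm)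
    rw [Complex.normSq_apply] at this
    simp only [Complex.sub_re, Complex.sub_im] at this
    linarith
  have := mul_pos hε this
  linarith

theorem continuous_shifted (u v : ℂ) : Continuous fun q : ℝ × ℝ => shifted u v q.1 q.2 := by
  unfold shifted lp
  fun_prop

/-- The face to the right of an edge is the same all along the edge. -/
theorem eventually_shifted_mem (hA : IsPSLG P A) {f : Set ℂ} (hf : IsFace P A f) {u v : ℂ}
    (huv : A.Adj u v) {t₀ t : ℝ} (h0 : 0 < t₀) (h1 : t₀ < 1) (ht0 : 0 < t) (ht1 : t < 1)
    (h : ∀ᶠ ε : ℝ in 𝓝[>] 0, shifted u v t₀ ε ∈ f) :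
    ∀ᶠ ε : ℝ in 𝓝[>] 0, shifted u v t ε ∈ f := by
  have hcl := isClosed_subdrawing hA (fun _ => True) (fun x y => s(u, v) ≠ s(x, y))
  set D' := {z | (z ∈ P ∧ True) ∨ ∃ x y, A.Adj x y ∧ s(u, v) ≠ s(x, y) ∧ z ∈ segment ℝ x y}
    with hD'
  have hK : ∀ τ ∈ Set.uIcc t₀ t, ∀ᶠ q : ℝ × ℝ in 𝓝 (0, τ), shifted u v q.2 q.1 ∈ D'ᶜ := by
    intro τ hτ
    have hτ0 : 0 < τ := lt_of_lt_of_le (lt_min h0 ht0) hτ.1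
    have hτ1 : τ < 1 := lt_of_le_of_lt hτ.2 (max_lt h1 ht1)
    have hopen : shifted u v τ 0 ∈ openSegment ℝ u v :=
      mem_openSegment_lp.mpr ⟨τ, hτ0, hτ1, by simp [shifted]⟩
    have hmem : shifted u v τ 0 ∈ D'ᶜ := by
      rintro (⟨hP, -⟩ | ⟨x, y, hxy, hne, hz⟩)
      · exact hA.vertex_not_inside u v huv _ hP hopen
      · have := (hA.noncrossing u v x y huv hxy hne _ (openSegment_subset_segment ℝ _ _ hopen) hz).1
        have hP := hA.endpoints u v huv
        rcases this with e | e
        · rw [e] at hopen; exact hA.vertex_not_inside u v huv u hP.1 hopen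
        · rw [e] at hopen; exact hA.vertex_not_inside u v huv v hP.2 hopen
    have hcont : Continuous fun q : ℝ × ℝ => shifted u v q.2 q.1 :=
      (continuous_shifted u v).comp continuous_swap
    exact hcont.continuousAt.eventually_mem (hcl.isOpen_compl.mem_nhds hmem)
  -- By compactness a thin strip along the edge between the two parameters avoids all of the drawing
  -- other than the edge itself.
  have htube := isCompact_uIcc.eventually_forall_of_forall_eventually
    (P := fun ε τ => shifted u v τ ε ∈ D'ᶜ) hK
  obtain ⟨δ, hδ, hball⟩ := Metric.eventually_nhds_iff.mp htube
  have hS : (fun q : ℝ × ℝ => shifted u v q.1 q.2) '' (Set.uIcc t₀ t ×ˢ Set.Ioo 0 δ) ⊆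
      (drawing P A)ᶜ := by
    rintro _ ⟨⟨τ, ε⟩, ⟨hτ, hε⟩, rfl⟩ hD
    have hn := hball (y := ε) (by rw [Real.dist_eq, sub_zero, abs_of_pos hε.1]; exact hε.2) τ hτ
    have hside := side_shifted_self huv.ne τ hε.1
    rcases hD with hP | ⟨x, y, hxy, hz⟩
    · exact hn (Or.inl ⟨hP, trivial⟩)
    · by_cases hne : s(u, v) = s(x, y)
      · have hz' : shifted u v τ ε ∈ segment ℝ u v := by
          rcases Sym2.eq_iff.mp hne with ⟨rfl, rfl⟩ | ⟨rfl, rfl⟩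
          · exact hz
          · rwa [segment_symm]
        obtain ⟨t', -, -, e⟩ := mem_segment_lp.mp hz'
        rw [e, side_lp] at hside
        simp at hside
      · exact hn (Or.inr ⟨x, y, hxy, hne, hz⟩)
  have hpre : IsPreconnected
      ((fun q : ℝ × ℝ => shifted u v q.1 q.2) '' (Set.uIcc t₀ t ×ˢ Set.Ioo 0 δ)) :=
    (isPreconnected_uIcc.prod isPreconnected_Ioo).image _ (continuous_shifted u v).continuousOn
  have hIoo : ∀ᶠ ε : ℝ in 𝓝[>] 0, ε ∈ Set.Ioo 0 δ := Ioo_mem_nhdsGT hδ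
  obtain ⟨ε₀, hε₀, hεm⟩ := (h.and hIoo).exists
  have hsub := hf.subset_of_isPreconnected hpre hS
    ⟨(t₀, ε₀), ⟨Set.left_mem_uIcc, hεm⟩, rfl⟩ hε₀
  filter_upwards [hIoo] with ε hε
  exact hsub ⟨(t, ε), ⟨Set.right_mem_uIcc, hε⟩, rfl⟩

theorem eq_of_coe_angle_eq {x y : ℝ} (hx : 0 < x) (hx' : x ≤ 2 * Real.pi) (hy : 0 < y)
    (hy' : y ≤ 2 * Real.pi) (h : (x : Real.Angle) = y) : x = y := by
  obtain ⟨k, hk⟩ := Real.Angle.angle_eq_iff_two_pi_dvd_sub.mp h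
  have hpi := Real.pi_pos
  have k1 : (-1 : ℝ) < k := by
    by_contra hcon; push Not at hcon; nlinarith
  have k2 : (k : ℝ) < 1 := by
    by_contra hcon; push Not at hcon; nlinarith
  have k1' : -1 < k := by exact_mod_cast k1
  have k2' : k < 1 := by exact_mod_cast k2
  obtain rfl : k = 0 := by omega
  simp at hk
  linarith

theorem ccwAngle_of_eq {v a w : ℂ} {R θ : ℝ} (hR : 0 < R) (hθ : 0 < θ) (hθ' : θ ≤ 2 * Real.pi)
    (h : (w - v) / (a - v) = R * Complex.exp (θ * Complex.I)) : ccwAngle v a w = θ := by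
  refine eq_of_coe_angle_eq (ccwAngle_pos _ _ _) (ccwAngle_le _ _ _) hθ hθ' ?_
  rw [ccwAngle_coe, h, Complex.arg_real_mul _ hR, Complex.arg_exp_mul_I, Real.Angle.coe_toIocMod]

theorem div_eq_of_ccwAngle {v a b : ℂ} : (b - v) / (a - v) =
    ‖(b - v) / (a - v)‖ * Complex.exp (ccwAngle v a b * Complex.I) := by
  have h := ccwAngle_coe v a b
  obtain ⟨k, hk⟩ := Real.Angle.angle_eq_iff_two_pi_dvd_sub.mp h
  have e : (ccwAngle v a b : ℂ) * Complex.I =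
      Complex.arg ((b - v) / (a - v)) * Complex.I + k * (2 * Real.pi * Complex.I) := by
    have : ccwAngle v a b = Complex.arg ((b - v) / (a - v)) + 2 * Real.pi * k := by linarith
    rw [this]; push_cast; ring
  rw [e, Complex.exp_add, Complex.exp_int_mul_two_pi_mul_I, mul_one,
    Complex.norm_mul_exp_arg_mul_I]

/-- The face to the right of an edge is also to the right of the next edge. -/
theorem faceOnRight_next (hA : IsPSLG P A) {f : Set ℂ} (hf : IsFace P A f) {a v b : ℂ}
    (hav : A.Adj a v) (hvb : A.Adj v b)
    (hturn : ∀ x, A.Adj v x → ccwAngle v a b ≤ ccwAngle v a x) (h : FaceOnRight f a v) :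
    FaceOnRight f v b := by
  have hav0 : a - v ≠ 0 := sub_ne_zero.mpr hav.ne
  have hbv0 : b - v ≠ 0 := sub_ne_zero.mpr hvb.ne'
  set θk := ccwAngle v a b with hθk
  have hθ0 : 0 < θk := ccwAngle_pos _ _ _
  have hθ2 : θk ≤ 2 * Real.pi := ccwAngle_le _ _ _
  set R := ‖(b - v) / (a - v)‖ with hR
  have hR0 : 0 < R := norm_pos_iff.mpr (div_ne_zero hbv0 hav0)
  have hb : b - v = (a - v) * (R * Complex.exp (θk * Complex.I)) := by
    rw [hR, hθk, ← div_eq_of_ccwAngle]; field_simp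
  have hcl := isClosed_subdrawing hA (fun z => z ≠ v) (fun x y => x ≠ v ∧ y ≠ v)
  set D' := {z | (z ∈ P ∧ z ≠ v) ∨ ∃ x y, A.Adj x y ∧ (x ≠ v ∧ y ≠ v) ∧ z ∈ segment ℝ x y}
    with hD'
  have hvD : v ∉ D' := by
    rintro (⟨-, h⟩ | ⟨x, y, hxy, ⟨h1, h2⟩, h3⟩)
    · exact h rfl
    · exact hA.vertex_not_inside x y hxy v (hA.endpoints _ _ hvb).1
        (mem_openSegment_of_mem_segment h3 h1.symm h2.symm)
  obtain ⟨r, hr, hball⟩ : ∃ r > 0, ∀ w : ℂ, ‖w‖ < r → v + (a - v) * w ∉ D' := by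
    have hc : Continuous fun w : ℂ => v + (a - v) * w := by fun_prop
    have : ∀ᶠ w : ℂ in 𝓝 0, v + (a - v) * w ∈ D'ᶜ :=
      hc.continuousAt.eventually_mem (hcl.isOpen_compl.mem_nhds (by simpa using hvD))
    obtain ⟨r, hr, h⟩ := Metric.eventually_nhds_iff.mp this
    exact ⟨r, hr, fun w hw => h (by rwa [dist_zero_right])⟩
  set F : ℝ × ℝ → ℂ := fun q => v + (a - v) * (q.1 * Complex.exp (q.2 * Complex.I)) with hF
  -- A small open sector at `v`, in polar coordinates relative to `a - v`, swept from the direction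
  -- of `a` to that of `b`. The turning rule keeps all edges at `v` out of it, also when `b = a` and
  -- the sector is a full slit disc.
  set S := F '' (Set.Ioo 0 r ×ˢ Set.Ioo 0 θk) with hS
  have hSD : S ⊆ (drawing P A)ᶜ := by
    rintro _ ⟨⟨ρ, θ⟩, ⟨hρ, hθ⟩, rfl⟩ hD
    simp only [Set.mem_Ioo] at hρ hθ
    have hn : ‖(ρ : ℂ) * Complex.exp (θ * Complex.I)‖ = ρ := by
      rw [norm_mul, Complex.norm_exp_ofReal_mul_I, mul_one, Complex.norm_real, Real.norm_eq_abs,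
        abs_of_pos hρ.1]
    have hnD := hball _ (hn.trans_lt hρ.2)
    have hw0 : (ρ : ℂ) * Complex.exp (θ * Complex.I) ≠ 0 := by
      rw [← norm_pos_iff, hn]; exact hρ.1
    have hFv : F (ρ, θ) ≠ v := by
      simp only [hF, ne_eq, add_eq_left]
      exact mul_ne_zero hav0 hw0
    have key : ∀ w, A.Adj v w → F (ρ, θ) ∈ segment ℝ v w → False := by
      intro w hvw hz
      obtain ⟨τ, τ0, τ1, e⟩ := mem_segment_lp.mp hz
      have τpos : 0 < τ := by
        refine lt_of_le_of_ne τ0 ?_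
        rintro rfl
        rw [lp_zero] at e
        exact hFv e
      have hτ : (τ : ℂ) ≠ 0 := by exact_mod_cast τpos.ne'
      have e2 : (w - v) / (a - v) = ((ρ / τ : ℝ) : ℂ) * Complex.exp (θ * Complex.I) := by
        simp only [hF, lp] at e
        have : (a - v) * (ρ * Complex.exp (θ * Complex.I)) = τ * (w - v) := by
          linear_combination e
        push_cast
        field_simp
        linear_combination -this
      have := ccwAngle_of_eq (div_pos hρ.1 τpos) hθ.1 (by linarith) e2
      have := hturn w hvw
      linarith
    rcases hD with hP | ⟨x, y, hxy, hz⟩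
    · exact hnD (Or.inl ⟨hP, hFv⟩)
    · by_cases hx : x = v
      · subst hx; exact key y hxy hz
      by_cases hy : y = v
      · subst hy; rw [segment_symm] at hz; exact key x hxy.symm hz
      exact hnD (Or.inr ⟨x, y, hxy, ⟨hx, hy⟩, hz⟩)
  have hSpre : IsPreconnected S :=
    (isPreconnected_Ioo.prod isPreconnected_Ioo).image _ (by
      apply Continuous.continuousOn; rw [hF]; fun_prop)
  -- Points at parameter distance `κ` from `v` on both edges, shifted to the right, have radii about
  -- `κ` and `R * κ`; both must be less than `r`.
  obtain ⟨κ, κ0, κ1, κr, κR⟩ : ∃ κ : ℝ, 0 < κ ∧ κ < 1 ∧ κ < r ∧ R * κ < r := by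
    have h1 : ∀ᶠ κ : ℝ in 𝓝[>] 0, κ < 1 := nhdsWithin_le_nhds (gt_mem_nhds one_pos)
    have h2 : ∀ᶠ κ : ℝ in 𝓝[>] 0, κ < r := nhdsWithin_le_nhds (gt_mem_nhds hr)
    have h3 : ∀ᶠ κ : ℝ in 𝓝[>] 0, R * κ < r := by
      refine nhdsWithin_le_nhds ?_
      have : Continuous fun κ : ℝ => R * κ := by fun_prop
      exact this.continuousAt.eventually (gt_mem_nhds (by simpa using hr))
    have h4 : ∀ᶠ κ : ℝ in 𝓝[>] 0, 0 < κ := self_mem_nhdsWithin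
    obtain ⟨κ, ⟨⟨h1, h2⟩, h3⟩, h4⟩ := (((h1.and h2).and h3).and h4).exists
    exact ⟨κ, h4, h1, h2, h3⟩
  have hκs : (κ : ℂ) ∈ Complex.slitPlane := Complex.ofReal_mem_slitPlane.mpr κ0
  have harg : ∀ σ : ℝ, Tendsto (fun ε : ℝ => Complex.arg ((κ : ℂ) + (σ * ε : ℝ) * Complex.I))
      (𝓝[>] 0) (𝓝 0) := by
    intro σ
    have h1 : ContinuousAt (fun ε : ℝ => (κ : ℂ) + (σ * ε : ℝ) * Complex.I) 0 := by
      apply Continuous.continuousAt; fun_prop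
    have h2 : ContinuousAt Complex.arg ((κ : ℂ) + (σ * (0 : ℝ) : ℝ) * Complex.I) := by
      apply Complex.continuousAt_arg; simpa using hκs
    have h3 := (ContinuousAt.comp (f := fun ε : ℝ => (κ : ℂ) + (σ * ε : ℝ) * Complex.I) h2 h1).tendsto
    simp only [Function.comp_def] at h3
    simp only [mul_zero, Complex.ofReal_zero, zero_mul, add_zero,
      Complex.arg_ofReal_of_nonneg κ0.le] at h3
    exact h3.mono_left nhdsWithin_le_nhds
  have hnorm : ∀ σ : ℝ, Tendsto (fun ε : ℝ => ‖(κ : ℂ) + (σ * ε : ℝ) * Complex.I‖)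
      (𝓝[>] 0) (𝓝 κ) := by
    intro σ
    have h1 : Continuous (fun ε : ℝ => ‖(κ : ℂ) + (σ * ε : ℝ) * Complex.I‖) := by fun_prop
    have h2 := h1.tendsto 0
    simp only [mul_zero, Complex.ofReal_zero, zero_mul, add_zero, Complex.norm_real,
      Real.norm_eq_abs, abs_of_pos κ0] at h2
    exact h2.mono_left nhdsWithin_le_nhds
  have hpos : ∀ᶠ ε : ℝ in 𝓝[>] 0, 0 < ε := self_mem_nhdsWithin
  have hin : ∀ᶠ ε : ℝ in 𝓝[>] 0, shifted a v (1 - κ) ε ∈ S := by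
    filter_upwards [hpos, (harg 1).eventually (gt_mem_nhds hθ0),
      (hnorm 1).eventually (gt_mem_nhds κr)] with ε h1 h2 h3
    rw [one_mul] at h2 h3
    set w := (κ : ℂ) + (ε : ℝ) * Complex.I with hw
    have him : w.im = ε := by simp [hw]
    have hw0 : w ≠ 0 := by intro e; rw [e] at him; simp at him; linarith
    refine ⟨(‖w‖, Complex.arg w), ⟨⟨norm_pos_iff.mpr hw0, h3⟩, ?_, h2⟩, ?_⟩
    · refine lt_of_le_of_ne (Complex.arg_nonneg_iff.mpr (by rw [him]; exact h1.le)) ?_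
      intro e
      have := (Complex.arg_eq_zero_iff.mp e.symm).2
      linarith
    · simp only [hF, Complex.norm_mul_exp_arg_mul_I, hw, shifted, lp]
      push_cast; ring
  have hout : ∀ᶠ ε : ℝ in 𝓝[>] 0, shifted v b κ ε ∈ S := by
    have hR' : Tendsto (fun ε : ℝ => R * ‖(κ : ℂ) + (-1 * ε : ℝ) * Complex.I‖)
      (𝓝[>] 0) (𝓝 (R * κ)) := (hnorm (-1)).const_mul R
    filter_upwards [hpos, (harg (-1)).eventually (lt_mem_nhds (neg_lt_zero.mpr hθ0)),
      hR'.eventually (gt_mem_nhds κR)] with ε h1 h2 h3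
    set w := (κ : ℂ) + (-1 * ε : ℝ) * Complex.I with hw
    have him : w.im = -ε := by simp [hw]
    have hw0 : w ≠ 0 := by intro e; rw [e] at him; simp at him; linarith
    refine ⟨(R * ‖w‖, θk + Complex.arg w), ⟨⟨mul_pos hR0 (norm_pos_iff.mpr hw0), h3⟩, ?_, ?_⟩, ?_⟩
    · simp only; linarith
    · have : Complex.arg w < 0 := Complex.arg_neg_iff.mpr (by rw [him]; linarith)
      simp only; linarith
    · have e : (R * ‖w‖ : ℝ) * Complex.exp ((θk + Complex.arg w : ℝ) * Complex.I) =
          (R * Complex.exp (θk * Complex.I)) * (‖w‖ * Complex.exp (Complex.arg w * Complex.I)) := by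
        push_cast
        rw [add_mul, Complex.exp_add]; ring
      simp only [hF]
      rw [e, Complex.norm_mul_exp_arg_mul_I, ← mul_assoc, ← hb]
      simp only [hw, shifted, lp]
      push_cast; ring
  have hfin := eventually_shifted_mem hA hf hav (t := 1 - κ) one_half_pos one_half_lt_one
    (by linarith) (by linarith) (faceOnRight_iff.mp h)
  obtain ⟨ε, hε1, hε2⟩ := (hfin.and hin).exists
  have hsub := hf.subset_of_isPreconnected hSpre hSD hε2 hε1
  rw [faceOnRight_iff]
  exact eventually_shifted_mem hA hf hvb κ0 κ1 one_half_pos one_half_lt_one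
    (hout.mono fun ε hε => hsub hε)

theorem eq_of_faceOnRight {f f' : Set ℂ} (hf : IsFace P A f) (hf' : IsFace P A f') {u v : ℂ}
    (h : FaceOnRight f u v) (h' : FaceOnRight f' u v) : f = f' := by
  obtain ⟨ε, h1, h2⟩ := (h.and h').exists
  exact hf.eq_of_mem hf' h1 h2

end

/-! ### Triangles and faces -/

section

open Filter Topology

variable {P : Finset ℂ} {A : SimpleGraph ℂ} {γ : ℝ} {o : ℂ} {i : ℕ}

theorem conv_pos {t a b : ℝ} (t0 : 0 ≤ t) (t1 : t ≤ 1) (ha : 0 < a) (hb : 0 < b) :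
    0 < (1 - t) * a + t * b := by
  rcases t0.eq_or_lt with rfl | t0
  · linarith
  · nlinarith [mul_pos t0 hb, mul_nonneg (sub_nonneg.mpr t1) ha.le]

theorem conv_nonneg {t a b : ℝ} (t0 : 0 ≤ t) (t1 : t ≤ 1) (ha : 0 ≤ a) (hb : 0 ≤ b) :
    0 ≤ (1 - t) * a + t * b :=
  add_nonneg (mul_nonneg (sub_nonneg.mpr t1) ha) (mul_nonneg t0 hb)

/-- The open triangle together with the open side `r p`. -/
theorem convex_triangle (p q r : ℂ) :
    Convex ℝ {z | 0 < side 1 p q z ∧ 0 < side 1 q r z ∧ 0 ≤ side 1 r p z} := by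
  rw [convex_iff_segment_subset]
  rintro x ⟨x1, x2, x3⟩ y ⟨y1, y2, y3⟩ z hz
  obtain ⟨t, t0, t1, rfl⟩ := mem_segment_lp.mp hz
  refine ⟨?_, ?_, ?_⟩ <;> rw [side_lp]
  exacts [conv_pos t0 t1 x1 y1, conv_pos t0 t1 x2 y2, conv_nonneg t0 t1 x3 y3]

/-- A face to the right of an edge contains points of each triangle to the right of the edge. -/
theorem exists_mem_triangle {f : Set ℂ} {p q r : ℂ} (ht : 0 < side 1 p q r)
    (hF : FaceOnRight f p q) :
    ∃ z ∈ f, 0 < side 1 p q z ∧ 0 < side 1 q r z ∧ 0 < side 1 r p z := by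
  have h2 : ∀ a b : ℂ, 0 < (1 - 1 / 2) * side 1 a b p + 1 / 2 * side 1 a b q →
      ∀ᶠ ε : ℝ in 𝓝[>] 0, 0 < side 1 a b (shifted p q (1 / 2) ε) := by
    intro a b hpos
    refine nhdsWithin_le_nhds ?_
    simp only [side_shifted]
    have hc : Continuous fun ε : ℝ => (1 - 1 / 2) * side 1 a b p + 1 / 2 * side 1 a b q +
      ε * ((b.im - a.im) * (q.im - p.im) + (b.re - a.re) * (q.re - p.re)) := by fun_prop
    exact hc.continuousAt.eventually (lt_mem_nhds (by simpa using hpos))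
  have h3 := h2 q r (by rw [side_rotate, side_left]; linarith)
  have h4 := h2 r p (by have := side_rotate' 1 p q r; rw [side_right]; linarith)
  have h5 : ∀ᶠ ε : ℝ in 𝓝[>] 0, 0 < ε := self_mem_nhdsWithin
  obtain ⟨ε, ⟨⟨e1, e2⟩, e3⟩, e4⟩ := (((faceOnRight_iff.mp hF).and h3).and h4).and h5 |>.exists
  exact ⟨_, e1, side_shifted_self (side_ne 1 ht.ne').1 _ e4, e2, e3⟩

/-- The open triangle with its open side `r p` adjoined is convex and misses the drawing, and the
face reaches into it along the side `p q`. -/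
theorem openSegment_subset_face (hA : IsPSLG P A) {f : Set ℂ}
    (hf : IsFace P A f) {p q r : ℂ} (hp : p ∈ P) (hr : r ∈ P) (ht : 0 < side 1 p q r)
    (he : EmptyTri P 1 p q r)
    (hfree : ∀ z w, A.Adj z w → ∀ t ∈ segment ℝ z w,
      ¬ (0 < side 1 p q t ∧ 0 < side 1 q r t ∧ 0 < side 1 r p t))
    (hunc : Unc A p r) (hadj : ¬ A.Adj p r) (hF : FaceOnRight f p q) :
    openSegment ℝ p r ⊆ f := by
  have hne := side_ne 1 ht.ne'
  have hsub : {z | 0 < side 1 p q z ∧ 0 < side 1 q r z ∧ 0 ≤ side 1 r p z} ⊆ (drawing P A)ᶜ := by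
    rintro z ⟨z1, z2, z3⟩ hD
    have hzP : z ∉ P := by
      intro hz
      rcases he z hz ⟨z1.le, z2.le, z3⟩ with e | e | e
      · rw [e] at z1; simp at z1
      · rw [e] at z1; simp at z1
      · rw [e] at z2; simp at z2
    rcases hD with hz | ⟨u, v, huv, hz⟩
    · exact hzP hz
    rcases z3.eq_or_lt with z3 | z3
    · have hm : z ∈ segment ℝ r p := mem_segment_of_side one_ne_zero hne.2.2.symm z3.symm z1.le
        z2.le (by rwa [side_rotate'])
      rw [segment_symm] at hm
      have hm' := mem_openSegment_of_mem_segment hm (fun e => hzP (e ▸ hp)) (fun e => hzP (e ▸ hr))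
      have hne' : s(p, r) ≠ s(u, v) := by
        intro e
        rcases Sym2.eq_iff.mp e with ⟨rfl, rfl⟩ | ⟨rfl, rfl⟩
        · exact hadj huv
        · exact hadj huv.symm
      by_cases hzu : z = u ∨ z = v
      · have := hA.endpoints u v huv
        rcases hzu with e | e
        · exact hzP (e ▸ this.1)
        · exact hzP (e ▸ this.2)
      · push Not at hzu
        exact hunc u v huv ⟨hne', z, hm', mem_openSegment_of_mem_segment hz hzu.1 hzu.2⟩
    · exact hfree u v huv z hz ⟨z1, z2, z3⟩
  obtain ⟨z, hzf, z1, z2, z3⟩ := exists_mem_triangle ht hF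
  have hO := hf.subset_of_isPreconnected (convex_triangle p q r).isPreconnected hsub
    ⟨z1, z2, z3.le⟩ hzf
  intro x hx
  obtain ⟨t, t0, t1, rfl⟩ := mem_openSegment_lp.mp hx
  apply hO
  refine ⟨?_, ?_, ?_⟩
  · rw [side_lp, side_left]; nlinarith [mul_pos t0 ht]
  · rw [side_lp, side_right, side_rotate]; nlinarith [mul_pos (sub_pos.mpr t1) ht]
  · rw [side_lp]; simp

theorem interior_triangle {p q r : ℂ} (ht : 0 < side 1 p q r) :
    interior (convexHull ℝ {p, q, r}) =
      {z | 0 < side 1 p q z ∧ 0 < side 1 q r z ∧ 0 < side 1 r p z} := by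
  have hcont : ∀ a b : ℂ, Continuous fun z => side 1 a b z := by
    intro a b
    unfold side
    exact continuous_const.mul (((Complex.continuous_re.sub continuous_const).mul
      continuous_const).sub ((Complex.continuous_im.sub continuous_const).mul continuous_const))
  have t1 := side_rotate 1 p q r
  have t2 := side_rotate' 1 p q r
  have hsub : ∀ a b c : ℂ, 0 ≤ side 1 a b p → 0 ≤ side 1 a b q → 0 ≤ side 1 a b r →
      0 < side 1 a b c → interior (convexHull ℝ {p, q, r}) ⊆ {z | 0 < side 1 a b z} := by
    intro a b c hp hq hr hc z hz
    have hge : convexHull ℝ {p, q, r} ⊆ {z | 0 ≤ side 1 a b z} := by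
      apply convexHull_min
      · intro x hx
        simp only [Set.mem_insert_iff, Set.mem_singleton_iff] at hx
        rcases hx with rfl | rfl | rfl
        exacts [hp, hq, hr]
      · rw [convex_iff_segment_subset]
        rintro x hx y hy z hz
        obtain ⟨t, t0, t1, rfl⟩ := mem_segment_lp.mp hz
        change 0 ≤ side 1 a b _
        rw [side_lp]
        exact conv_nonneg t0 t1 hx hy
    have h0 : 0 ≤ side 1 a b z := hge (interior_subset hz)
    refine lt_of_le_of_ne h0 fun e => ?_
    -- A point of the interior on the line `a b` could be moved away from `c` a little without
    -- leaving the hull, but then it would be on the wrong side of the line.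
    have hl : Continuous fun t : ℝ => lp z c (-t) := by unfold lp; fun_prop
    have h1 : ∀ᶠ t : ℝ in 𝓝 0, lp z c (-t) ∈ interior (convexHull ℝ {p, q, r}) :=
      hl.continuousAt.eventually_mem (isOpen_interior.mem_nhds (by simpa [lp_zero] using hz))
    have h2 : ∀ᶠ t : ℝ in 𝓝[>] 0, lp z c (-t) ∈ interior (convexHull ℝ {p, q, r}) :=
      nhdsWithin_le_nhds h1
    have h3 : ∀ᶠ t : ℝ in 𝓝[>] 0, 0 < t := self_mem_nhdsWithin
    obtain ⟨t, h2, h3⟩ := (h2.and h3).exists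
    have h4 : 0 ≤ side 1 a b (lp z c (-t)) := hge (interior_subset h2)
    rw [side_lp, ← e] at h4
    nlinarith
  apply Set.Subset.antisymm
  · intro z hz
    exact ⟨hsub p q r (by simp) (by simp) ht.le ht hz,
      hsub q r p (by linarith) (by simp) (by simp) (by linarith) hz,
      hsub r p q (by simp) (by linarith) (by simp) (by linarith) hz⟩
  · apply interior_maximal
    · rintro z ⟨z1, z2, z3⟩
      have hD := ht.ne'
      have e : z = (side 1 q r z / side 1 p q r) • p + (side 1 r p z / side 1 p q r) • q +
          (side 1 p q z / side 1 p q r) • r := by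
        simp only [Complex.real_smul]
        apply Complex.ext
        · simp only [Complex.add_re, Complex.mul_re, Complex.ofReal_re, Complex.ofReal_im]
          field_simp
          unfold side; ring
        · simp only [Complex.add_im, Complex.mul_im, Complex.ofReal_re, Complex.ofReal_im]
          field_simp
          unfold side; ring
      have hsum := side_add 1 p q r z
      have := (convex_convexHull ℝ {p, q, r}).sum_mem (t := Finset.univ)
        (w := ![side 1 q r z / side 1 p q r, side 1 r p z / side 1 p q r,
          side 1 p q z / side 1 p q r]) (z := ![p, q, r]) ?_ ?_ ?_
      · rw [Fin.sum_univ_three] at this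
        rw [e]
        exact this
      · intro j _
        fin_cases j
        exacts [(div_pos z2 ht).le, (div_pos z3 ht).le, (div_pos z1 ht).le]
      · rw [Fin.sum_univ_three]
        change side 1 q r z / side 1 p q r + side 1 r p z / side 1 p q r +
          side 1 p q z / side 1 p q r = 1
        field_simp
        linarith
      · intro j _
        apply subset_convexHull
        fin_cases j <;> simp
    · exact ((isOpen_lt continuous_const (hcont p q)).inter
        ((isOpen_lt continuous_const (hcont q r)).inter (isOpen_lt continuous_const (hcont r p))))

/-- The face inside an empty triangle of three edges. -/
theorem face_eq_triangle {f : Set ℂ} (hf : IsFace P A f) {p q r : ℂ}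
    (ht : 0 < side 1 p q r) (he : EmptyTri P 1 p q r)
    (hfree : ∀ z w, A.Adj z w → ∀ t ∈ segment ℝ z w,
      ¬ (0 < side 1 p q t ∧ 0 < side 1 q r t ∧ 0 < side 1 r p t))
    (hpq : A.Adj p q) (hqr : A.Adj q r) (hrp : A.Adj r p) (hF : FaceOnRight f p q) :
    f = interior (convexHull ℝ {p, q, r}) := by
  obtain ⟨z, hzf, hz⟩ := exists_mem_triangle ht hF
  have hint := interior_triangle ht
  have hconv : Convex ℝ (interior (convexHull ℝ {p, q, r})) := (convex_convexHull ℝ _).interior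
  have t1 := side_rotate 1 p q r
  have t2 := side_rotate' 1 p q r
  apply Set.Subset.antisymm
  · have hcont : ∀ a b : ℂ, Continuous fun z => side 1 a b z := by
      intro a b
      unfold side
      exact continuous_const.mul (((Complex.continuous_re.sub continuous_const).mul
        continuous_const).sub ((Complex.continuous_im.sub continuous_const).mul continuous_const))
    have hcl : IsClosed {x | InTri 1 p q r x} :=
      (isClosed_le continuous_const (hcont p q)).inter
        ((isClosed_le continuous_const (hcont q r)).inter (isClosed_le continuous_const (hcont r p)))
    refine hf.isPreconnected.subset_left_of_subset_union isOpen_interior hcl.isOpen_compl ?_ ?_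
      ⟨z, hzf, by rw [hint]; exact hz⟩
    · rw [Set.disjoint_compl_right_iff_subset, hint]
      rintro x ⟨x1, x2, x3⟩
      exact ⟨x1.le, x2.le, x3.le⟩
    · intro x hx
      by_contra hcon
      rw [Set.mem_union, not_or, Set.mem_compl_iff, not_not] at hcon
      obtain ⟨h1, h2, h3, h4⟩ := hcon
      have hne := side_ne 1 ht.ne'
      have hxD := hf.subset hx
      rw [hint] at h1
      rcases h2.eq_or_lt with e1 | e1
      · exact hxD (Or.inr ⟨p, q, hpq,
          mem_segment_of_side one_ne_zero hne.1 e1.symm h3 h4 ht⟩)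
      rcases h3.eq_or_lt with e2 | e2
      · exact hxD (Or.inr ⟨q, r, hqr,
          mem_segment_of_side one_ne_zero hne.2.1 e2.symm h4 h2 (by linarith)⟩)
      rcases h4.eq_or_lt with e3 | e3
      · exact hxD (Or.inr ⟨r, p, hrp,
          mem_segment_of_side one_ne_zero hne.2.2.symm e3.symm h2 h3 (by linarith)⟩)
      exact h1 ⟨e1, e2, e3⟩
  · refine hf.subset_of_isPreconnected hconv.isPreconnected ?_ (by rw [hint]; exact hz) hzf
    rw [hint]
    rintro x ⟨x1, x2, x3⟩ hD
    rcases hD with hx | ⟨u, v, huv, hx⟩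
    · rcases he x hx ⟨x1.le, x2.le, x3.le⟩ with e | e | e
      · rw [e] at x1; simp at x1
      · rw [e] at x1; simp at x1
      · rw [e] at x2; simp at x2
    · exact hfree u v huv x hx ⟨x1, x2, x3⟩

end

section

variable {P : Finset ℂ} {A : SimpleGraph ℂ} {γ : ℝ} {o : ℂ} {i : ℕ} {w : Walk}

/-! ### Boundary walks -/

/-- The vertices of a boundary walk, indexed by the integers. -/
def Walk.seq (w : Walk) (k : ℤ) : ℂ := w.vert (k % w.len).toNat

namespace IsBoundaryWalk

theorem seq_natCast (h : IsBoundaryWalk A w) (n : ℕ) : w.seq n = w.vert n := by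
  unfold Walk.seq
  have hp : Function.Periodic w.vert w.len := h.periodic
  rw [← Int.natCast_mod, Int.toNat_natCast, hp.map_mod_nat]

theorem seq_add_mul (w : Walk) (k j : ℤ) : w.seq (k + j * w.len) = w.seq k := by
  unfold Walk.seq
  rw [Int.add_mul_emod_self_right]

theorem exists_nat (h : IsBoundaryWalk A w) (k : ℤ) : ∃ n : ℕ, ∀ j : ℕ,
    w.seq (k + j) = w.vert (n + j) := by
  have hm : (0 : ℤ) < w.len := by exact_mod_cast h.len_pos
  refine ⟨(k % w.len).toNat, fun j => ?_⟩
  have h0 := Int.emod_nonneg k hm.ne'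
  rw [← h.seq_natCast, Nat.cast_add, Int.toNat_of_nonneg h0,
    ← seq_add_mul w (k % w.len + j) (k / w.len)]
  congr 1
  have := Int.emod_add_mul_ediv k w.len
  linarith

theorem seq_adj (h : IsBoundaryWalk A w) (k : ℤ) : A.Adj (w.seq k) (w.seq (k + 1)) := by
  obtain ⟨n, hn⟩ := h.exists_nat k
  have h0 := hn 0
  have h1 := hn 1
  simp only [Nat.cast_zero, add_zero, Nat.cast_one] at h0 h1
  rw [h0, h1]
  exact h.adj n

theorem seq_turn (h : IsBoundaryWalk A w) (k : ℤ) {x : ℂ} (hx : A.Adj (w.seq k) x) :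
    ccwAngle (w.seq k) (w.seq (k - 1)) (w.seq (k + 1)) ≤ ccwAngle (w.seq k) (w.seq (k - 1)) x := by
  obtain ⟨n, hn⟩ := h.exists_nat (k - 1)
  have h0 := hn 0
  have h1 := hn 1
  have h2 := hn 2
  simp only [Nat.cast_zero, add_zero, Nat.cast_one, sub_add_cancel, Nat.cast_ofNat] at h0 h1 h2
  rw [show k - 1 + 2 = k + 1 by ring] at h2
  rw [h1] at hx
  rw [h0, h1, h2]
  exact h.turn n x hx

theorem faceOnRight (h : IsBoundaryWalk A w) (hA : IsPSLG P A) (hf : IsFace P A w.face) (n : ℕ) :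
    FaceOnRight w.face (w.vert n) (w.vert (n + 1)) := by
  induction n with
  | zero => exact h.face_right
  | succ n ih => exact faceOnRight_next hA hf (h.adj n) (h.adj (n + 1)) (h.turn n) ih

theorem seq_faceOnRight (h : IsBoundaryWalk A w) (hA : IsPSLG P A) (hf : IsFace P A w.face)
    (k : ℤ) : FaceOnRight w.face (w.seq k) (w.seq (k + 1)) := by
  obtain ⟨n, hn⟩ := h.exists_nat k
  have h0 := hn 0
  have h1 := hn 1
  simp only [Nat.cast_zero, add_zero, Nat.cast_one] at h0 h1
  rw [h0, h1]
  exact h.faceOnRight hA hf n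

end IsBoundaryWalk

/-- `A` is a straight-line graph that contains all uncrossed edges of the adjacency graph and no
other edges. -/
structure IsLevelGraph (P : Finset ℂ) (A : SimpleGraph ℂ) (γ : ℝ) (o : ℂ) (i : ℕ) : Prop where
  gp : GeneralPosition P
  pslg : IsPSLG P A
  near : ∀ u v, A.Adj u v → Near γ o i u v
  maxi : ∀ u ∈ P, ∀ v ∈ P, u ≠ v → Near γ o i u v → Unc A u v → A.Adj u v

/-- Only `notri` uses that the face is not triangulated: an empty convex corner closed by an edge
would make the face the interior of that triangle. -/
theorem IsLevelGraph.bd (hG : IsLevelGraph P A γ o i) (hf : IsNonTriangulatedFace P A w.face)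
    (hw : IsBoundaryWalk A w) : Bd P A γ o i 1 w.seq where
  gp := hG.gp
  pslg := hG.pslg
  near := hG.near
  maxi := hG.maxi
  hs := Or.inl rfl
  adj := hw.seq_adj
  turn := fun k x hx => by rw [ang_one, ang_one]; exact hw.seq_turn k hx
  notri := fun k hk he hadj => by
    have ha1 : A.Adj (w.seq (k - 1)) (w.seq k) := by
      have := hw.seq_adj (k - 1); rwa [sub_add_cancel] at this
    have ha2 := hw.seq_adj k
    have hm : ∀ {u v}, A.Adj u v → u ∈ P := fun h => (hG.pslg.endpoints _ _ h).1
    have hno : ∀ x, A.Adj (w.seq k) x →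
        ¬ (0 < side 1 (w.seq (k - 1)) (w.seq k) x ∧ 0 < side 1 (w.seq k) (w.seq (k + 1)) x) := by
      rintro x hx ⟨x1, x2⟩
      have := hw.seq_turn k hx
      rw [← neg_lt_zero, ← side_swap] at x1
      rw [← neg_lt_zero, ← side_swap'] at x2
      have e := ang_add_of_side (Or.inl rfl) x1 x2
      rw [ang_one, ang_one, ang_one] at e
      have := ccwAngle_pos (w.seq k) x (w.seq (k + 1))
      linarith
    obtain ⟨y, hy⟩ := exists_first hG.gp hG.pslg (hm ha1) (hm ha2) (hm ha2.symm) hk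
      (hG.pslg.unc ha1) (hG.pslg.unc ha2) hno
    obtain rfl : y = w.seq (k + 1) := by
      rcases he y hy.mem hy.inTri with e | e | e
      · exact absurd e hy.ne_left
      · exact absurd e hy.ne_right
      · exact e
    refine hf.2 ⟨_, _, _, ha1, ha2, hadj.symm, face_eq_triangle hf.1 hk he ?_ ha1 ha2 hadj.symm ?_⟩
    · rintro u v huv t ht ⟨t1, t2, t3⟩
      exact hy.free u v huv t ht ⟨t1, t2, by rwa [side_rotate]⟩
    · have := hw.seq_faceOnRight hG.pslg hf.1 (k - 1)
      rwa [sub_add_cancel] at this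

theorem rightOf_iff {a b x : ℂ} : RightOf a b x ↔ 0 < side 1 a b x := by
  unfold RightOf side
  simp only [Complex.mul_im, Complex.sub_re, Complex.sub_im, Complex.conj_re, Complex.conj_im,
    map_sub]
  constructor <;> intro <;> linarith

theorem unc_of_subset_face {f : Set ℂ} (hf : IsFace P A f) {x y : ℂ}
    (h : openSegment ℝ x y ⊆ f) : Unc A x y ∧ ¬ A.Adj x y := by
  constructor
  · rintro u v huv ⟨-, z, hz, hz'⟩
    exact hf.subset (h hz) (Or.inr ⟨u, v, huv, openSegment_subset_segment ℝ _ _ hz'⟩)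
  · intro hadj
    obtain ⟨z, hz⟩ := (⟨_, midpoint_mem_openSegment x y⟩ : (openSegment ℝ x y).Nonempty)
    exact hf.subset (h hz) (Or.inr ⟨x, y, hadj, openSegment_subset_segment ℝ _ _ hz⟩)

/-- The neighbours of a convex vertex always see each other through the face. Hence Step 1 applies
just before each convex vertex, and the backward condition holds just after it. -/
theorem Bd.openSegment_subset (h : Bd P A γ o i 1 w.seq) (hf : IsFace P A w.face)
    (hw : IsBoundaryWalk A w) {k : ℤ} (hk : Conv 1 w.seq k) :
    openSegment ℝ (w.seq (k - 1)) (w.seq (k + 1)) ⊆ w.face := by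
  have hd := h.ear_diag hk
  refine openSegment_subset_face h.pslg hf (h.mem _) (h.mem _) hk (h.ear_emptyTri hk) ?_ hd.unc
    hd.not_adj ?_
  · rintro u v huv t ht ⟨t1, t2, t3⟩
    exact (h.ear_first hk).free u v huv t ht ⟨t1, t2, by rwa [side_rotate]⟩
  · have := hw.seq_faceOnRight h.pslg hf (k - 1)
    rwa [sub_add_cancel] at this

theorem Bd.isConvex_iff (h : Bd P A γ o i 1 w.seq) (hw : IsBoundaryWalk A w) (k : ℕ) :
    w.IsConvex k ↔ Conv 1 w.seq k := by
  rw [h.conv_iff, ang_one]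
  unfold Walk.IsConvex
  have hm := hw.len_pos
  have h1 : w.seq ((k : ℤ) - 1) = w.vert (k + w.len - 1) := by
    rw [← hw.seq_natCast, ← IsBoundaryWalk.seq_add_mul w (k - 1) 1]
    congr 1
    omega
  have h2 : w.seq ((k : ℤ) + 1) = w.vert (k + 1) := by
    rw [← hw.seq_natCast]; push_cast; rfl
  rw [hw.seq_natCast, h1, h2]

end

section

variable {P : Finset ℂ} {A : SimpleGraph ℂ} {γ : ℝ} {o : ℂ} {i : ℕ} {w : Walk} {N : ℂ → ℂ → Prop}

/-! ### The traversal of a boundary walk -/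

namespace Walk

theorem fwdConvex_eq {p c : ℕ} (h1 : p < c) (h2 : w.IsConvex c)
    (h3 : ∀ k, p < k → k < c → ¬ w.IsConvex k) : w.fwdConvex p = c :=
  IsLeast.csInf_eq ⟨⟨h1, h2⟩, fun k hk => not_lt.mp fun hlt => h3 k hk.1 hlt hk.2⟩

theorem fwdConvex_spec {p : ℕ} (h : ∃ q, p < q ∧ w.IsConvex q) :
    p < w.fwdConvex p ∧ w.IsConvex (w.fwdConvex p) ∧
      ∀ k, p < k → k < w.fwdConvex p → ¬ w.IsConvex k := by
  have hm : w.fwdConvex p ∈ {q | p < q ∧ w.IsConvex q} := Nat.sInf_mem h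
  exact ⟨hm.1, hm.2, fun k h1 h2 h3 => Nat.notMem_of_lt_sInf h2 ⟨h1, h3⟩⟩

theorem bwdConvex_eq {g r : ℕ} (h1 : g < r) (h2 : w.IsConvex g)
    (h3 : ∀ k, g < k → k < r → ¬ w.IsConvex k) : w.bwdConvex r = g :=
  IsGreatest.csSup_eq ⟨⟨h1, h2⟩, fun k hk => not_lt.mp fun hlt => h3 k hlt hk.1 hk.2⟩

theorem bwdConvex_spec {r : ℕ} (h : ∃ q, 0 < q ∧ q < r ∧ w.IsConvex q) :
    0 < w.bwdConvex r ∧ w.bwdConvex r < r ∧ w.IsConvex (w.bwdConvex r) ∧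
      ∀ k, w.bwdConvex r < k → k < r → ¬ w.IsConvex k := by
  obtain ⟨q, q0, q1, q2⟩ := h
  have hb : BddAbove {q | q < r ∧ w.IsConvex q} := ⟨r, fun k hk => hk.1.le⟩
  have hm : w.bwdConvex r ∈ {q | q < r ∧ w.IsConvex q} := Nat.sSup_mem ⟨q, q1, q2⟩ hb
  have hle : ∀ k, k < r → w.IsConvex k → k ≤ w.bwdConvex r := fun k h1 h2 =>
    le_csSup hb ⟨h1, h2⟩
  exact ⟨q0.trans_le (hle q q1 q2), hm.1, hm.2, fun k h1 h2 h3 => absurd (hle k h2 h3) (not_le.mpr h1)⟩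

/-- A convex vertex followed by a reflex one produces a backward support vertex; without any,
convexity propagates forward. -/
theorem isConvex_succ (hb : ¬ ∃ k, w.IsBackwardSupport k) {k : ℕ}
    (hk : w.IsConvex (k + 1)) : w.IsConvex (k + 2) := by
  by_contra hcon
  refine hb ⟨k, hk, k + 2, by omega, fun t h1 h2 => ?_⟩
  obtain rfl : t = k + 2 := by omega
  exact hcon

/-- The traversal moves forward, and positions from `w.len` on never lead back below it. The minimum
with `w.len` accounts for Step 1(c), which resets to exactly `w.len`. -/
theorem le_next {x : ℕ} (h : ∀ p, p < w.len → p < w.next N p) (k : ℕ) :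
    min x w.len ≤ (w.next N)^[k] x := by
  induction k with
  | zero => exact min_le_left _ _
  | succ k ih =>
    rw [Function.iterate_succ_apply']
    set y := (w.next N)^[k] x
    by_cases hy : y < w.len
    · exact ih.trans (h y hy).le
    · have : w.len ≤ w.next N y := by
        unfold next
        split_ifs with h1 h2
        · exact le_rfl
        · rw [not_lt] at hy
          exact absurd (hy.trans (fwdConvex_spec h1.1).1.le) h2
        · omega
      exact (min_le_right _ _).trans this

end Walk

/-- `w` is a boundary walk, with an admissible start vertex, of a face that is not triangulated. -/
structure IsTraversal (P : Finset ℂ) (A : SimpleGraph ℂ) (γ : ℝ) (o : ℂ) (i : ℕ) (w : Walk) :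
    Prop where
  graph : IsLevelGraph P A γ o i
  nontri : IsNonTriangulatedFace P A w.face
  walk : IsBoundaryWalk A w
  start : w.IsStart

namespace IsTraversal

theorem bd (h : IsTraversal P A γ o i w) : Bd P A γ o i 1 w.seq := h.graph.bd h.nontri h.walk

theorem convex_iff (h : IsTraversal P A γ o i w) (k : ℕ) : w.IsConvex k ↔ Conv 1 w.seq k :=
  h.bd.isConvex_iff h.walk k

theorem convex_iff_of_int (h : IsTraversal P A γ o i w) {k : ℕ} {j : ℤ} (e : (k : ℤ) = j) :
    w.IsConvex k ↔ Conv 1 w.seq j := by rw [h.convex_iff, e]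

theorem two_le_len (h : IsTraversal P A γ o i w) : 2 ≤ w.len := by
  have h0 := h.walk.len_pos
  by_contra hcon
  have h1 : w.len = 1 := by omega
  have := h.walk.periodic 0
  rw [h1] at this
  exact (h.walk.adj 0).ne this.symm

theorem convex_add_mul (h : IsTraversal P A γ o i w) (k j : ℕ) :
    w.IsConvex (k + j * w.len) ↔ w.IsConvex k := by
  rw [h.convex_iff, h.convex_iff]
  unfold Conv
  push_cast
  rw [show (k : ℤ) + j * w.len - 1 = k - 1 + j * w.len by ring,
    show (k : ℤ) + j * w.len + 1 = k + 1 + j * w.len by ring,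
    IsBoundaryWalk.seq_add_mul, IsBoundaryWalk.seq_add_mul, IsBoundaryWalk.seq_add_mul]

theorem convex_add_len (h : IsTraversal P A γ o i w) (k : ℕ) :
    w.IsConvex (k + w.len) ↔ w.IsConvex k := by
  have := h.convex_add_mul k 1
  rwa [one_mul] at this

theorem ear (h : IsTraversal P A γ o i w) {p : ℕ} (hp : w.IsConvex (p + 1)) :
    openSegment ℝ (w.vert p) (w.vert (p + 2)) ⊆ w.face ∧
      0 < side 1 (w.vert p) (w.vert (p + 1)) (w.vert (p + 2)) := by
  have hc := (h.convex_iff _).mp hp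
  have h1 := h.bd.openSegment_subset h.nontri.1 h.walk hc
  have e1 : ((p + 1 : ℕ) : ℤ) - 1 = (p : ℕ) := by push_cast; ring
  have e2 : ((p + 1 : ℕ) : ℤ) + 1 = (p + 2 : ℕ) := by push_cast; ring
  unfold Conv at hc
  rw [e1, e2] at h1 hc
  simp only [h.walk.seq_natCast] at h1 hc
  exact ⟨h1, hc⟩

theorem vert_near (h : IsTraversal P A γ o i w) (p : ℕ) :
    Near γ o i (w.vert p) (w.vert (p + 1)) := h.graph.near _ _ (h.walk.adj p)

theorem step1_of_convex (h : IsTraversal P A γ o i w) {p : ℕ} (hp : w.IsConvex (p + 1)) :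
    w.Step1 (Near γ o i) p ∧ w.fwdConvex p = p + 1 := by
  have e : w.fwdConvex p = p + 1 := Walk.fwdConvex_eq (by omega) hp (fun k h1 h2 => by omega)
  have he := h.ear hp
  refine ⟨⟨⟨p + 1, by omega, hp⟩, ?_, ?_⟩, e⟩
  · rw [e]; exact h.vert_near p
  · rw [e]
    refine ⟨he.1, rightOf_iff.mpr ?_⟩
    rw [side_rotate]; exact he.2

theorem backwardOK_of_convex (h : IsTraversal P A γ o i w) {p : ℕ} (hp : w.IsConvex (p + 1)) :
    w.BackwardOK (Near γ o i) (p + 2) ∧ w.bwdConvex (p + 2) = p + 1 := by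
  have e : w.bwdConvex (p + 2) = p + 1 := Walk.bwdConvex_eq (by omega) hp (fun k h1 h2 => by omega)
  have he := h.ear hp
  refine ⟨⟨⟨p + 1, by omega, by omega, hp⟩, ?_, ?_⟩, e⟩
  · rw [e]; exact (h.vert_near (p + 1)).symm
  · rw [e, Nat.add_sub_cancel]
    exact ⟨by rw [openSegment_symm]; exact he.1, rightOf_iff.mpr he.2⟩

/-- The choice of the start vertex makes `v₁` convex. If there is no backward support vertex at all,
one convex corner forces all corners to be convex, by going once around. -/
theorem convex_one (h : IsTraversal P A γ o i w) (hc : ∃ q, w.IsConvex q) : w.IsConvex 1 := by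
  by_cases hb : ∃ k, w.IsBackwardSupport k
  · exact (h.start hb).1
  obtain ⟨q, hq⟩ := hc
  have hall : ∀ j, w.IsConvex (q + w.len + j) := by
    intro j
    induction j with
    | zero => exact (h.convex_add_len q).mpr hq
    | succ j ih =>
      have := Walk.isConvex_succ hb (k := q + w.len + j - 1)
      have h2 := h.two_le_len
      rw [show q + w.len + j - 1 + 1 = q + w.len + j by omega,
        show q + w.len + j - 1 + 2 = q + w.len + (j + 1) by omega] at this
      exact this ih
  rw [← h.convex_add_mul 1 (q + 1)]
  have h2 := h.two_le_len
  obtain ⟨j, hj⟩ := Nat.exists_eq_add_of_le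
    (show q + w.len ≤ 1 + (q + 1) * w.len by nlinarith)
  rw [hj]
  exact hall j

/-- A convex `v₂` shows that `v₀` is not a backward support vertex, so there is none and convexity
propagates. -/
theorem convex_three (h : IsTraversal P A γ o i w) (h2 : w.IsConvex 2) : w.IsConvex 3 := by
  by_cases hb : ∃ k, w.IsBackwardSupport k
  · obtain ⟨-, r, h1, hr⟩ := h.start hb
    exact absurd h2 (hr 2 (by omega) (by omega))
  · exact Walk.isConvex_succ hb h2

theorem chainEnd_spec (h : IsTraversal P A γ o i w) {p : ℕ} (hc : w.IsConvex (w.fwdConvex p)) :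
    (w.chainEnd (Near γ o i) p = w.fwdConvex p + 1 ∧
      ¬ (¬ w.IsConvex (w.fwdConvex p + 2) ∧ w.BackwardOK (Near γ o i) (w.fwdConvex p + 2))) ∨
    (w.fwdConvex p + 2 ≤ w.chainEnd (Near γ o i) p ∧
      (∀ r, w.fwdConvex p + 2 ≤ r → r ≤ w.chainEnd (Near γ o i) p → ¬ w.IsConvex r) ∧
      w.BackwardOK (Near γ o i) (w.chainEnd (Near γ o i) p)) := by
  by_cases hcond : ¬ w.IsConvex (w.fwdConvex p + 2) ∧
      w.BackwardOK (Near γ o i) (w.fwdConvex p + 2)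
  · right
    have e : w.chainEnd (Near γ o i) p = sSup {s | w.fwdConvex p + 2 ≤ s ∧
      (∀ r, w.fwdConvex p + 2 ≤ r → r ≤ s → ¬ w.IsConvex r) ∧ w.BackwardOK (Near γ o i) s} := by
      unfold Walk.chainEnd
      rw [if_pos hcond]
    rw [e]
    set S := {s | w.fwdConvex p + 2 ≤ s ∧
      (∀ r, w.fwdConvex p + 2 ≤ r → r ≤ s → ¬ w.IsConvex r) ∧ w.BackwardOK (Near γ o i) s}
    suffices hmem : sSup S ∈ S from hmem
    refine Nat.sSup_mem ?_ ?_
    · refine ⟨w.fwdConvex p + 2, le_rfl, fun r h1 h2 => ?_, hcond.2⟩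
      rw [le_antisymm h2 h1]; exact hcond.1
    -- The supremum is an actual maximum because the reflex run must stop at the latest when the
    -- convex vertex comes round again; two periods suffice even for `w.len = 2`.
    · refine ⟨w.fwdConvex p + 2 * w.len, fun s hs => ?_⟩
      by_contra hcon
      have := h.two_le_len
      exact hs.2.1 (w.fwdConvex p + 2 * w.len) (by omega) (by omega) ((h.convex_add_mul _ 2).mpr hc)
  · left
    refine ⟨?_, hcond⟩
    unfold Walk.chainEnd
    rw [if_neg hcond]

theorem le_chainEnd (h : IsTraversal P A γ o i w) {p : ℕ} (hc : w.IsConvex (w.fwdConvex p)) :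
    w.fwdConvex p + 1 ≤ w.chainEnd (Near γ o i) p := by
  rcases h.chainEnd_spec hc with e | e <;> omega

/-- The reflex run cannot pass `v_{m+1}`, which is a copy of the convex vertex `v₁`. -/
theorem chainEnd_le (h : IsTraversal P A γ o i w) {p : ℕ} (hc : w.IsConvex (w.fwdConvex p))
    (hlt : w.fwdConvex p < w.len) : w.chainEnd (Near γ o i) p ≤ w.len := by
  rcases h.chainEnd_spec hc with e | ⟨-, e, -⟩
  · omega
  · by_contra hcon
    refine e (1 + w.len) (by omega) (by omega) ((h.convex_add_len 1).mpr (h.convex_one ⟨_, hc⟩))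

theorem lt_next (h : IsTraversal P A γ o i w) {p : ℕ} (hp : p < w.len) :
    p < w.next (Near γ o i) p := by
  unfold Walk.next
  split_ifs with h1 h2
  · exact hp
  · have h3 := Walk.fwdConvex_spec h1.1
    have := h.le_chainEnd h3.2.1
    omega
  · omega

/-- Positions are handled in increasing order, so the intervals from a position to its successor do
not overlap. -/
theorem next_le_of_lt (h : IsTraversal P A γ o i w) {p p' : ℕ}
    (hp : w.IsProcessed (Near γ o i) p) (hp' : w.IsProcessed (Near γ o i) p') (hlt : p < p') :
    w.next (Near γ o i) p ≤ p' := by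
  obtain ⟨h1, k, hk⟩ := hp
  obtain ⟨h2, k', hk'⟩ := hp'
  have hle := fun x j => Walk.le_next (N := Near γ o i) (w := w) (x := x) (fun p hp => h.lt_next hp) j
  rcases lt_trichotomy k k' with e | e | e
  · obtain ⟨j, rfl⟩ := Nat.exists_eq_add_of_lt e
    have := hle (w.next (Near γ o i) p) j
    rw [← hk, ← Function.iterate_succ_apply' (w.next (Near γ o i)) k 0, ← Function.iterate_add_apply] at this
    rw [show j + (k + 1) = k + j + 1 by ring, hk', Function.iterate_succ_apply', hk] at this
    omega
  · subst e; omega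
  · obtain ⟨j, rfl⟩ := Nat.exists_eq_add_of_lt e
    have := hle p' (j + 1)
    rw [← hk', ← Function.iterate_add_apply, show j + 1 + k' = k' + j + 1 by ring, hk, hk'] at this
    omega

theorem processed_cases (h : IsTraversal P A γ o i w) {p : ℕ}
    (hp : w.IsProcessed (Near γ o i) p) : p = 0 ∨ ∃ p', w.IsProcessed (Near γ o i) p' ∧
      w.next (Near γ o i) p' = p := by
  obtain ⟨h1, k, hk⟩ := hp
  cases k with
  | zero => exact Or.inl hk.symm
  | succ k =>
    right
    have hle := Walk.le_next (N := Near γ o i) (w := w) (x := (w.next (Near γ o i))^[k] 0)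
      (fun p hp => h.lt_next hp) 1
    rw [Function.iterate_one, ← Function.iterate_succ_apply' (w.next (Near γ o i)) k 0, hk] at hle
    refine ⟨(w.next (Near γ o i))^[k] 0, ⟨by omega, k, rfl⟩, ?_⟩
    rwa [← Function.iterate_succ_apply' (w.next (Near γ o i)) k 0]

theorem processed_zero (h : IsTraversal P A γ o i w) : w.IsProcessed (Near γ o i) 0 :=
  ⟨h.walk.len_pos, 0, rfl⟩

/-- The corners next to a convex corner that is handled are convex. -/
theorem processed_convex (h : IsTraversal P A γ o i w) {p : ℕ}
    (hp : w.IsProcessed (Near γ o i) p) (hc : w.IsConvex p) :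
    w.IsConvex (p + 1) ∧ (0 < p → w.IsConvex (p - 1)) := by
  rcases h.processed_cases hp with rfl | ⟨p', hp', rfl⟩
  · exact ⟨h.convex_one ⟨_, hc⟩, fun h0 => absurd h0 (lt_irrefl _)⟩
  have hlt := hp.1
  unfold Walk.next at hc hlt ⊢
  split_ifs at hc hlt ⊢ with h1 h2
  · omega
  · obtain ⟨h3, h4, h5⟩ := Walk.fwdConvex_spec h1.1
    rcases h.chainEnd_spec h4 with ⟨e, hn⟩ | ⟨e, hr, -⟩
    · rw [e] at hc ⊢
      refine ⟨?_, fun _ => h4⟩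
      -- A chain that stops at a convex support vertex cannot be followed by a reflex one: the ear
      -- there would satisfy the backward condition and Step 1(a) would have extended the chain.
      by_contra hcon
      exact hn ⟨hcon, (h.backwardOK_of_convex hc).1⟩
    · exact absurd hc (hr _ e le_rfl)
  -- Step 2 never moves onto a convex vertex, since Step 1 applies in front of it.
  · exact absurd (h.step1_of_convex hc).1 h1

/-- The chain generated from `v₀` is itself a backward fan over `v₁`. Shifted by one period, it is
the fan that the last chain meets in Step 1(c). -/
theorem start_chain (h : IsTraversal P A γ o i w) (hc : ∃ q, w.IsConvex q) :
    w.fwdConvex 0 = 1 ∧ w.next (Near γ o i) 0 = w.chainEnd (Near γ o i) 0 ∧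
    2 ≤ w.next (Near γ o i) 0 ∧ w.BackwardOK (Near γ o i) (w.next (Near γ o i) 0) ∧
    w.bwdConvex (w.next (Near γ o i) 0) = 1 ∧
    (w.IsConvex (w.next (Near γ o i) 0) → w.next (Near γ o i) 0 = 2 ∧ w.IsConvex 3) := by
  have h1 := h.convex_one hc
  obtain ⟨hs, e⟩ := h.step1_of_convex h1
  rw [zero_add] at e
  have hm := h.two_le_len
  have hn : w.next (Near γ o i) 0 = w.chainEnd (Near γ o i) 0 := by
    unfold Walk.next
    rw [if_pos hs, if_neg (by omega)]
  rw [hn]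
  have hspec := h.chainEnd_spec (p := 0) (by rw [e]; exact h1)
  rw [e] at hspec
  refine ⟨e, rfl, ?_⟩
  rcases hspec with ⟨e', -⟩ | ⟨e', hr, hb⟩
  · rw [e']
    have := h.backwardOK_of_convex h1
    exact ⟨le_rfl, this.1, this.2, fun h2 => ⟨rfl, h.convex_three h2⟩⟩
  · refine ⟨by omega, hb, ?_, fun h2 => absurd h2 (hr _ e' le_rfl)⟩
    refine Walk.bwdConvex_eq (by omega) h1 fun k k1 k2 hk => ?_
    by_cases k3 : k = 2
    · subst k3; exact hr 3 (by omega) (by omega) (h.convex_three hk)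
    · exact hr k (by omega) (by omega) hk

end IsTraversal

end

section

variable {P : Finset ℂ} {A : SimpleGraph ℂ} {γ : ℝ} {o : ℂ} {i : ℕ} {w : Walk} {s : ℝ} {V : ℤ → ℂ}

/-! ### The added edges -/

theorem conv_shift {T : ℤ} (hV : ∀ k, V (k + T) = V k) (k : ℤ) :
    Conv s V (k + T) ↔ Conv s V k := by
  unfold Conv
  rw [show k + T - 1 = k - 1 + T by ring, show k + T + 1 = k + 1 + T by ring, hV, hV, hV]

theorem Fwd.shift {T p c : ℤ} (hV : ∀ k, V (k + T) = V k) (hF : Fwd P A γ o i s V p c) :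
    Fwd P A γ o i s V (p + T) (c + T) where
  lt := by have := hF.lt; omega
  conv := (conv_shift hV c).mpr hF.conv
  reflex := fun k h1 h2 hk => by
    refine hF.reflex (k - T) (by omega) (by omega) ((conv_shift hV _).mp ?_)
    rwa [sub_add_cancel]
  near := by rw [hV, hV]; exact hF.near
  unc := by rw [show c + T + 1 = c + 1 + T by ring, hV, hV]; exact hF.unc
  not_adj := by rw [show c + T + 1 = c + 1 + T by ring, hV, hV]; exact hF.not_adj
  facing := by rw [show c + T + 1 = c + 1 + T by ring, hV, hV, hV]; exact hF.facing
  next := fun h => by have := hF.next ((conv_shift hV p).mp h); omega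

/-- Properties of the triangulated chain from `V a` to `V b` and of the edge between its ends. -/
structure IsChain (P : Finset ℂ) (A : SimpleGraph ℂ) (γ : ℝ) (o : ℂ) (i : ℕ) (V : ℤ → ℂ)
    (a b : ℤ) : Prop where
  tree : Tree P A 1 V a b
  edge : A.Adj (V a) (V b) ∨ Diag A 1 V a b
  dist : CellDist γ o i 3 (V a) (V b)

theorem Fwd.isChain {p c j : ℤ} (hF : Fwd P A γ o i 1 V p c) (h : Bd P A γ o i 1 V) (hpj : p ≤ j)
    (hjc : j < c) : IsChain P A γ o i V j (c + 1) :=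
  ⟨hF.tree h hpj hjc.le, Or.inr (hF.fanAt h hpj hjc).diag, hF.cellDist h hpj hjc⟩

theorem Pair.isChain {p c g q a b : ℤ} (h : Pair P A γ o i 1 V p c g q) (hpa : p ≤ a)
    (hac : a < c) (hgb : g < b) (hbq : b ≤ q) : IsChain P A γ o i V a b := by
  have hcg : g = c ∨ g = c + 1 := h.convex.imp id And.left
  refine ⟨h.tree hpa (by omega) (by omega) hbq, ?_, h.cellDist hpa hac hgb hbq⟩
  rcases (h.quad hpa (by omega) (by omega) hbq).link with (e | e) | e
  · omega
  · exact Or.inr e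
  · exact Or.inl e.1

namespace IsTraversal

theorem fwd (h : IsTraversal P A γ o i w) {p : ℕ} (hs : w.Step1 (Near γ o i) p)
    (hp : w.IsProcessed (Near γ o i) p) : Fwd P A γ o i 1 w.seq p (w.fwdConvex p) := by
  obtain ⟨hex, hn, hsub, hside⟩ := hs
  obtain ⟨h1, h2, h3⟩ := Walk.fwdConvex_spec hex
  have hu := unc_of_subset_face h.nontri.1 hsub
  have e : ((w.fwdConvex p : ℕ) : ℤ) + 1 = (w.fwdConvex p + 1 : ℕ) := by push_cast; rfl
  refine ⟨by exact_mod_cast h1, (h.convex_iff _).mp h2, fun k k1 k2 hk => ?_, ?_, ?_, ?_, ?_, ?_⟩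
  · obtain ⟨n, rfl⟩ := Int.eq_ofNat_of_zero_le (show 0 ≤ k by omega)
    exact h3 n (by omega) (by omega) ((h.convex_iff n).mpr hk)
  · rw [h.walk.seq_natCast, h.walk.seq_natCast]; exact hn.symm
  · rw [e, h.walk.seq_natCast, h.walk.seq_natCast]; exact hu.1
  · rw [e, h.walk.seq_natCast, h.walk.seq_natCast]; exact hu.2
  · rw [e, h.walk.seq_natCast, h.walk.seq_natCast, h.walk.seq_natCast]
    exact rightOf_iff.mp hside
  -- A convex vertex that is handled has a convex successor, so its forward convex vertex is the
  -- next one.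
  · intro hc
    have := (h.step1_of_convex (h.processed_convex hp ((h.convex_iff p).mpr hc)).1).2
    rw [this]; push_cast; rfl

theorem bwd (h : IsTraversal P A γ o i w) {r : ℕ} (hb : w.BackwardOK (Near γ o i) r)
    (hr : w.IsConvex r → r = w.bwdConvex r + 1) :
    Fwd P A γ o i (-1) (fun k => w.seq (-k)) (-(r : ℤ)) (-(w.bwdConvex r : ℤ)) := by
  obtain ⟨hex, hn, hsub, hside⟩ := hb
  obtain ⟨h0, h1, h2, h3⟩ := Walk.bwdConvex_spec hex
  have hu := unc_of_subset_face h.nontri.1 hsub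
  have e : -(-((w.bwdConvex r : ℕ) : ℤ) + 1) = (w.bwdConvex r - 1 : ℕ) := by omega
  refine ⟨by omega, conv_rev.mpr ((h.convex_iff _).mp h2), fun k k1 k2 hk => ?_, ?_, ?_, ?_, ?_, ?_⟩
  · obtain ⟨n, hk'⟩ := Int.eq_ofNat_of_zero_le (show 0 ≤ -k by omega)
    obtain rfl : k = -(n : ℤ) := by omega
    exact h3 n (by omega) (by omega) ((h.convex_iff n).mpr (conv_rev.mp hk))
  · simp only [neg_neg]
    rw [h.walk.seq_natCast, h.walk.seq_natCast]; exact hn.symm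
  · rw [neg_neg, e, h.walk.seq_natCast, h.walk.seq_natCast]; exact hu.1
  · rw [neg_neg, e, h.walk.seq_natCast, h.walk.seq_natCast]; exact hu.2
  · rw [neg_neg, neg_neg, e, h.walk.seq_natCast, h.walk.seq_natCast, h.walk.seq_natCast, side_neg,
      side_swap, neg_neg]
    exact rightOf_iff.mp hside
  · intro hc
    have := hr ((h.convex_iff r).mpr (conv_rev.mp hc))
    omega

/-- The chain generated from `v_p`, if it extends beyond the forward support vertex. -/
theorem pair_of_chainEnd (h : IsTraversal P A γ o i w) {p : ℕ} (hs : w.Step1 (Near γ o i) p)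
    (hp : w.IsProcessed (Near γ o i) p)
    (he : w.fwdConvex p + 1 < w.chainEnd (Near γ o i) p) :
    ∃ g : ℤ, g ≤ w.fwdConvex p + 1 ∧ Pair P A γ o i 1 w.seq p (w.fwdConvex p) g
      (w.chainEnd (Near γ o i) p) := by
  obtain ⟨h1, h2, h3⟩ := Walk.fwdConvex_spec hs.1
  rcases h.chainEnd_spec h2 with ⟨e, -⟩ | ⟨e, hr, hb⟩
  · omega
  have hbwd := h.bwd hb fun hc => absurd hc (hr _ e le_rfl)
  by_cases hc : w.IsConvex (w.fwdConvex p + 1)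
  · have hg : w.bwdConvex (w.chainEnd (Near γ o i) p) = w.fwdConvex p + 1 :=
      Walk.bwdConvex_eq (by omega) hc fun k k1 k2 => hr k (by omega) (by omega)
    rw [hg] at hbwd
    refine ⟨_, le_of_eq (by push_cast; rfl), ⟨h.bd, h.fwd hs hp, hbwd, Or.inr ⟨by push_cast; rfl,
      fun hcp => ?_, fun hce => ?_⟩⟩⟩
    -- For `p = 0` the two convex vertices would be `v₁` and `v₂`, which forces `v₃` to be convex,
    -- whereas the chain runs over it as a reflex vertex.
    · rcases Nat.eq_zero_or_pos p with rfl | hp0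
      · exfalso
        rw [(h.start_chain ⟨_, hc⟩).1] at hc e hr
        exact hr 3 le_rfl (by omega) (h.convex_three hc)
      · have := (h.processed_convex hp ((h.convex_iff p).mpr hcp)).2 hp0
        exact (h.convex_iff_of_int (by omega)).mp this
    · exact absurd ((h.convex_iff _).mpr hce) (hr _ e le_rfl)
  · have hg : w.bwdConvex (w.chainEnd (Near γ o i) p) = w.fwdConvex p := by
      refine Walk.bwdConvex_eq (by omega) h2 fun k k1 k2 hk => ?_
      by_cases k3 : k = w.fwdConvex p + 1
      · exact hc (k3 ▸ hk)
      · exact hr k (by omega) (by omega) hk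
    rw [hg] at hbwd
    exact ⟨_, by omega, ⟨h.bd, h.fwd hs hp, hbwd, Or.inl rfl⟩⟩

/-- The last chain of a traversal. -/
theorem last_chain (h : IsTraversal P A γ o i w) {p : ℕ} (hs : w.Step1 (Near γ o i) p)
    (hp : w.IsProcessed (Near γ o i) p) (hl : w.len ≤ w.fwdConvex p) :
    w.next (Near γ o i) p = w.len ∧ 2 ≤ w.next (Near γ o i) 0 ∧ w.next (Near γ o i) 0 ≤ p ∧
      ∀ a : ℤ, p ≤ a → a < w.len →
        IsChain P A γ o i w.seq a (w.len + w.next (Near γ o i) 0 : ℕ) := by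
  obtain ⟨h1, h2, h3⟩ := Walk.fwdConvex_spec hs.1
  obtain ⟨e1, e2, e3, e4, e5, e6⟩ := h.start_chain ⟨_, h2⟩
  have hm := h.two_le_len
  have hpm := hp.1
  have hp0 : 0 < p := by
    by_contra hcon
    obtain rfl : p = 0 := by omega
    omega
  refine ⟨?_, e3, h.next_le_of_lt h.processed_zero hp hp0, fun a ha1 ha2 => ?_⟩
  · unfold Walk.next
    rw [if_pos hs, if_pos hl]
  set S := w.next (Near γ o i) 0
  have hS := h.bwd e4 fun hc => by rw [e5]; exact (e6 hc).1
  rw [e5] at hS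
  have hV : ∀ k, w.seq (-(k + -(w.len : ℤ))) = w.seq (-k) := by
    intro k
    rw [show -(k + -(w.len : ℤ)) = -k + 1 * w.len by ring, IsBoundaryWalk.seq_add_mul]
  have hS' := hS.shift hV
  rw [show -(S : ℤ) + -(w.len : ℤ) = -((w.len + S : ℕ) : ℤ) by push_cast; ring,
    show -((1 : ℕ) : ℤ) + -(w.len : ℤ) = -((w.len : ℤ) + 1) by push_cast; ring] at hS'
  have hF := h.fwd hs hp
  have hc1 : w.IsConvex (1 + w.len) := (h.convex_add_len 1).mpr (h.convex_one ⟨_, h2⟩)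
  -- The copy of `v₁` one period later is convex, so the forward convex vertex is `v_m` or
  -- `v_{m+1}`: these are the two cases of `Pair.convex` with `g = m + 1`.
  have hle : w.fwdConvex p ≤ w.len + 1 := by
    by_contra hcon
    exact h3 _ (by omega) (by omega) hc1
  have hpair : Pair P A γ o i 1 w.seq p (w.fwdConvex p) (w.len + 1) (w.len + S : ℕ) := by
    refine ⟨h.bd, hF, hS', ?_⟩
    rcases (show w.fwdConvex p = w.len + 1 ∨ w.fwdConvex p = w.len by omega) with e | e
    · left; rw [e]; push_cast; rfl
    · right
      refine ⟨by rw [e], fun hc => ?_, fun hc => ?_⟩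
      · have := (h.processed_convex hp ((h.convex_iff p).mpr hc)).2 hp0
        exact (h.convex_iff_of_int (by omega)).mp this
      · have hc' := (h.convex_iff _).mpr hc
        rw [add_comm, h.convex_add_len] at hc'
        obtain ⟨e7, e8⟩ := e6 hc'
        exact (h.convex_iff_of_int (k := 3 + w.len) (by omega)).mp ((h.convex_add_len 3).mpr e8)
  refine hpair.isChain ha1 (by omega) (by push_cast; omega) le_rfl

/-- The possible positions of the end points of an added edge. -/
theorem adds_cases (h : IsTraversal P A γ o i w) {a b : ℕ} (hab : w.Adds (Near γ o i) a b) :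
    IsChain P A γ o i w.seq a b ∧ ∃ p c, w.IsProcessed (Near γ o i) p ∧ c = w.fwdConvex p ∧
    ((w.next (Near γ o i) p ≤ w.len ∧ c < w.len ∧
        ((p ≤ a ∧ a < c ∧ b = c + 1 ∧ b ≤ w.next (Near γ o i) p) ∨
          (a = p ∧ p < c ∧ c + 1 < b ∧ b ≤ w.next (Near γ o i) p))) ∨
      (w.next (Near γ o i) p = w.len ∧ w.len ≤ c ∧ 2 ≤ w.next (Near γ o i) 0 ∧
        w.next (Near γ o i) 0 ≤ p ∧ p ≤ a ∧ a < w.len ∧ b = w.len + w.next (Near γ o i) 0)) := by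
  obtain ⟨p, hp, hs, hcase⟩ := hab
  obtain ⟨h1, h2, h3⟩ := Walk.fwdConvex_spec hs.1
  have hF := h.fwd hs hp
  rcases hcase with ⟨hlt, hcase⟩ | ⟨hle, ha1, ha2, hb⟩
  · have hn : w.next (Near γ o i) p = w.chainEnd (Near γ o i) p := by
      unfold Walk.next
      rw [if_pos hs, if_neg (by omega)]
    have hcl := h.chainEnd_le h2 hlt
    have hce := h.le_chainEnd h2
    rcases hcase with ⟨ha1, ha2, rfl⟩ | ⟨rfl, hb1, hb2⟩
    · refine ⟨?_, p, _, hp, rfl, Or.inl ⟨by omega, hlt, Or.inl ⟨ha1, ha2, rfl, by omega⟩⟩⟩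
      have := hF.isChain h.bd (j := a) (by omega) (by omega)
      rwa [Nat.cast_add, Nat.cast_one]
    · refine ⟨?_, a, _, hp, rfl, Or.inl ⟨by omega, hlt, Or.inr ⟨rfl, h1, hb1, by omega⟩⟩⟩
      obtain ⟨g, hg, hpair⟩ := h.pair_of_chainEnd hs hp (by omega)
      exact hpair.isChain le_rfl (by omega) (by omega) (by omega)
  · obtain ⟨l1, l2, l3, l4⟩ := h.last_chain hs hp hle
    refine ⟨?_, p, _, hp, rfl, Or.inr ⟨l1, hle, l2, l3, ha1, ha2, hb⟩⟩
    rw [hb]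
    exact l4 a (by omega) (by omega)

/-- The chains of a traversal are nested or disjoint. -/
theorem adds_laminar (h : IsTraversal P A γ o i w) {a b a' b' : ℕ}
    (hab : w.Adds (Near γ o i) a b) (hab' : w.Adds (Near γ o i) a' b') {k j : ℤ} (hak : a < k)
    (hkb : k < b) (hk : k = a' + j * w.len ∨ k = b' + j * w.len) : b' - a' < b - a := by
  obtain ⟨-, p, c, hp, hc, h1⟩ := h.adds_cases hab
  obtain ⟨-, p', c', hp', hc', h2⟩ := h.adds_cases hab'
  have hm := h.two_le_len
  have l1 := h.next_le_of_lt hp hp'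
  have l2 := h.next_le_of_lt hp' hp
  have l3 := h.next_le_of_lt h.processed_zero hp
  have l4 := h.next_le_of_lt h.processed_zero hp'
  have l5 : p = p' → c = c' := fun e => by rw [hc, hc', e]
  have l6 : p = 0 → w.next (Near γ o i) p = w.next (Near γ o i) 0 := fun e => by rw [e]
  have l7 : p' = 0 → w.next (Near γ o i) p' = w.next (Near γ o i) 0 := fun e => by rw [e]
  have l8 : p = p' → w.next (Near γ o i) p = w.next (Near γ o i) p' := fun e => by rw [e]
  have hpm := hp.1
  have hpm' := hp'.1
  clear hp hp' hc hc' hab hab'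
  generalize w.next (Near γ o i) 0 = S at *
  generalize w.next (Near γ o i) p = n at *
  generalize w.next (Near γ o i) p' = n' at *
  generalize w.len = m at *
  -- All chains lie within two periods, so only neighbouring copies can interfere; the remaining
  -- cases are linear arithmetic from the order of the handled positions.
  have hj : j = -1 ∨ j = 0 ∨ j = 1 := by
    by_contra hcon
    rcases (show j ≤ -2 ∨ 2 ≤ j by omega) with hj | hj
    · have : j * (m : ℤ) ≤ -2 * m := mul_le_mul_of_nonneg_right hj (by omega)
      omega
    · have : 2 * (m : ℤ) ≤ j * m := mul_le_mul_of_nonneg_right hj (by omega)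
      omega
  rcases hj with rfl | rfl | rfl
  · omega
  · omega
  · omega

end IsTraversal

end

section

variable {P : Finset ℂ} {A B : SimpleGraph ℂ} {γ : ℝ} {o : ℂ} {i : ℕ} {w w' : Walk} {s : ℝ}
  {V V' : ℤ → ℂ} {W : Set Walk}

/-! ### Crossings of added edges -/

/-- A direction lies in one corner only. -/
theorem Bd.prev_eq_of_inC (h : Bd P A γ o i s V) (h' : Bd P A γ o i s V') {k l : ℤ} {d : ℂ}
    (e : V k = V' l) (hd : d ≠ V k) (h1 : InC s V k d) (h2 : InC s V' l d) :
    V (k - 1) = V' (l - 1) := by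
  have hu := (h.adj' k).ne'
  have hu' : V' (l - 1) ≠ V k := by rw [e]; exact (h'.adj' l).ne'
  have t1 := lt_of_lt_of_le h1 (h.turn k (V' (l - 1)) (e ▸ h'.adj' l))
  have t2 := lt_of_lt_of_le h2 (h'.turn l (V (k - 1)) (e ▸ h.adj' k))
  rw [← e] at t2
  have p1 := ang_le s (V k) d (V' (l - 1))
  have p2 := ang_le s (V k) d (V (k - 1))
  have p3 := ang_le s (V k) (V (k - 1)) (V' (l - 1))
  have p4 := ang_le s (V k) (V' (l - 1)) (V (k - 1))
  have p5 := ang_pos s (V k) (V (k - 1)) d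
  have p6 := ang_pos s (V k) (V' (l - 1)) d
  have p7 := ang_pos s (V k) d (V' (l - 1))
  have p8 := ang_pos s (V k) d (V (k - 1))
  have a1 := ang_add s hu hd hu'
  have a2 := ang_add s hu' hd hu
  have a3 := ang_add s hd hu hd
  have a4 := ang_add s hd hu' hd
  rw [ang_self s hd] at a3 a4
  refine h.ang_eq_two_pi (h.mem k) (h.mem _) (h'.mem _) hu hu' ?_
  rcases a1 with a1 | a1 <;> rcases a2 with a2 | a2 <;> rcases a3 with a3 | a3 <;>
    rcases a4 with a4 | a4 <;> linarith

/-- Both occurrences of the directed edge are advanced by the same number of steps until one index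
is a multiple of the length; minimality of the walk then makes the other one a multiple, too. -/
theorem IsTraversal.dvd_of_eq (h : IsTraversal P A γ o i w) {k l : ℤ} (e0 : w.seq k = w.seq l)
    (e1 : w.seq (k + 1) = w.seq (l + 1)) : ∃ j : ℤ, k = l + j * w.len := by
  have hm : (0 : ℤ) < w.len := by exact_mod_cast h.walk.len_pos
  obtain ⟨n, hn⟩ := Int.eq_ofNat_of_zero_le (Int.emod_nonneg (-k) hm.ne')
  have hk := Int.emod_add_mul_ediv (-k) w.len
  rw [hn] at hk
  have hadd := h.bd.eq_add e0 e1 n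
  have ek : k + n = 0 + (-(-k / w.len)) * w.len := by linarith
  have hl := Int.emod_add_mul_ediv (l + n) w.len
  obtain ⟨t, ht⟩ := Int.eq_ofNat_of_zero_le (Int.emod_nonneg (l + n) hm.ne')
  have htm := Int.emod_lt_of_pos (l + n) hm
  rw [ht] at hl htm
  have el : l + n = t + ((l + n) / w.len) * w.len := by linarith
  rw [ek, el] at hadd
  rw [show ∀ q : ℤ, 0 + q * w.len + 1 = 1 + q * w.len by intro q; ring,
    show ∀ q : ℤ, (t : ℤ) + q * w.len + 1 = (t + 1 : ℕ) + q * w.len by intro q; push_cast; ring,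
    IsBoundaryWalk.seq_add_mul, IsBoundaryWalk.seq_add_mul, IsBoundaryWalk.seq_add_mul,
    IsBoundaryWalk.seq_add_mul, h.walk.seq_natCast, h.walk.seq_natCast] at hadd
  have z0 := h.walk.seq_natCast 0
  have z1 := h.walk.seq_natCast 1
  rw [Nat.cast_zero] at z0
  rw [Nat.cast_one] at z1
  rw [z0, z1] at hadd
  have ht0 : t = 0 := by
    by_contra hcon
    exact h.walk.minimal t (by omega) (by exact_mod_cast htm) ⟨hadd.1.symm, hadd.2.symm⟩
  rw [ht0, Nat.cast_zero] at el
  exact ⟨-(-k / w.len) - (l + n) / w.len, by linarith⟩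

theorem IsTraversalFamily.isTraversal (hW : IsTraversalFamily P A W)
    (hG : IsLevelGraph P A γ o i) (hw : w ∈ W) : IsTraversal P A γ o i w :=
  ⟨hG, (hW.1 w hw).1, (hW.1 w hw).2.1, (hW.1 w hw).2.2⟩

/-- A direction lies in one corner of one walk only. -/
theorem IsTraversalFamily.eq_of_inC (hW : IsTraversalFamily P A W) (hG : IsLevelGraph P A γ o i)
    (hw : w ∈ W) (hw' : w' ∈ W) {k l : ℤ} {d : ℂ} (e : w.seq k = w'.seq l) (hd : d ≠ w.seq k)
    (h1 : InC 1 w.seq k d) (h2 : InC 1 w'.seq l d) :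
    w = w' ∧ ∃ j : ℤ, k = l + j * w.len := by
  have h := hW.isTraversal hG hw
  have h' := hW.isTraversal hG hw'
  have hp := h.bd.prev_eq_of_inC h'.bd e hd h1 h2
  have f1 := h.walk.seq_faceOnRight hG.pslg h.nontri.1 (k - 1)
  have f2 := h'.walk.seq_faceOnRight hG.pslg h'.nontri.1 (l - 1)
  rw [sub_add_cancel] at f1 f2
  rw [← hp, ← e] at f2
  have hf := eq_of_faceOnRight h.nontri.1 h'.nontri.1 f1 f2
  have hidx : ∀ {v : Walk}, IsBoundaryWalk A v → ∀ k : ℤ,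
      ∃ n, v.vert n = v.seq (k - 1) ∧ v.vert (n + 1) = v.seq k := by
    intro v hv k
    obtain ⟨n, hn⟩ := hv.exists_nat (k - 1)
    have n0 := hn 0
    have n1 := hn 1
    simp only [Nat.cast_zero, add_zero, Nat.cast_one, sub_add_cancel] at n0 n1
    exact ⟨n, n0.symm, n1.symm⟩
  obtain rfl : w = w' := by
    refine (hW.2 w.face h.nontri (w.seq (k - 1)) (w.seq k) (h.bd.adj' k).symm f1).unique
      ⟨hw, rfl, hidx h.walk k⟩ ⟨hw', hf.symm, ?_⟩
    obtain ⟨n, n0, n1⟩ := hidx h'.walk l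
    exact ⟨n, n0.trans hp.symm, n1.trans e.symm⟩
  refine ⟨rfl, ?_⟩
  obtain ⟨j, hj⟩ := h.dvd_of_eq (k := k - 1) (l := l - 1) hp (by rwa [sub_add_cancel, sub_add_cancel])
  exact ⟨j, by linarith⟩

theorem IsChain.unc {a b : ℤ} (hc : IsChain P A γ o i V a b) (hA : IsPSLG P A) :
    Unc A (V a) (V b) := hc.edge.elim hA.unc Diag.unc

theorem IsChain.ne {a b : ℤ} (hc : IsChain P A γ o i V a b) : V a ≠ V b :=
  hc.edge.elim SimpleGraph.Adj.ne Diag.ne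

/-- The second edge must be a diagonal, since edges of `A` cross no added edge. It ends in a corner
at an inner vertex of the first chain; a corner determines the walk and the index up to periods, so
the nesting of chains applies. -/
theorem IsTraversalFamily.lt_of_crosses (hW : IsTraversalFamily P A W)
    (hG : IsLevelGraph P A γ o i) (hw : w ∈ W) (hw' : w' ∈ W) {a b a' b' : ℕ}
    (hab : w.Adds (Near γ o i) a b) (hab' : w'.Adds (Near γ o i) a' b')
    (hc : Crosses (w.vert a) (w.vert b) (w'.vert a') (w'.vert b')) : b' - a' < b - a := by
  have h := hW.isTraversal hG hw
  have h' := hW.isTraversal hG hw'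
  have c1 := (h.adds_cases hab).1
  have c2 := (h'.adds_cases hab').1
  have hc' := hc
  simp only [← h.walk.seq_natCast, ← h'.walk.seq_natCast] at hc'
  rcases c2.edge with hadj | hd
  · exact absurd hc' (c1.unc hG.pslg _ _ hadj)
  obtain ⟨k, k1, k2, ⟨e, hk⟩ | ⟨e, hk⟩⟩ := c1.tree.exists_of_crosses h.bd (h'.bd.mem a')
    (h'.bd.mem b') hd.ne hd.unc hc'
  · obtain ⟨rfl, j, hj⟩ := hW.eq_of_inC hG hw hw' e.symm (e ▸ hd.ne.symm) hk hd.left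
    exact h.adds_laminar hab hab' k1 k2 (Or.inl hj)
  · obtain ⟨rfl, j, hj⟩ := hW.eq_of_inC hG hw hw' e.symm (e ▸ hd.ne) hk hd.right
    exact h.adds_laminar hab hab' k1 k2 (Or.inr hj)

/-- No two added edges cross. -/
theorem IsTraversalFamily.not_crosses (hW : IsTraversalFamily P A W)
    (hG : IsLevelGraph P A γ o i) (hw : w ∈ W) (hw' : w' ∈ W) {a b a' b' : ℕ}
    (hab : w.Adds (Near γ o i) a b) (hab' : w'.Adds (Near γ o i) a' b') :
    ¬ Crosses (w.vert a) (w.vert b) (w'.vert a') (w'.vert b') := fun hc =>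
  lt_asymm (hW.lt_of_crosses hG hw hw' hab hab' hc)
    (hW.lt_of_crosses hG hw' hw hab' hab (crosses_symm hc))

theorem IsTraversal.unc (h : IsTraversal P A γ o i w) {a b : ℕ} (hab : w.Adds (Near γ o i) a b) :
    Unc A (w.vert a) (w.vert b) := by
  have := (h.adds_cases hab).1.unc h.graph.pslg
  rwa [h.walk.seq_natCast, h.walk.seq_natCast] at this

/-- The region enclosed by a chain and the added edge contains no point. -/
theorem IsTraversal.notMem_region (h : IsTraversal P A γ o i w) {a b : ℕ}
    (hab : w.Adds (Near γ o i) a b) {z : ℂ} (hz : z ∈ P) : z ∉ w.region a b := by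
  rintro ⟨h1, -, h3⟩
  have hc := (h.adds_cases hab).1
  have hlt : a < b := by exact_mod_cast hc.tree.lt
  have hne : ∀ k : ℕ, a ≤ k → k ≤ b → z ≠ w.vert k := by
    rintro k k1 k2 rfl
    rcases k2.lt_or_eq with k3 | rfl
    · exact h1 k k1 k3 (left_mem_segment ℝ _ _)
    · refine h1 (k - 1) (by omega) (by omega) ?_
      rw [Nat.sub_add_cancel (by omega)]
      exact right_mem_segment ℝ _ _
  have hsum := hc.tree.sum_arg hz fun k k1 k2 => by
    obtain ⟨n, rfl⟩ := Int.eq_ofNat_of_zero_le (show 0 ≤ k by omega)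
    rw [h.walk.seq_natCast]
    exact hne n (by omega) (by omega)
  have hI : Finset.Ico (a : ℤ) b = (Finset.Ico a b).image (fun n : ℕ => (n : ℤ)) := by
    ext k
    simp only [Finset.mem_Ico, Finset.mem_image]
    refine ⟨fun hk => ⟨k.toNat, by omega, by omega⟩, ?_⟩
    rintro ⟨n, hn, rfl⟩
    omega
  rw [hI, Finset.sum_image (fun x _ y _ hxy => by exact_mod_cast hxy)] at hsum
  have hinv := arg_add_arg_inv h.graph.gp (h.bd.mem a) (h.bd.mem b) hz hc.ne
    (by rw [h.walk.seq_natCast]; exact hne a le_rfl hlt.le)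
    (by rw [h.walk.seq_natCast]; exact hne b hlt.le le_rfl)
  rw [← hsum] at hinv
  apply h3
  simp only [← h.walk.seq_natCast]
  push_cast
  exact hinv

/-! ### The graphs of the algorithm -/

/-- In general position no point of `P` is inside a segment between two others, so the absence of
proper crossings is all that remains to be checked. -/
theorem isPSLG_of_not_crosses (gp : GeneralPosition P)
    (hP : ∀ u v, A.Adj u v → u ∈ P ∧ v ∈ P)
    (hc : ∀ u v x y, A.Adj u v → A.Adj x y → ¬ Crosses u v x y) : IsPSLG P A where
  endpoints := hP
  vertex_not_inside := fun u v huv p hp =>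
    gp.not_mem_openSegment (hP u v huv).1 (hP u v huv).2 hp huv.ne
  noncrossing := by
    intro u v x y huv hxy hne z hz hz'
    have ho : ∀ {u v : ℂ}, z ∈ segment ℝ u v → ¬ (z = u ∨ z = v) → z ∈ openSegment ℝ u v := by
      intro u v h1 h2
      rw [not_or] at h2
      exact mem_openSegment_of_mem_segment h1 h2.1 h2.2
    have hmem : ∀ {u v : ℂ}, A.Adj u v → z = u ∨ z = v → z ∈ P := by
      rintro u v huv (rfl | rfl)
      exacts [(hP _ _ huv).1, (hP _ _ huv).2]
    have hno : ∀ {u v : ℂ}, A.Adj u v → z ∈ P → z ∈ segment ℝ u v → z = u ∨ z = v := by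
      intro u v huv h1 h2
      by_contra hcon
      exact gp.not_mem_openSegment (hP u v huv).1 (hP u v huv).2 h1 huv.ne (ho h2 hcon)
    by_cases h1 : z = u ∨ z = v
    · exact ⟨h1, hno hxy (hmem huv h1) hz'⟩
    by_cases h2 : z = x ∨ z = y
    · exact ⟨hno huv (hmem hxy h2) hz, h2⟩
    exact absurd ⟨hne, z, ho hz h1, ho hz' h2⟩ (hc u v x y huv hxy)

/-- Greedy extension leaves out only segments that are crossed, which is precisely the maximality in
the invariant. The old edges must be near in the current grid, too. -/
theorem IsGreedyExtension.isLevelGraph (gp : GeneralPosition P) (hB : IsPSLG P B)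
    (hn : ∀ u v, B.Adj u v → Near γ o i u v)
    (h : IsGreedyExtension B (adjGraph P γ o i) A) : IsLevelGraph P A γ o i := by
  have hadj : ∀ u v, A.Adj u v → u ∈ P ∧ v ∈ P ∧ Near γ o i u v := by
    intro u v huv
    by_cases hb : B.Adj u v
    · exact ⟨(hB.endpoints u v hb).1, (hB.endpoints u v hb).2, hn u v hb⟩
    · have := (h.2.1 u v huv hb).1
      unfold adjGraph at this
      rw [SimpleGraph.fromRel_adj] at this
      rcases this.2 with e | e
      · exact e
      · exact ⟨e.2.1, e.1, e.2.2.symm⟩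
  refine ⟨gp, isPSLG_of_not_crosses gp (fun u v huv => ⟨(hadj u v huv).1, (hadj u v huv).2.1⟩) ?_,
    fun u v huv => (hadj u v huv).2.2, ?_⟩
  · intro u v x y huv hxy hc
    by_cases hb : B.Adj u v
    · by_cases hb' : B.Adj x y
      · exact hB.unc hb x y hb' hc
      · exact (h.2.1 x y hxy hb').2 u v huv (crosses_symm hc)
    · exact (h.2.1 u v huv hb).2 x y hxy hc
  · intro u hu v hv huv hnear hunc
    by_contra hcon
    obtain ⟨x, y, hxy, hc⟩ := h.2.2 u v
      (by unfold adjGraph; rw [SimpleGraph.fromRel_adj]; exact ⟨huv, Or.inl ⟨hu, hv, hnear⟩⟩) hcon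
    exact hunc x y hxy hc

theorem phaseOne_adj {u v : ℂ} (h : (phaseOne γ o i A W).Adj u v) : A.Adj u v ∨
    ∃ w ∈ W, ∃ a b, w.Adds (Near γ o i) a b ∧
      ((u = w.vert a ∧ v = w.vert b) ∨ (u = w.vert b ∧ v = w.vert a)) := by
  unfold phaseOne at h
  rw [SimpleGraph.sup_adj, SimpleGraph.fromEdgeSet_adj] at h
  rcases h with h | ⟨⟨w, hw, a, b, hab, e⟩, -⟩
  · exact Or.inl h
  · exact Or.inr ⟨w, hw, a, b, hab, Sym2.eq_iff.mp e⟩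

theorem CellDist.symm {n : ℤ} {u v : ℂ} (h : CellDist γ o i n u v) : CellDist γ o i n v u := by
  unfold CellDist at *
  rwa [abs_sub_comm, abs_sub_comm (cell γ o i v).2]

theorem phaseOne_cellDist (hG : IsLevelGraph P A γ o i) (hW : IsTraversalFamily P A W) {u v : ℂ}
    (h : (phaseOne γ o i A W).Adj u v) : CellDist γ o i 3 u v := by
  rcases phaseOne_adj h with h | ⟨w, hw, a, b, hab, e⟩
  · exact (hG.near u v h).cellDist.mono (by norm_num)
  · have ht := hW.isTraversal hG hw
    have := (ht.adds_cases hab).1.dist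
    rw [ht.walk.seq_natCast, ht.walk.seq_natCast] at this
    rcases e with ⟨rfl, rfl⟩ | ⟨rfl, rfl⟩
    · exact this
    · exact this.symm

theorem phaseOne_isPSLG (hG : IsLevelGraph P A γ o i) (hW : IsTraversalFamily P A W) :
    IsPSLG P (phaseOne γ o i A W) := by
  refine isPSLG_of_not_crosses hG.gp ?_ ?_
  · intro u v huv
    rcases phaseOne_adj huv with h | ⟨w, hw, a, b, hab, e⟩
    · exact hG.pslg.endpoints u v h
    · have ht := hW.isTraversal hG hw
      have hm : ∀ k : ℕ, w.vert k ∈ P := fun k => by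
        have := ht.bd.mem k; rwa [ht.walk.seq_natCast] at this
      rcases e with ⟨rfl, rfl⟩ | ⟨rfl, rfl⟩
      exacts [⟨hm _, hm _⟩, ⟨hm _, hm _⟩]
  · intro u v x y huv hxy
    rcases phaseOne_adj huv with h | ⟨w, hw, a, b, hab, e⟩ <;>
      rcases phaseOne_adj hxy with h' | ⟨w', hw', a', b', hab', e'⟩
    · exact hG.pslg.unc h x y h'
    · have := fun hc => (hW.isTraversal hG hw').unc hab' u v h (crosses_symm hc)
      rcases e' with ⟨rfl, rfl⟩ | ⟨rfl, rfl⟩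
      · exact this
      · exact fun hc => this (crosses_swap_right hc)
    · have := (hW.isTraversal hG hw).unc hab x y h'
      rcases e with ⟨rfl, rfl⟩ | ⟨rfl, rfl⟩
      · exact this
      · exact fun hc => this (crosses_swap_left hc)
    · have := hW.not_crosses hG hw hw' hab hab'
      rcases e with ⟨rfl, rfl⟩ | ⟨rfl, rfl⟩ <;> rcases e' with ⟨rfl, rfl⟩ | ⟨rfl, rfl⟩
      · exact this
      · exact fun hc => this (crosses_swap_right hc)
      · exact fun hc => this (crosses_swap_left hc)
      · exact fun hc => this (crosses_swap_left (crosses_swap_right hc))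

theorem Reaches.isLevelGraph (gp : GeneralPosition P) {i₀ : ℕ} (h : Reaches P γ o i₀ i A W) :
    IsLevelGraph P A γ o i ∧ IsTraversalFamily P A W := by
  induction h with
  | first A W hA hW =>
    refine ⟨hA.isLevelGraph gp (isPSLG_of_not_crosses gp ?_ ?_) ?_, hW⟩
    · intro u v huv; simp at huv
    · intro u v x y huv; simp at huv
    · intro u v huv; simp at huv
  -- The distance bound of three cells at one level supplies the nearness of all inherited edges at
  -- the next.
  | later i A A' W W' _ hA hW ih =>
    exact ⟨hA.isLevelGraph gp (phaseOne_isPSLG ih.1 ih.2)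
      fun u v huv => (phaseOne_cellDist ih.1 ih.2 huv).near_succ, hW⟩

end

end

end GridTriangulation

theorem mainTheorem1 (P : Finset ℂ) (hP : GridTriangulation.GeneralPosition P)
    (γ : ℝ) (hγ : 0 < γ) (o : ℂ) (i₀ i : ℕ) (A : SimpleGraph ℂ)
    (W : Set GridTriangulation.Walk) (hrun : GridTriangulation.Reaches P γ o i₀ i A W) :
    GridTriangulation.IsPSLG P (GridTriangulation.phaseOne γ o i A W) ∧
    (∀ u v, (GridTriangulation.phaseOne γ o i A W).Adj u v → ¬ A.Adj u v →
      dist u v ≤ 4 * √2 * (γ * (3 : ℝ) ^ ((i : ℤ) - 1))) ∧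
    (∀ w ∈ W, ∀ a b, w.Adds (GridTriangulation.Near γ o i) a b →
      (∀ p ∈ P, p ∉ w.region a b) ∧
      (∀ x y, A.Adj x y → ¬ GridTriangulation.Crosses (w.vert a) (w.vert b) x y) ∧
      (∀ w' ∈ W, ∀ a' b', w'.Adds (GridTriangulation.Near γ o i) a' b' →
        ¬ GridTriangulation.Crosses (w.vert a) (w.vert b) (w'.vert a') (w'.vert b'))) := by
  obtain ⟨hG, hW⟩ := hrun.isLevelGraph hP
  refine ⟨GridTriangulation.phaseOne_isPSLG hG hW, fun u v huv _ =>
      (GridTriangulation.phaseOne_cellDist hG hW huv).dist_le hγ,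
    fun w hw a b hab => ⟨fun p hp => (hW.isTraversal hG hw).notMem_region hab hp,
      (hW.isTraversal hG hw).unc hab,
      fun w' hw' a' b' hab' => hW.not_crosses hG hw hw' hab hab'⟩⟩
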